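/- Let $N\in\{2,3\}$ and $1<p<2^*$, where $2^*=\infty$ if $N=2$ and $2^*=1+\frac{4}{N-2}=5$ if $N=3$. Let $\gamma_1,\dots,\gamma_N>0$, $\gamma=\min_j\gamma_j$ and $V(x)=\sum_{j=1}^N\gamma_j^2x_j^2$. Let $\Omega\in\mathbb R^3$, with $\Omega=(0,0,\Omega_3)$ if $N=2$, and let $$L_\Omega u=-\Omega\cdot Lu,\qquad Lu=-i\,x\wedge\nabla u,$$ where for $N=2$ the vectors $x$ and $\nabla u$ are completed by a zero third component. Let $$\Sigma=\{u\in H^1(\mathbb R^N;\mathbb C): |x|u\in L^2(\mathbb R^N)\},\qquad \|u\|_\Sigma^2=\int_{\mathbb R^N}\big(|\nabla u|^2+|x|^2|u|^2+|u|^2\big)\,dx,$$ regarded as a real Banach space, and for $u\in\Sigma$ and $\omega\in\mathbb R$ let $$l_\Omega(u)=\int_{\mathbb R^N}(L_\Omega u)\,\overline u\,dx\in\mathbb R,\qquad \mathfrak t[u]=\|\nabla u\|_2^2+\int_{\mathbb R^N}V|u|^2\,dx+2\,l_\Omega(u),$$ $$S_\omega(u)=\tfrac12\mathfrak t[u]+\tfrac{\omega}{2}\|u\|_2^2-\tfrac{2}{p+1}\int_{\mathbb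 R^N}|u|^{p+1}dx,\qquad I_\omega(u)=\mathfrak t[u]+\omega\|u\|_2^2-2\int_{\mathbb R^N}|u|^{p+1}dx,$$ $$\lambda_0=-\inf\{\mathfrak t[u]: u\in\Sigma,\ \|u\|_2^2=1\},\qquad d(\omega)=\inf\{S_\omega(u): u\in\Sigma\setminus\{0\},\ I_\omega(u)=0\}.$$ Let $\mathcal A_\omega=\{\varphi\in\Sigma\setminus\{0\}: S_\omega'(\varphi)=0\}$, where $S_\omega'$ is the Fréchet derivative on $\Sigma$; this is the set of nontrivial solutions of the stationary equation $-\Delta\varphi+\omega\varphi+V\varphi-2|\varphi|^{p-1}\varphi+2L_\Omega\varphi=0$. The set of ground states is $$\mathcal G_\omega=\{\varphi\in\mathcal A_\omega: S_\omega(\varphi)\le S_\omega(v)\ \text{for all } v\in\mathcal A_\omega\}.$$ Assume $|\Omega|<\gamma$ and $\omega>\lambda_0$. Then $\mathcal G_\omega\ne\emptyset$, $d(\omega)>0$, and $$\mathcal G_\omega=\{\varphi\in\Sigma: S_\omega(\varphi)=d(\omega)\ \text{and}\ I_\omega(\varphi)=0\}.$$ -/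

import Mathlib

open MeasureTheory

/-- `u` has the weak gradient `g` on `ℝᴺ`:
`∫ u ∂ⱼψ = -∫ gⱼ ψ` for every `ψ ∈ C_c^∞(ℝᴺ)` and every `j`. -/
def IsWeakGradient {N : ℕ} (u : EuclideanSpace ℝ (Fin N) → ℂ)
    (g : EuclideanSpace ℝ (Fin N) → EuclideanSpace ℂ (Fin N)) : Prop :=
  ∀ ψ : EuclideanSpace ℝ (Fin N) → ℝ, ContDiff ℝ (⊤ : ℕ∞) ψ → HasCompactSupport ψ → ∀ j : Fin N,
    ∫ x, fderiv ℝ ψ x (EuclideanSpace.single j 1) • u x = -∫ x, ψ x • g x j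

/-- The Hilbert space `L² × L² × L²` of candidate triples `(u, ∇u, |x| u)`, with
`‖(u, g, w)‖² = ‖u‖₂² + (‖g‖₂² + ‖w‖₂²)`. -/
abbrev L2Triple (N : ℕ) : Type :=
  WithLp 2 (Lp ℂ 2 (volume : Measure (EuclideanSpace ℝ (Fin N))) ×
    WithLp 2 (Lp (EuclideanSpace ℂ (Fin N)) 2 (volume : Measure (EuclideanSpace ℝ (Fin N))) ×
      Lp ℂ 2 (volume : Measure (EuclideanSpace ℝ (Fin N)))))

theorem integrable_testFunction_smul {N : ℕ} {F : Type*} [NormedAddCommGroup F] [NormedSpace ℝ F]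
    (f : Lp F 2 (volume : Measure (EuclideanSpace ℝ (Fin N))))
    {ψ : EuclideanSpace ℝ (Fin N) → ℝ} (hψ : Continuous ψ) (hc : HasCompactSupport ψ) :
    Integrable (fun x => ψ x • f x) := by
  have h : LocallyIntegrable (f : EuclideanSpace ℝ (Fin N) → F) volume :=
    (Lp.memLp f).locallyIntegrable (by norm_num)
  exact h.integrable_smul_left_of_hasCompactSupport hψ hc

theorem integrable_testFunction_fderiv_smul {N : ℕ}
    (f : Lp ℂ 2 (volume : Measure (EuclideanSpace ℝ (Fin N))))
    {ψ : EuclideanSpace ℝ (Fin N) → ℝ} (hψ : ContDiff ℝ (⊤ : ℕ∞) ψ) (hc : HasCompactSupport ψ)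
    (v : EuclideanSpace ℝ (Fin N)) :
    Integrable (fun x => fderiv ℝ ψ x v • f x) :=
  integrable_testFunction_smul f
    ((hψ.continuous_fderiv (by simp)).clm_apply continuous_const) (hc.fderiv_apply ℝ v)

theorem integrable_testFunction_smul_apply {N : ℕ}
    (f : Lp (EuclideanSpace ℂ (Fin N)) 2 (volume : Measure (EuclideanSpace ℝ (Fin N))))
    {ψ : EuclideanSpace ℝ (Fin N) → ℝ} (hψ : Continuous ψ) (hc : HasCompactSupport ψ)
    (j : Fin N) : Integrable (fun x => ψ x • f x j) := by
  have h := (EuclideanSpace.proj j : EuclideanSpace ℂ (Fin N) →L[ℂ] ℂ).integrable_comp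
    (integrable_testFunction_smul f hψ hc)
  simpa using h

/-- The energy space `Σ = {u ∈ H¹(ℝᴺ; ℂ) : |x| u ∈ L²}`. A function `u ∈ Σ` is represented by the
triple `(u, ∇u, |x| u)`, whose last two entries are determined by `u` (see `SigmaSpace.ext_fn`).
The norm inherited from `L2Triple N` is the norm of `Σ`:
`‖u‖_Σ² = ∫ (|∇u|² + |x|² |u|² + |u|²)`. -/
def SigmaSpace (N : ℕ) : Submodule ℂ (L2Triple N) where
  carrier := {z | IsWeakGradient (z.fst : EuclideanSpace ℝ (Fin N) → ℂ) z.snd.fst ∧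
    (z.snd.snd : EuclideanSpace ℝ (Fin N) → ℂ) =ᵐ[volume]
      fun x : EuclideanSpace ℝ (Fin N) => ((‖x‖ : ℝ) : ℂ) * z.fst x}
  zero_mem' := ⟨fun ψ _ _ j => by simp, Filter.Eventually.of_forall fun x => by simp⟩
  add_mem' := by
    rintro a b ⟨ha, ha'⟩ ⟨hb, hb'⟩
    refine ⟨fun ψ hψ hc j => ?_, ?_⟩
    · have e1 : ∫ x, fderiv ℝ ψ x (EuclideanSpace.single j 1) • (a + b).fst x
          = ∫ x, (fderiv ℝ ψ x (EuclideanSpace.single j 1) • a.fst x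
            + fderiv ℝ ψ x (EuclideanSpace.single j 1) • b.fst x) := by
        refine integral_congr_ae ?_
        filter_upwards [Lp.coeFn_add a.fst b.fst] with x hx
        simp only [WithLp.add_fst, hx, Pi.add_apply, smul_add]
      have e2 : ∫ x, ψ x • (a + b).snd.fst x j
          = ∫ x, (ψ x • a.snd.fst x j + ψ x • b.snd.fst x j) := by
        refine integral_congr_ae ?_
        filter_upwards [Lp.coeFn_add a.snd.fst b.snd.fst] with x hx
        simp only [WithLp.add_fst, WithLp.add_snd, hx, Pi.add_apply, PiLp.add_apply, smul_add]
      rw [e1, e2, integral_add (integrable_testFunction_fderiv_smul _ hψ hc _)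
          (integrable_testFunction_fderiv_smul _ hψ hc _),
        integral_add (integrable_testFunction_smul_apply _ hψ.continuous hc j)
          (integrable_testFunction_smul_apply _ hψ.continuous hc j),
        ha ψ hψ hc j, hb ψ hψ hc j, neg_add]
    · filter_upwards [ha', hb', Lp.coeFn_add a.fst b.fst, Lp.coeFn_add a.snd.snd b.snd.snd]
        with x h1 h2 h3 h4
      simp only [WithLp.add_fst, WithLp.add_snd, h3, h4, Pi.add_apply, h1, h2, mul_add]
  smul_mem' := by
    rintro c a ⟨ha, ha'⟩
    refine ⟨fun ψ hψ hc j => ?_, ?_⟩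
    · have e1 : ∫ x, fderiv ℝ ψ x (EuclideanSpace.single j 1) • (c • a).fst x
          = ∫ x, c • (fderiv ℝ ψ x (EuclideanSpace.single j 1) • a.fst x) := by
        refine integral_congr_ae ?_
        filter_upwards [Lp.coeFn_smul c a.fst] with x hx
        simp only [WithLp.smul_fst, hx, Pi.smul_apply]
        rw [smul_comm]
      have e2 : ∫ x, ψ x • (c • a).snd.fst x j = ∫ x, c • (ψ x • a.snd.fst x j) := by
        refine integral_congr_ae ?_
        filter_upwards [Lp.coeFn_smul c a.snd.fst] with x hx
        simp only [WithLp.smul_fst, WithLp.smul_snd, hx, Pi.smul_apply, PiLp.smul_apply]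
        rw [smul_comm]
      rw [e1, e2, integral_smul, integral_smul, ha ψ hψ hc j, smul_neg]
    · filter_upwards [ha', Lp.coeFn_smul c a.fst, Lp.coeFn_smul c a.snd.snd] with x h1 h2 h3
      simp only [WithLp.smul_fst, WithLp.smul_snd, h2, h3, Pi.smul_apply, h1, smul_eq_mul]
      ring

/-- The function `u` itself. -/
noncomputable def fnOf {N : ℕ} (u : SigmaSpace N) : EuclideanSpace ℝ (Fin N) → ℂ := u.1.fst

/-- The weak gradient `∇u`. -/
noncomputable def gradOf {N : ℕ} (u : SigmaSpace N) :
    EuclideanSpace ℝ (Fin N) → EuclideanSpace ℂ (Fin N) := u.1.snd.fst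

/-- An element of `Σ` is determined by its underlying function. -/
theorem SigmaSpace.ext_fn {N : ℕ} {u v : SigmaSpace N} (h : fnOf u =ᵐ[volume] fnOf v) : u = v := by
  obtain ⟨a, ha, ha'⟩ := u
  obtain ⟨b, hb, hb'⟩ := v
  have h0 : (a.fst : EuclideanSpace ℝ (Fin N) → ℂ) =ᵐ[volume] b.fst := h
  have h1 : a.fst = b.fst := Lp.ext h0
  have h3 : a.snd.snd = b.snd.snd := by
    refine Lp.ext ?_
    filter_upwards [ha', hb', h0] with x e1 e2 e3
    rw [e1, e2, e3]
  have h2 : a.snd.fst = b.snd.fst := by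
    refine Lp.ext ?_
    have key : ∀ j : Fin N, ∀ᵐ x : EuclideanSpace ℝ (Fin N), a.snd.fst x j = b.snd.fst x j := by
      intro j
      have hloc : ∀ f : Lp (EuclideanSpace ℂ (Fin N)) 2
          (volume : Measure (EuclideanSpace ℝ (Fin N))),
          LocallyIntegrable (fun x => f x j) volume := by
        intro f
        have hm := (EuclideanSpace.proj j : EuclideanSpace ℂ (Fin N) →L[ℂ] ℂ).comp_memLp'
          (Lp.memLp f)
        exact MemLp.locallyIntegrable hm (by norm_num)
      refine ae_eq_of_integral_contDiff_smul_eq (hloc _) (hloc _) fun ψ hψ hc => ?_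
      have e1 := ha ψ hψ hc j
      have e2 := hb ψ hψ hc j
      rw [h1, e2] at e1
      exact (neg_injective e1).symm
    filter_upwards [ae_all_iff.2 key] with x hx
    ext j
    exact hx j
  apply Subtype.ext
  apply WithLp.ofLp_injective
  refine Prod.ext h1 ?_
  apply WithLp.ofLp_injective
  exact Prod.ext h2 h3

/-- The Sobolev exponent `2* = ∞` if `N = 2` and `2* = 1 + 4/(N-2)` otherwise. -/
noncomputable def critExponent (N : ℕ) : EReal :=
  if N = 2 then ⊤ else ((1 + 4 / ((N : ℝ) - 2) : ℝ) : EReal)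

/-- A vector with `N ≤ 3` entries, completed by zeros to three entries. -/
def toThree {N : ℕ} (v : Fin N → ℂ) : Fin 3 → ℂ :=
  fun k => if h : (k : ℕ) < N then v ⟨k, h⟩ else 0

/-- `L u = -i x ∧ ∇u`. For `N = 2` this is the vector `(0, 0, -i (x₁ ∂₂u - x₂ ∂₁u))`. -/
noncomputable def angularMomentum {N : ℕ} (u : SigmaSpace N) (x : EuclideanSpace ℝ (Fin N)) :
    Fin 3 → ℂ :=
  (-Complex.I) • crossProduct (toThree fun j => ((x j : ℝ) : ℂ)) (toThree fun j => gradOf u x j)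

/-- `L_Ω u = -Ω · L u`. -/
noncomputable def rotationOp {N : ℕ} (Ω : EuclideanSpace ℝ (Fin 3)) (u : SigmaSpace N)
    (x : EuclideanSpace ℝ (Fin N)) : ℂ :=
  -∑ k : Fin 3, ((Ω k : ℝ) : ℂ) * angularMomentum u x k

/-- `l_Ω(u) = ⟨L_Ω u, u⟩ = ∫ (L_Ω u) ū`, which is a real number. -/
noncomputable def rotationForm {N : ℕ} (Ω : EuclideanSpace ℝ (Fin 3)) (u : SigmaSpace N) : ℝ :=
  (∫ x, rotationOp Ω u x * (starRingEnd ℂ) (fnOf u x)).re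

/-- The harmonic potential `V(x) = ∑ⱼ γⱼ² xⱼ²`. -/
def harmonicPotential {N : ℕ} (γ : Fin N → ℝ) (x : EuclideanSpace ℝ (Fin N)) : ℝ :=
  ∑ j, γ j ^ 2 * x j ^ 2

/-- The quadratic form `𝔱[u] = ‖∇u‖₂² + ∫ V |u|² + 2 l_Ω(u)`. -/
noncomputable def rotForm {N : ℕ} (γ : Fin N → ℝ) (Ω : EuclideanSpace ℝ (Fin 3))
    (u : SigmaSpace N) : ℝ :=
  (∫ x, ‖gradOf u x‖ ^ 2) + (∫ x, harmonicPotential γ x * ‖fnOf u x‖ ^ 2) + 2 * rotationForm Ω u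

/-- `λ₀ = -inf {𝔱[u] : u ∈ Σ, ‖u‖₂² = 1}`. -/
noncomputable def lambdaZero {N : ℕ} (γ : Fin N → ℝ) (Ω : EuclideanSpace ℝ (Fin 3)) : ℝ :=
  -sInf {r | ∃ u : SigmaSpace N, (∫ x, ‖fnOf u x‖ ^ 2) = 1 ∧ r = rotForm γ Ω u}

/-- The action `S_ω(u) = ½ 𝔱[u] + (ω/2) ∫ |u|² - (2/(p+1)) ∫ |u|^{p+1}`. -/
noncomputable def actionS {N : ℕ} (p : ℝ) (γ : Fin N → ℝ) (Ω : EuclideanSpace ℝ (Fin 3)) (ω : ℝ)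
    (u : SigmaSpace N) : ℝ :=
  1 / 2 * rotForm γ Ω u + ω / 2 * (∫ x, ‖fnOf u x‖ ^ 2)
    - 2 / (p + 1) * ∫ x, ‖fnOf u x‖ ^ (p + 1)

/-- The Nehari functional `I_ω(u) = 𝔱[u] + ω ∫ |u|² - 2 ∫ |u|^{p+1}`. -/
noncomputable def nehariI {N : ℕ} (p : ℝ) (γ : Fin N → ℝ) (Ω : EuclideanSpace ℝ (Fin 3)) (ω : ℝ)
    (u : SigmaSpace N) : ℝ :=
  rotForm γ Ω u + ω * (∫ x, ‖fnOf u x‖ ^ 2) - 2 * ∫ x, ‖fnOf u x‖ ^ (p + 1)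

/-- `𝒜_ω = {φ ∈ Σ \ {0} : S_ω'(φ) = 0}`, with `S_ω'` the Fréchet derivative on the real Banach
space `Σ`: the nontrivial solutions of
`-Δφ + ωφ + Vφ - 2|φ|^{p-1}φ + 2 L_Ω φ = 0`. -/
def stationarySolutions {N : ℕ} (p : ℝ) (γ : Fin N → ℝ) (Ω : EuclideanSpace ℝ (Fin 3)) (ω : ℝ) :
    Set (SigmaSpace N) :=
  {φ | φ ≠ 0 ∧ HasFDerivAt (actionS p γ Ω ω) (0 : SigmaSpace N →L[ℝ] ℝ) φ}

/-- The ground states: the elements of `𝒜_ω` that minimize `S_ω` over `𝒜_ω`. -/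
def groundStates {N : ℕ} (p : ℝ) (γ : Fin N → ℝ) (Ω : EuclideanSpace ℝ (Fin 3)) (ω : ℝ) :
    Set (SigmaSpace N) :=
  {φ | φ ∈ stationarySolutions p γ Ω ω ∧
    ∀ v ∈ stationarySolutions p γ Ω ω, actionS p γ Ω ω φ ≤ actionS p γ Ω ω v}

/-- `d(ω) = inf {S_ω(u) : u ∈ Σ \ {0}, I_ω(u) = 0}`. -/
noncomputable def nehariLevel {N : ℕ} (p : ℝ) (γ : Fin N → ℝ) (Ω : EuclideanSpace ℝ (Fin 3))
    (ω : ℝ) : ℝ :=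
  sInf {r | ∃ u : SigmaSpace N, u ≠ 0 ∧ nehariI p γ Ω ω u = 0 ∧ r = actionS p γ Ω ω u}

/-!
The problem is an abstract Nehari problem, solved by the direct method. On the energy space `Σ` let
`B(u, u) = 𝔱[u] + ω ‖u‖₂²`, a bounded symmetric bilinear form, and `P(u) = ∫ |u|^q` with
`q = p + 1 > 2`; then `S_ω = ½ B - (2/q) P` and `I_ω = B - 2 P`. Four facts about `B` and `P`
suffice.

* `B` is coercive. Since `2 |l_Ω(u)| ≤ 2 ∫ |Ω| |x| |u| |∇u|` is at most the fraction `|Ω| / γ < 1` of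
  the harmonic oscillator energy, `𝔱` controls `‖∇u‖₂² + ‖|x| u‖₂²`
  (`SigmaSpace.rotForm_ge`); in particular the infimum defining `λ₀` is over a set bounded below,
  and `ω > λ₀` gives the missing multiple of `‖u‖₂²` (`SigmaSpace.exists_coercive`).
* `P(u) ≤ C ‖u‖^q`, by the Sobolev inequalities (`exists_sobolev_const`).
* `P` is weakly sequentially continuous: the weight `|x|` prevents loss of mass at infinity and
  mollification gives local compactness, so weakly null sequences tend to zero in `L²`
  (`SigmaSpace.tendsto_lintegral_enorm_sq`), and in the subcritical spaces by interpolation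
  (`SigmaSpace.tendsto_lintegral_enorm_rpow`).
* `P` is Fréchet differentiable (`SigmaSpace.differentiableAt_powInt`).

On the Nehari manifold `I = 0` the action equals `(1/2 - 1/q) B`, and `c ‖u‖² ≤ B = 2 P ≤ 2C ‖u‖^q`
keeps `u` away from the origin, so the level `d` is positive (`NehariData.level_pos`). The weak
limit of a minimizing sequence is nonzero because `P` passes to the limit; `B` is weakly lower
semicontinuous, so the limit can be scaled down to the manifold without increasing the action
(`NehariData.exists_minimizer`).

Every ray meets the manifold in one point, where the action is an increasing function of
`B^q / P^2`. A minimizer on the manifold therefore minimizes `q log B - 2 log P` over all nonzero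
vectors, and the derivative of this quotient vanishing is, on the manifold, the equation `S' = 0`:
no Lagrange multiplier is needed (`NehariData.hasFDerivAt_zero_of_minimizer`). Conversely Euler's
identity puts every critical point on the manifold (`NehariData.nehari_eq_zero_of_critical`), so
the least action among critical points is `d` and is attained exactly at the minimizers
(`NehariData.groundStates_eq`).
-/

open Filter Topology
open scoped ENNReal NNReal

/-! ### Minimization on the Nehari manifold -/

/-- Weak convergence of a sequence in a real normed space. -/
def WeakTendsto {H : Type*} [NormedAddCommGroup H] [NormedSpace ℝ H] (u : ℕ → H) (v : H) : Prop :=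
  ∀ f : H →L[ℝ] ℝ, Tendsto (fun n => f (u n)) atTop (𝓝 (f v))

/-- The data of an abstract Nehari problem with action `½ B(u, u) - (2/q) P(u)`: a symmetric
coercive continuous bilinear form `B` and a positive, `q`-homogeneous (`q > 2`), differentiable and
weakly sequentially continuous functional `P` on a space whose bounded sequences have weakly
convergent subsequences. -/
structure NehariData (H : Type*) [NormedAddCommGroup H] [NormedSpace ℝ H] where
  /-- the quadratic part of the action, as a bilinear form -/
  B : H →L[ℝ] H →L[ℝ] ℝ
  /-- the superquadratic part of the action -/
  P : H → ℝ
  /-- the degree of homogeneity of `P` -/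
  q : ℝ
  /-- a coercivity constant of `B` -/
  c : ℝ
  /-- a growth constant of `P` -/
  C : ℝ
  symm : ∀ u v, B u v = B v u
  c_pos : 0 < c
  coercive : ∀ u, c * ‖u‖ ^ 2 ≤ B u u
  two_lt : 2 < q
  homog : ∀ t : ℝ, 0 < t → ∀ u, P (t • u) = t ^ q * P u
  pos : ∀ u, u ≠ 0 → 0 < P u
  growth : ∀ u, P u ≤ C * ‖u‖ ^ q
  differentiable : ∀ u, DifferentiableAt ℝ P u
  weakCont : ∀ (u : ℕ → H) (v : H), WeakTendsto u v → (∃ M, ∀ n, ‖u n‖ ≤ M) →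
    Tendsto (fun n => P (u n)) atTop (𝓝 (P v))
  weakCompact : ∀ u : ℕ → H, (∃ M, ∀ n, ‖u n‖ ≤ M) →
    ∃ v, ∃ φ : ℕ → ℕ, StrictMono φ ∧ WeakTendsto (u ∘ φ) v

namespace NehariData

variable {H : Type*} [NormedAddCommGroup H] [NormedSpace ℝ H] (D : NehariData H)

/-- The action `½ B(u, u) - (2/q) P(u)`. -/
noncomputable def action (u : H) : ℝ := 1 / 2 * D.B u u - 2 / D.q * D.P u

/-- The Nehari functional `B(u, u) - 2 P(u)`. -/
noncomputable def nehari (u : H) : ℝ := D.B u u - 2 * D.P u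

/-- The infimum of the action over the Nehari manifold. -/
noncomputable def level : ℝ := sInf {r | ∃ u : H, u ≠ 0 ∧ D.nehari u = 0 ∧ r = D.action u}

theorem B_pos {u : H} (hu : u ≠ 0) : 0 < D.B u u := by
  have := D.coercive u
  have h1 : 0 < ‖u‖ := norm_pos_iff.2 hu
  have := D.c_pos
  have : 0 < D.c * ‖u‖ ^ 2 := by positivity
  linarith

/-- The positive factor in front of `B(u, u)` in the action on the Nehari manifold. -/
theorem factor_pos : 0 < 1 / 2 - 1 / D.q := by
  have h := D.two_lt
  rw [sub_pos]
  exact one_div_lt_one_div_of_lt (by norm_num) h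

theorem action_eq {u : H} (hu : D.nehari u = 0) :
    D.action u = (1 / 2 - 1 / D.q) * D.B u u := by
  have h : D.B u u = 2 * D.P u := by unfold nehari at hu; linarith
  have : D.P u = D.B u u / 2 := by linarith
  rw [action, this]
  have hq : D.q ≠ 0 := by have := D.two_lt; positivity
  field_simp

/-- The Nehari manifold stays away from the origin. -/
theorem exists_lower_bound : ∃ δ : ℝ, 0 < δ ∧ ∀ u, u ≠ 0 → D.nehari u = 0 → δ ≤ D.B u u := by
  have hc := D.c_pos
  have hq := D.two_lt
  set K : ℝ := max D.C 1
  have hK : 0 < K := lt_of_lt_of_le one_pos (le_max_right _ _)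
  -- `c ‖u‖² ≤ B(u, u) = 2 P(u) ≤ 2K ‖u‖^q` bounds `‖u‖` below.
  refine ⟨D.c * ((D.c / (2 * K)) ^ (1 / (D.q - 2))) ^ 2, by positivity, fun u hu h => ?_⟩
  have hn : 0 < ‖u‖ := norm_pos_iff.2 hu
  have h1 : D.B u u = 2 * D.P u := by unfold nehari at h; linarith
  have h2 : D.P u ≤ K * ‖u‖ ^ D.q := (D.growth u).trans (by gcongr; exact le_max_left _ _)
  have h3 := D.coercive u
  have e : ‖u‖ ^ D.q = ‖u‖ ^ 2 * ‖u‖ ^ (D.q - 2) := by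
    rw [← Real.rpow_natCast, ← Real.rpow_add hn]; norm_num
  rw [e] at h2
  have h4 : D.c * ‖u‖ ^ 2 ≤ (2 * K * ‖u‖ ^ (D.q - 2)) * ‖u‖ ^ 2 := by nlinarith
  have h5 : D.c ≤ 2 * K * ‖u‖ ^ (D.q - 2) := le_of_mul_le_mul_right h4 (by positivity)
  have h6 : D.c / (2 * K) ≤ ‖u‖ ^ (D.q - 2) := by
    rw [div_le_iff₀ (by positivity)]; linarith
  have h7 : (D.c / (2 * K)) ^ (1 / (D.q - 2)) ≤ ‖u‖ := by
    calc _ ≤ (‖u‖ ^ (D.q - 2)) ^ (1 / (D.q - 2)) :=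
          Real.rpow_le_rpow (by positivity) h6 (by apply one_div_nonneg.2; linarith)
      _ = ‖u‖ := by rw [one_div, Real.rpow_rpow_inv hn.le (by linarith)]
  calc _ ≤ D.c * ‖u‖ ^ 2 := by gcongr
    _ ≤ _ := h3

/-- Every ray meets the Nehari manifold, before or at `u` if `B(u, u) ≤ 2 P(u)`. -/
theorem exists_scaling {u : H} (hu : u ≠ 0) :
    ∃ t : ℝ, 0 < t ∧ D.nehari (t • u) = 0 ∧ (D.B u u ≤ 2 * D.P u → t ≤ 1) := by
  have hB := D.B_pos hu
  have hP := D.pos u hu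
  have hq := D.two_lt
  have hr : 0 < D.B u u / (2 * D.P u) := by positivity
  -- The solution of `t² B(u, u) = 2 t^q P(u)`.
  refine ⟨(D.B u u / (2 * D.P u)) ^ (1 / (D.q - 2)), by positivity, ?_, fun h => ?_⟩
  · set t := (D.B u u / (2 * D.P u)) ^ (1 / (D.q - 2)) with ht
    have htp : 0 < t := by positivity
    have e1 : t ^ (D.q - 2) = D.B u u / (2 * D.P u) := by
      rw [ht, one_div, Real.rpow_inv_rpow hr.le (by linarith)]
    have e : t ^ D.q = t ^ 2 * t ^ (D.q - 2) := by
      rw [← Real.rpow_natCast, ← Real.rpow_add htp]; norm_num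
    rw [nehari, D.homog t htp, e, e1]
    simp only [map_smul, smul_apply, smul_eq_mul]
    field_simp
    ring
  · apply Real.rpow_le_one hr.le
    · rw [div_le_one (by positivity)]; exact h
    · apply one_div_nonneg.2; linarith

theorem level_le {u : H} (hu : u ≠ 0) (h : D.nehari u = 0) : D.level ≤ D.action u := by
  refine csInf_le ⟨0, ?_⟩ ⟨u, hu, h, rfl⟩
  rintro _ ⟨v, hv, hI, rfl⟩
  rw [D.action_eq hI]
  exact mul_nonneg D.factor_pos.le (D.B_pos hv).le

theorem level_pos [Nontrivial H] : 0 < D.level := by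
  obtain ⟨δ, hδ, h⟩ := D.exists_lower_bound
  obtain ⟨u, hu⟩ := exists_ne (0 : H)
  obtain ⟨t, ht, hI, -⟩ := D.exists_scaling hu
  refine lt_of_lt_of_le (mul_pos D.factor_pos hδ)
    (le_csInf ⟨_, t • u, smul_ne_zero ht.ne' hu, hI, rfl⟩ ?_)
  rintro _ ⟨v, hv, hI, rfl⟩
  rw [D.action_eq hI]
  exact mul_le_mul_of_nonneg_left (h v hv hI) D.factor_pos.le

/-- The quadratic part is weakly lower semicontinuous, by convexity. -/
theorem B_le_of_weakTendsto {u : ℕ → H} {v : H} (h : WeakTendsto u v) {b : ℕ → ℝ} {β : ℝ}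
    (hb : ∀ n, D.B (u n) (u n) ≤ b n) (hβ : Tendsto b atTop (𝓝 β)) : D.B v v ≤ β := by
  have h1 : Tendsto (fun n => 2 * D.B v (u n) - D.B v v) atTop (𝓝 (2 * D.B v v - D.B v v)) :=
    ((h (D.B v)).const_mul 2).sub_const _
  have h2 : D.B v v = 2 * D.B v v - D.B v v := by ring
  rw [h2]
  refine le_of_tendsto_of_tendsto' h1 hβ fun n => le_trans ?_ (hb n)
  have h3 : 0 ≤ D.B (u n - v) (u n - v) :=
    le_trans (mul_nonneg D.c_pos.le (sq_nonneg _)) (D.coercive _)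
  simp only [map_sub, sub_apply] at h3
  rw [D.symm (u n) v] at h3
  linarith

/-- The direct method: the weak limit of a minimizing sequence is nonzero because `P` is weakly
continuous, and rescaling it to the Nehari manifold does not increase the action. -/
theorem exists_minimizer [Nontrivial H] :
    ∃ φ : H, D.action φ = D.level ∧ D.nehari φ = 0 := by
  obtain ⟨δ, hδ, hlow⟩ := D.exists_lower_bound
  obtain ⟨u₀, hu₀⟩ := exists_ne (0 : H)
  obtain ⟨t₀, ht₀, hI₀, -⟩ := D.exists_scaling hu₀
  have hne : {r | ∃ u : H, u ≠ 0 ∧ D.nehari u = 0 ∧ r = D.action u}.Nonempty :=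
    ⟨_, t₀ • u₀, smul_ne_zero ht₀.ne' hu₀, hI₀, rfl⟩
  have hbdd : BddBelow {r | ∃ u : H, u ≠ 0 ∧ D.nehari u = 0 ∧ r = D.action u} := by
    refine ⟨0, ?_⟩
    rintro _ ⟨v, hv, hI, rfl⟩
    rw [D.action_eq hI]
    exact mul_nonneg D.factor_pos.le (D.B_pos hv).le
  obtain ⟨r, -, hr, hmem⟩ := exists_seq_tendsto_sInf hne hbdd
  choose u hu hI hS using hmem
  have hκ := D.factor_pos
  set κ := 1 / 2 - 1 / D.q with hκd
  have hBr : ∀ n, D.B (u n) (u n) = r n / κ := fun n => by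
    rw [hS n, D.action_eq (hI n), mul_div_cancel_left₀ _ hκ.ne']
  have hBlim : Tendsto (fun n => D.B (u n) (u n)) atTop (𝓝 (D.level / κ)) := by
    simp_rw [hBr]; exact hr.div_const κ
  have hbd : ∃ M, ∀ n, ‖u n‖ ≤ M := by
    obtain ⟨M, hM⟩ := hBlim.bddAbove_range
    refine ⟨√(M / D.c), fun n => ?_⟩
    apply Real.le_sqrt_of_sq_le
    rw [le_div_iff₀ D.c_pos, mul_comm]
    exact (D.coercive _).trans (hM ⟨n, rfl⟩)
  obtain ⟨v, φ, hφ, hw⟩ := D.weakCompact u hbd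
  have hbd' : ∃ M, ∀ n, ‖(u ∘ φ) n‖ ≤ M := by
    obtain ⟨M, hM⟩ := hbd
    exact ⟨M, fun n => hM _⟩
  have hPlim := D.weakCont _ v hw hbd'
  have hPB : ∀ n, D.P ((u ∘ φ) n) = D.B (u (φ n)) (u (φ n)) / 2 := fun n => by
    have := hI (φ n); unfold nehari at this; simp only [Function.comp]; linarith
  simp_rw [hPB] at hPlim
  have hBlim' := hBlim.comp hφ.tendsto_atTop
  have hPv : D.P v = D.level / κ / 2 :=
    tendsto_nhds_unique hPlim (hBlim'.div_const 2)
  have hPpos : 0 < D.P v := by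
    have h1 : δ / 2 ≤ D.P v := ge_of_tendsto' hPlim fun n => by
      have := hlow _ (hu (φ n)) (hI (φ n)); linarith
    linarith
  have hv : v ≠ 0 := by
    rintro rfl
    -- Homogeneity at the origin forces `P(0) = 0`.
    have h2 := D.homog 2 two_pos 0
    rw [smul_zero] at h2
    have : (1 : ℝ) < 2 ^ D.q := Real.one_lt_rpow (by norm_num) (by linarith [D.two_lt])
    nlinarith
  have hBv : D.B v v ≤ D.level / κ :=
    D.B_le_of_weakTendsto hw (fun n => le_rfl) hBlim'
  obtain ⟨t, ht, hIt, htle⟩ := D.exists_scaling hv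
  have ht1 : t ≤ 1 := htle (by rw [hPv]; linarith)
  refine ⟨t • v, le_antisymm ?_ (D.level_le (smul_ne_zero ht.ne' hv) hIt), hIt⟩
  rw [D.action_eq hIt]
  simp only [map_smul, smul_apply, smul_eq_mul]
  have hBpos := D.B_pos hv
  have h1 : t * (t * D.B v v) ≤ D.level / κ := by
    calc t * (t * D.B v v) ≤ 1 * (1 * D.B v v) := by gcongr
      _ ≤ _ := by linarith
  calc κ * (t * (t * D.B v v)) ≤ κ * (D.level / κ) := by gcongr
    _ = D.level := mul_div_cancel₀ _ hκ.ne'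

theorem hasFDerivAt_B (u : H) : HasFDerivAt (fun u => D.B u u) ((2 : ℝ) • D.B u) u := by
  have h := D.B.hasFDerivAt_of_bilinear (hasFDerivAt_id u) (hasFDerivAt_id u)
  refine h.congr_fderiv ?_
  ext v
  simp [two_mul, D.symm v u]

theorem hasFDerivAt_action (u : H) :
    HasFDerivAt D.action (D.B u - (2 / D.q) • fderiv ℝ D.P u) u := by
  have h := ((D.hasFDerivAt_B u).const_mul (1 / 2)).sub
    ((D.differentiable u).hasFDerivAt.const_mul (2 / D.q))
  refine h.congr_fderiv ?_
  ext v
  simp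

/-- Euler's identity for `P`. -/
theorem fderiv_P_self (u : H) : fderiv ℝ D.P u u = D.q * D.P u := by
  have h1 : HasDerivAt (fun t : ℝ => t • u) u 1 := by
    simpa using (hasDerivAt_id (1 : ℝ)).smul_const u
  have h2 : HasDerivAt (fun t : ℝ => D.P (t • u)) (fderiv ℝ D.P u u) 1 := by
    simpa [Function.comp_def] using!
      (D.differentiable u).hasFDerivAt.comp_hasDerivAt_of_eq (1 : ℝ) h1 (one_smul ℝ u).symm
  have h3 : HasDerivAt (fun t : ℝ => t ^ D.q * D.P u) (D.q * D.P u) 1 := by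
    simpa using (Real.hasDerivAt_rpow_const (x := 1) (p := D.q) (Or.inl one_ne_zero)).mul_const
      (D.P u)
  refine h2.unique (h3.congr_of_eventuallyEq ?_)
  filter_upwards [lt_mem_nhds (zero_lt_one (α := ℝ))] with t ht
  exact D.homog t ht u

theorem nehari_eq_zero_of_critical {u : H} (h : HasFDerivAt D.action (0 : H →L[ℝ] ℝ) u) :
    D.nehari u = 0 := by
  have h1 := congrArg (fun f => f u) (h.unique (D.hasFDerivAt_action u))
  have hq : D.q ≠ 0 := by have := D.two_lt; positivity
  simp only [zero_apply, sub_apply,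
    smul_apply, smul_eq_mul, D.fderiv_P_self] at h1
  rw [nehari, h1]
  field_simp

/-- On the ray through `u`, the action at the Nehari point is a function of
`B(u, u)^q / P(u)^2`; minimality of `φ` bounds this quotient below by its value at `φ`. -/
theorem log_quotient_ge {φ : H} (hφ : φ ≠ 0) (hS : D.action φ = D.level) (hI : D.nehari φ = 0)
    {u : H} (hu : u ≠ 0) :
    D.q * Real.log (D.B φ φ) - 2 * Real.log (D.P φ) ≤
      D.q * Real.log (D.B u u) - 2 * Real.log (D.P u) := by
  obtain ⟨t, ht, hIt, -⟩ := D.exists_scaling hu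
  have hle := D.level_le (smul_ne_zero ht.ne' hu) hIt
  rw [← hS, D.action_eq hI, D.action_eq hIt] at hle
  have hB : D.B φ φ ≤ D.B (t • u) (t • u) := le_of_mul_le_mul_left hle D.factor_pos
  have hBφ := D.B_pos hφ
  have hBu := D.B_pos hu
  have hPu := D.pos u hu
  have e1 : D.B (t • u) (t • u) = t ^ 2 * D.B u u := by
    simp only [map_smul, smul_apply, smul_eq_mul]; ring
  have e2 : D.P (t • u) = t ^ D.q * D.P u := D.homog t ht u
  have e3 : D.P φ = D.B φ φ / 2 := by unfold nehari at hI; linarith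
  have e4 : t ^ 2 * D.B u u = 2 * (t ^ D.q * D.P u) := by
    unfold nehari at hIt; rw [e1, e2] at hIt; linarith
  rw [e1] at hB
  have l1 : Real.log (D.B φ φ) ≤ 2 * Real.log t + Real.log (D.B u u) := by
    calc _ ≤ Real.log (t ^ 2 * D.B u u) := Real.log_le_log hBφ hB
      _ = _ := by rw [Real.log_mul (by positivity) hBu.ne', Real.log_pow]; norm_num
  have l2 : 2 * Real.log t + Real.log (D.B u u) =
      Real.log 2 + (D.q * Real.log t + Real.log (D.P u)) := by
    have h1 := congrArg Real.log e4
    rw [Real.log_mul (by positivity) hBu.ne', Real.log_mul two_ne_zero (by positivity),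
      Real.log_mul (by positivity) hPu.ne', Real.log_pow, Real.log_rpow ht] at h1
    exact_mod_cast h1
  have l3 : Real.log (D.P φ) = Real.log (D.B φ φ) - Real.log 2 := by
    rw [e3, Real.log_div hBφ.ne' two_ne_zero]
  rw [l3]
  have hq := D.two_lt
  nlinarith

/-- Minimizers on the Nehari manifold are critical points of the action. -/
theorem hasFDerivAt_zero_of_minimizer {φ : H} (hφ : φ ≠ 0) (hS : D.action φ = D.level)
    (hI : D.nehari φ = 0) : HasFDerivAt D.action (0 : H →L[ℝ] ℝ) φ := by
  have hB := D.B_pos hφ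
  have hP := D.pos φ hφ
  have hq := D.two_lt
  have hmin : IsLocalMin
      (fun u => D.q * Real.log (D.B u u) - 2 * Real.log (D.P u)) φ := by
    filter_upwards [isOpen_ne.mem_nhds hφ] with u hu
    exact D.log_quotient_ge hφ hS hI hu
  have hd := (((D.hasFDerivAt_B φ).log hB.ne').const_mul D.q).sub
    (((D.differentiable φ).hasFDerivAt.log hP.ne').const_mul 2)
  have h0 := hmin.hasFDerivAt_eq_zero hd
  have e3 : D.B φ φ = 2 * D.P φ := by unfold nehari at hI; linarith
  refine (D.hasFDerivAt_action φ).congr_fderiv ?_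
  ext v
  have h1 := congrArg (fun f => f v) h0
  simp only [zero_apply, sub_apply,
    smul_apply, smul_eq_mul, e3] at h1 ⊢
  field_simp at h1 ⊢
  linarith

/-- The ground states of an abstract Nehari problem are the minimizers on the Nehari manifold. -/
theorem groundStates_eq [Nontrivial H] :
    {φ | (φ ≠ 0 ∧ HasFDerivAt D.action (0 : H →L[ℝ] ℝ) φ) ∧
        ∀ v, v ≠ 0 ∧ HasFDerivAt D.action (0 : H →L[ℝ] ℝ) v → D.action φ ≤ D.action v} =
      {φ | D.action φ = D.level ∧ D.nehari φ = 0} := by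
  have hd := D.level_pos
  have key : ∀ φ, D.action φ = D.level → D.nehari φ = 0 → φ ≠ 0 := by
    rintro φ hS hI rfl
    rw [D.action_eq hI] at hS
    simp at hS
    linarith
  ext φ
  constructor
  · rintro ⟨⟨h0, hc⟩, hmin⟩
    have hI := D.nehari_eq_zero_of_critical hc
    obtain ⟨φ₀, hS₀, hI₀⟩ := D.exists_minimizer
    have hφ₀ := key φ₀ hS₀ hI₀
    exact ⟨le_antisymm
      ((hmin φ₀ ⟨hφ₀, D.hasFDerivAt_zero_of_minimizer hφ₀ hS₀ hI₀⟩).trans hS₀.le)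
      (D.level_le h0 hI), hI⟩
  · rintro ⟨hS, hI⟩
    have h0 := key φ hS hI
    refine ⟨⟨h0, D.hasFDerivAt_zero_of_minimizer h0 hS hI⟩, fun v hv => ?_⟩
    rw [hS]
    exact D.level_le hv.1 (D.nehari_eq_zero_of_critical hv.2)

end NehariData

/-! ### Mollification of functions with a weak gradient -/

section Lintegral

variable {α : Type*} [MeasurableSpace α] {μ : Measure α}

theorem sq_lintegral_mul_le {f g : α → ℝ≥0∞} (hf : AEMeasurable f μ) (hg : AEMeasurable g μ) :
    (∫⁻ x, f x * g x ∂μ) ^ 2 ≤ (∫⁻ x, f x ^ 2 ∂μ) * ∫⁻ x, g x ^ 2 ∂μ := by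
  have h := ENNReal.lintegral_mul_le_Lp_mul_Lq μ Real.HolderConjugate.two_two hf hg
  simp only [Pi.mul_apply, ENNReal.rpow_two] at h
  calc _ ≤ ((∫⁻ x, f x ^ 2 ∂μ) ^ (1 / 2 : ℝ) * (∫⁻ x, g x ^ 2 ∂μ) ^ (1 / 2 : ℝ)) ^ 2 := by gcongr
    _ = _ := by
      rw [mul_pow, ← ENNReal.rpow_two, ← ENNReal.rpow_two, ← ENNReal.rpow_mul, ← ENNReal.rpow_mul]
      norm_num

/-- Jensen's inequality for the square and a probability density `φ`. -/
theorem sq_lintegral_weight_mul_le {φ g : α → ℝ≥0∞} (hφ : AEMeasurable φ μ) (hg : AEMeasurable g μ)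
    (h1 : ∫⁻ x, φ x ∂μ ≤ 1) : (∫⁻ x, φ x * g x ∂μ) ^ 2 ≤ ∫⁻ x, φ x * g x ^ 2 ∂μ := by
  have e (a : ℝ≥0∞) : (a ^ (1 / 2 : ℝ)) ^ 2 = a := by
    rw [← ENNReal.rpow_two, ← ENNReal.rpow_mul]; norm_num
  have h := sq_lintegral_mul_le (hφ.pow_const (1 / 2 : ℝ)) ((hφ.pow_const (1 / 2 : ℝ)).mul hg)
  simp only [Pi.mul_apply, mul_pow, e] at h
  have e' (a b : ℝ≥0∞) : a ^ (1 / 2 : ℝ) * (a ^ (1 / 2 : ℝ) * b) = a * b := by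
    rw [← mul_assoc, ← sq, e]
  simp only [e'] at h
  calc _ ≤ _ := h
    _ ≤ 1 * _ := by gcongr
    _ = _ := one_mul _

theorem enorm_integral_smul_sq_le {F : Type*} [NormedAddCommGroup F] [NormedSpace ℝ F]
    {φ : α → ℝ} {f : α → F} (hφ : AEStronglyMeasurable φ μ) (hf : AEStronglyMeasurable f μ)
    (h1 : ∫⁻ x, ‖φ x‖ₑ ∂μ ≤ 1) :
    ‖∫ x, φ x • f x ∂μ‖ₑ ^ 2 ≤ ∫⁻ x, ‖φ x‖ₑ * ‖f x‖ₑ ^ 2 ∂μ := by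
  refine le_trans ?_ (sq_lintegral_weight_mul_le hφ.enorm hf.enorm h1)
  gcongr
  refine (enorm_integral_le_lintegral_enorm _).trans (le_of_eq ?_)
  simp_rw [enorm_smul]

end Lintegral

section Mollify

variable {N : ℕ}


/-- The convolution of `f` with the normalized bump function `φ`. -/
noncomputable def mollify {F : Type*} [NormedAddCommGroup F] [NormedSpace ℝ F]
    (φ : ContDiffBump (0 : EuclideanSpace ℝ (Fin N))) (f : EuclideanSpace ℝ (Fin N) → F)
    (x : EuclideanSpace ℝ (Fin N)) : F :=
  ∫ y, φ.normed volume (x - y) • f y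

variable {F : Type*} [NormedAddCommGroup F] [NormedSpace ℝ F]
  (φ : ContDiffBump (0 : EuclideanSpace ℝ (Fin N)))

theorem mollify_eq_convolution (f : EuclideanSpace ℝ (Fin N) → F) :
    mollify φ f = convolution (φ.normed volume) f (ContinuousLinearMap.lsmul ℝ ℝ) volume := by
  ext x
  rw [mollify, convolution_eq_swap]
  rfl

theorem lintegral_enorm_normed : ∫⁻ x, ‖φ.normed volume x‖ₑ = 1 := by
  have h := φ.integral_normed (μ := (volume : Measure (EuclideanSpace ℝ (Fin N))))
  rw [← ofReal_integral_norm_eq_lintegral_enorm φ.integrable_normed]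
  simp_rw [Real.norm_of_nonneg (φ.nonneg_normed _), h, ENNReal.ofReal_one]

theorem lintegral_enorm_normed_sub (x : EuclideanSpace ℝ (Fin N)) :
    ∫⁻ y, ‖φ.normed volume (x - y)‖ₑ = 1 := by
  rw [lintegral_sub_left_eq_self (fun y => ‖φ.normed volume y‖ₑ) x, lintegral_enorm_normed]

theorem continuous_normed_sub (x : EuclideanSpace ℝ (Fin N)) :
    Continuous fun y => φ.normed volume (x - y) :=
  φ.continuous_normed.comp (continuous_const.sub continuous_id)

theorem enorm_mollify_sq_le {f : EuclideanSpace ℝ (Fin N) → F}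
    (hf : AEStronglyMeasurable f volume) (x : EuclideanSpace ℝ (Fin N)) :
    ‖mollify φ f x‖ₑ ^ 2 ≤ ∫⁻ y, ‖φ.normed volume (x - y)‖ₑ * ‖f y‖ₑ ^ 2 :=
  enorm_integral_smul_sq_le (continuous_normed_sub φ x).aestronglyMeasurable hf
    (lintegral_enorm_normed_sub φ x).le

theorem lintegral_enorm_mollify_sq_le {f : EuclideanSpace ℝ (Fin N) → F}
    (hf : AEStronglyMeasurable f volume) :
    ∫⁻ x, ‖mollify φ f x‖ₑ ^ 2 ≤ ∫⁻ x, ‖f x‖ₑ ^ 2 := by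
  have hm : AEMeasurable (fun z : EuclideanSpace ℝ (Fin N) × EuclideanSpace ℝ (Fin N) =>
      ‖φ.normed volume (z.1 - z.2)‖ₑ * ‖f z.2‖ₑ ^ 2)
      (volume.prod volume) := by
    refine AEMeasurable.mul (M := ℝ≥0∞) ?_ ?_
    · have hc : Continuous fun z : EuclideanSpace ℝ (Fin N) × EuclideanSpace ℝ (Fin N) =>
          φ.normed volume (z.1 - z.2) :=
        φ.continuous_normed.comp (continuous_fst.sub continuous_snd)
      exact hc.enorm.measurable.aemeasurable
    · exact hf.comp_snd.enorm.pow_const 2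
  calc ∫⁻ x, ‖mollify φ f x‖ₑ ^ 2
      ≤ ∫⁻ x, ∫⁻ y, ‖φ.normed volume (x - y)‖ₑ * ‖f y‖ₑ ^ 2 :=
        lintegral_mono fun x => enorm_mollify_sq_le φ hf x
    _ = ∫⁻ y, ∫⁻ x, ‖φ.normed volume (x - y)‖ₑ * ‖f y‖ₑ ^ 2 := lintegral_lintegral_swap hm
    _ = ∫⁻ y, ‖f y‖ₑ ^ 2 := by
      refine lintegral_congr fun y => ?_
      have hc : Continuous fun x => φ.normed volume (x - y) :=
        φ.continuous_normed.comp (continuous_id.sub continuous_const)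
      rw [lintegral_mul_const _ hc.enorm.measurable,
        lintegral_sub_right_eq_self (fun x => ‖φ.normed volume x‖ₑ) y,
        lintegral_enorm_normed, one_mul]

theorem contDiff_mollify [CompleteSpace F] {f : EuclideanSpace ℝ (Fin N) → F}
    (hf : LocallyIntegrable f volume) :
    ContDiff ℝ 1 (mollify φ f) := by
  rw [mollify_eq_convolution]
  exact_mod_cast φ.hasCompactSupport_normed.contDiff_convolution_left (n := 1) _
    φ.contDiff_normed hf

theorem integrable_normed_sub_smul {f : EuclideanSpace ℝ (Fin N) → F}
    (hf : LocallyIntegrable f volume) (x : EuclideanSpace ℝ (Fin N)) :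
    Integrable fun y => φ.normed volume (x - y) • f y :=
  hf.integrable_smul_left_of_hasCompactSupport (continuous_normed_sub φ x)
    (φ.hasCompactSupport_normed.comp_homeomorph (Homeomorph.subLeft x))

/-- The derivative of a mollification is the mollification of the weak gradient. -/
theorem fderiv_mollify_single {u : EuclideanSpace ℝ (Fin N) → ℂ}
    {g : EuclideanSpace ℝ (Fin N) → EuclideanSpace ℂ (Fin N)}
    (h : IsWeakGradient u g) (hu : LocallyIntegrable u volume) (hg : LocallyIntegrable g volume)
    (x : EuclideanSpace ℝ (Fin N)) (j : Fin N) :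
    fderiv ℝ (mollify φ u) x (EuclideanSpace.single j 1) = mollify φ g x j := by
  have hd := (φ.hasCompactSupport_normed (μ := volume)).hasFDerivAt_convolution_left
    (ContinuousLinearMap.lsmul ℝ ℝ) (φ.contDiff_normed (μ := volume)) hu x
  rw [← mollify_eq_convolution] at hd
  rw [hd.fderiv, convolution_eq_swap, ContinuousLinearMap.integral_apply]
  · have hψ : ContDiff ℝ (⊤ : ℕ∞) fun y => φ.normed volume (x - y) :=
      φ.contDiff_normed.comp (contDiff_const.sub contDiff_id)
    have hc : HasCompactSupport fun y => φ.normed volume (x - y) :=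
      φ.hasCompactSupport_normed.comp_homeomorph (Homeomorph.subLeft x)
    have h1 := h _ hψ hc j
    have h2 : ∀ y, fderiv ℝ (fun y => φ.normed volume (x - y)) y (EuclideanSpace.single j 1) =
        -fderiv ℝ (φ.normed volume) (x - y) (EuclideanSpace.single j 1) := by
      intro y
      have h1 : HasFDerivAt (fun y => x - y)
          (-ContinuousLinearMap.id ℝ (EuclideanSpace ℝ (Fin N))) y :=
        (hasFDerivAt_id y).const_sub x
      have h2 := ((φ.contDiff_normed (μ := volume) (n := 1)).differentiable one_ne_zero
        (x - y)).hasFDerivAt.comp y h1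
      have h3 := h2.fderiv
      simp only [Function.comp_def] at h3
      rw [h3]
      simp
    simp_rw [h2, neg_smul, integral_neg] at h1
    have h3 := neg_injective h1
    have h4 : mollify φ g x j = ∫ y, φ.normed volume (x - y) • g y j := by
      have := (EuclideanSpace.proj j : EuclideanSpace ℂ (Fin N) →L[ℂ] ℂ).integral_comp_comm
        (integrable_normed_sub_smul φ hg x)
      simpa [mollify] using! this.symm
    rw [h4, ← h3]
    rfl
  · exact ((φ.hasCompactSupport_normed.fderiv ℝ).convolutionExists_left _
      (φ.contDiff_normed.continuous_fderiv (n := 1) one_ne_zero) hu x).integrable_swap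

theorem norm_fderiv_mollify_le {u : EuclideanSpace ℝ (Fin N) → ℂ}
    {g : EuclideanSpace ℝ (Fin N) → EuclideanSpace ℂ (Fin N)}
    (h : IsWeakGradient u g) (hu : LocallyIntegrable u volume) (hg : LocallyIntegrable g volume)
    (x : EuclideanSpace ℝ (Fin N)) : ‖fderiv ℝ (mollify φ u) x‖ ≤ ‖mollify φ g x‖ := by
  refine ContinuousLinearMap.opNorm_le_bound _ (norm_nonneg _) fun v => ?_
  have e : v = ∑ j, v j • EuclideanSpace.single j (1 : ℝ) := by
    have := (EuclideanSpace.basisFun (Fin N) ℝ).sum_repr v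
    simpa using! this.symm
  have e2 : fderiv ℝ (mollify φ u) x v = ∑ j, v j • mollify φ g x j := by
    conv_lhs => rw [e]
    simp_rw [map_sum, map_smul, fderiv_mollify_single φ h hu hg]
  rw [e2]
  calc _ ≤ ∑ j, ‖v j • mollify φ g x j‖ := norm_sum_le _ _
    _ = ∑ j, ‖mollify φ g x j‖ * ‖v j‖ := by simp_rw [norm_smul, mul_comm]
    _ ≤ √(∑ j, ‖mollify φ g x j‖ ^ 2) * √(∑ j, ‖v j‖ ^ 2) :=
        Real.sum_mul_le_sqrt_mul_sqrt _ _ _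
    _ = _ := by rw [EuclideanSpace.norm_eq, EuclideanSpace.norm_eq]

theorem lintegral_enorm_fderiv_mollify_sq_le {u : EuclideanSpace ℝ (Fin N) → ℂ}
    {g : EuclideanSpace ℝ (Fin N) → EuclideanSpace ℂ (Fin N)}
    (h : IsWeakGradient u g) (hu : LocallyIntegrable u volume) (hg : LocallyIntegrable g volume) :
    ∫⁻ x, ‖fderiv ℝ (mollify φ u) x‖ₑ ^ 2 ≤ ∫⁻ x, ‖g x‖ₑ ^ 2 := by
  refine le_trans (lintegral_mono fun x => ?_)
    (lintegral_enorm_mollify_sq_le φ hg.aestronglyMeasurable)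
  gcongr
  exact enorm_le_iff_norm_le.2 (norm_fderiv_mollify_le φ h hu hg x)

/-- A sequence of bump functions concentrating at the origin. -/
noncomputable def mollifierSeq (N n : ℕ) : ContDiffBump (0 : EuclideanSpace ℝ (Fin N)) where
  rIn := 1 / ((n : ℝ) + 1)
  rOut := 2 / ((n : ℝ) + 1)
  rIn_pos := by positivity
  rIn_lt_rOut := by gcongr; norm_num

theorem tendsto_mollifierSeq_rOut : Tendsto (fun n => (mollifierSeq N n).rOut) atTop (𝓝 0) := by
  have := (tendsto_one_div_add_atTop_nhds_zero_nat (𝕜 := ℝ)).const_mul 2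
  simpa [mollifierSeq, mul_one_div] using! this

theorem ae_tendsto_mollify [CompleteSpace F] {f : EuclideanSpace ℝ (Fin N) → F}
    (hf : LocallyIntegrable f volume) :
    ∀ᵐ x, Tendsto (fun n => mollify (mollifierSeq N n) f x) atTop (𝓝 (f x)) := by
  simp_rw [mollify_eq_convolution]
  refine ContDiffBump.ae_convolution_tendsto_right_of_locallyIntegrable (K := 2)
    tendsto_mollifierSeq_rOut (Eventually.of_forall fun n => ?_) hf
  exact le_of_eq (by simp only [mollifierSeq]; ring)

end Mollify

/-! ### Sobolev inequalities -/

/-- One step of the iteration behind the two-dimensional Sobolev inequality: the `L¹`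
Gagliardo–Nirenberg–Sobolev inequality applied to `vᵏ⁺¹`. -/
theorem lintegral_enorm_pow_le_of_dim_two {v : EuclideanSpace ℝ (Fin 2) → ℂ} (hv : ContDiff ℝ 1 v)
    (hc : HasCompactSupport v) (k : ℕ) :
    ∫⁻ x, ‖v x‖ₑ ^ (2 * (k + 1)) ≤
      (lintegralPowLePowLIntegralFDerivConst
        (volume : Measure (EuclideanSpace ℝ (Fin 2))) 2 * (k + 1) ^ 2 : ℝ≥0) *
        ((∫⁻ x, ‖v x‖ₑ ^ (2 * k)) * ∫⁻ x, ‖fderiv ℝ v x‖ₑ ^ 2) := by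
  have hdim : Real.HolderConjugate
      (Module.finrank ℝ (EuclideanSpace ℝ (Fin 2)) : ℝ) 2 := by
    rw [finrank_euclideanSpace_fin]
    exact_mod_cast Real.HolderConjugate.two_two
  have hcw : HasCompactSupport fun x => v x ^ (k + 1) :=
    hc.comp_left (g := fun z => z ^ (k + 1)) (by simp)
  have h := lintegral_pow_le_pow_lintegral_fderiv volume (hv.pow (k + 1)) hcw hdim
  have hd : ∀ x, ‖fderiv ℝ (fun x => v x ^ (k + 1)) x‖ₑ ≤
      ((k + 1 : ℝ≥0) : ℝ≥0∞) * (‖v x‖ₑ ^ k * ‖fderiv ℝ v x‖ₑ) := by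
    intro x
    have h1 := ((hv.differentiable one_ne_zero x).hasFDerivAt.pow (k + 1)).fderiv
    rw [h1, ← mul_assoc]
    refine le_of_eq ((enorm_smul _ (fderiv ℝ v x)).trans ?_)
    congr 1
    rw [Nat.add_sub_cancel, nsmul_eq_mul, enorm_mul, enorm_pow]
    congr 1
    rw [← ofReal_norm, Complex.norm_natCast, ENNReal.ofReal_natCast]
    push_cast
    rfl
  simp only [ENNReal.rpow_two, enorm_pow] at h
  calc ∫⁻ x, ‖v x‖ₑ ^ (2 * (k + 1)) = ∫⁻ x, (‖v x‖ₑ ^ (k + 1)) ^ 2 := by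
        simp_rw [← pow_mul, mul_comm]
    _ ≤ _ := h
    _ ≤ _ * (∫⁻ x, ((k + 1 : ℝ≥0) : ℝ≥0∞) * (‖v x‖ₑ ^ k * ‖fderiv ℝ v x‖ₑ)) ^ 2 := by
        gcongr with x
        exact hd x
    _ = _ * ((k + 1 : ℝ≥0) ^ 2 * (∫⁻ x, (‖v x‖ₑ ^ k * ‖fderiv ℝ v x‖ₑ)) ^ 2) := by
        rw [lintegral_const_mul' _ _ ENNReal.coe_ne_top, mul_pow]
    _ ≤ _ * ((k + 1 : ℝ≥0) ^ 2 * ((∫⁻ x, (‖v x‖ₑ ^ k) ^ 2) * ∫⁻ x, ‖fderiv ℝ v x‖ₑ ^ 2)) := by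
        gcongr
        refine sq_lintegral_mul_le ?_ ?_
        · exact (hv.continuous.enorm.measurable.pow_const k).aemeasurable
        · exact (hv.continuous_fderiv one_ne_zero).enorm.measurable.aemeasurable
    _ = _ := by
        simp_rw [← pow_mul, mul_comm k 2]
        push_cast
        ring

/-- Sobolev inequalities for test functions, in dimensions two and three: an even integer exponent
above the prescribed `q` is available. -/
theorem exists_sobolev_const_of_hasCompactSupport {N : ℕ} (hN : N = 2 ∨ N = 3) {q : ℝ}
    (hq : N = 3 → q < 6) :
    ∃ m : ℕ, q < 2 * m ∧ ∃ C : ℝ≥0, ∀ v : EuclideanSpace ℝ (Fin N) → ℂ, ContDiff ℝ 1 v →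
      HasCompactSupport v → ∫⁻ x, ‖v x‖ₑ ^ (2 * m) ≤
        C * ((∫⁻ x, ‖v x‖ₑ ^ 2) + ∫⁻ x, ‖fderiv ℝ v x‖ₑ ^ 2) ^ m := by
  rcases hN with rfl | rfl
  · have key : ∀ k : ℕ, ∃ C : ℝ≥0, ∀ v : EuclideanSpace ℝ (Fin 2) → ℂ, ContDiff ℝ 1 v →
      HasCompactSupport v → ∫⁻ x, ‖v x‖ₑ ^ (2 * (k + 1)) ≤
        C * ((∫⁻ x, ‖v x‖ₑ ^ 2) + ∫⁻ x, ‖fderiv ℝ v x‖ₑ ^ 2) ^ (k + 1) := by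
      intro k
      induction k with
      | zero => exact ⟨1, fun v _ _ => by simp⟩
      | succ k ih =>
        obtain ⟨C, hC⟩ := ih
        refine ⟨(lintegralPowLePowLIntegralFDerivConst
            (volume : Measure (EuclideanSpace ℝ (Fin 2))) 2 * (((k + 1 : ℕ) : ℝ≥0) + 1) ^ 2) * C,
          fun v hv hc => (lintegral_enorm_pow_le_of_dim_two hv hc (k + 1)).trans ?_⟩
        rw [ENNReal.coe_mul _ C, mul_assoc]
        refine mul_le_mul' le_rfl ?_
        rw [pow_succ _ (k + 1), ← mul_assoc]
        exact mul_le_mul' (hC v hv hc) le_add_self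
    obtain ⟨k, hk⟩ := exists_nat_gt q
    obtain ⟨C, hC⟩ := key k
    refine ⟨k + 1, ?_, C, hC⟩
    push_cast
    linarith [(Nat.cast_nonneg k : (0 : ℝ) ≤ k)]
  · refine ⟨3, by have := hq rfl; norm_num; exact this, (eLpNormLESNormFDerivOfEqInnerConst
      (volume : Measure (EuclideanSpace ℝ (Fin 3))) 2) ^ 6, fun v hv hc => ?_⟩
    · have h := eLpNorm_le_eLpNorm_fderiv_of_eq_inner (volume : Measure (EuclideanSpace ℝ (Fin 3)))
        hv hc (p := 2) (p' := 6) (by norm_num) (by simp) (by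
          rw [finrank_euclideanSpace_fin]; norm_num)
      have h2 := pow_le_pow_left' h 6
      rw [mul_pow] at h2
      have e6 : eLpNorm v ((6 : ℝ≥0) : ℝ≥0∞) volume ^ 6 = ∫⁻ x, ‖v x‖ₑ ^ 6 := by
        have := eLpNorm_nnreal_pow_eq_lintegral (f := v)
          (μ := (volume : Measure (EuclideanSpace ℝ (Fin 3)))) (p := 6) (by norm_num)
        simpa only [NNReal.coe_ofNat, ENNReal.rpow_ofNat] using this
      have e2 : eLpNorm (fderiv ℝ v) ((2 : ℝ≥0) : ℝ≥0∞) volume ^ 2 =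
          ∫⁻ x, ‖fderiv ℝ v x‖ₑ ^ 2 := by
        have := eLpNorm_nnreal_pow_eq_lintegral (f := fderiv ℝ v)
          (μ := (volume : Measure (EuclideanSpace ℝ (Fin 3)))) (p := 2) (by norm_num)
        simpa only [NNReal.coe_ofNat, ENNReal.rpow_ofNat] using this
      have e26 : ∀ a : ℝ≥0∞, a ^ 6 = (a ^ 2) ^ 3 := fun a => by rw [← pow_mul]
      rw [e6, e26 (eLpNorm (fderiv ℝ v) _ _), e2] at h2
      refine h2.trans ?_
      push_cast
      gcongr
      exact le_add_self

section Cutoff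

variable {N : ℕ}

/-- A fixed cutoff function, equal to one on the unit ball. -/
noncomputable def cutoffBump (N : ℕ) : ContDiffBump (0 : EuclideanSpace ℝ (Fin N)) where
  rIn := 1
  rOut := 2
  rIn_pos := one_pos
  rIn_lt_rOut := one_lt_two

/-- Cutoff functions with uniformly bounded gradients exhausting the space. -/
noncomputable def cutoff (N n : ℕ) (x : EuclideanSpace ℝ (Fin N)) : ℝ :=
  cutoffBump N ((1 / ((n : ℝ) + 1)) • x)

theorem contDiff_cutoff (n : ℕ) : ContDiff ℝ 1 (cutoff N n) :=
  (cutoffBump N).contDiff.comp (contDiff_const_smul _)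

theorem hasCompactSupport_cutoff (n : ℕ) : HasCompactSupport (cutoff N n) :=
  (cutoffBump N).hasCompactSupport.comp_smul (by positivity)

theorem enorm_cutoff_le (n : ℕ) (x : EuclideanSpace ℝ (Fin N)) : ‖cutoff N n x‖ₑ ≤ 1 := by
  rw [← enorm_one (G := ℝ)]
  refine enorm_le_iff_norm_le.2 ?_
  rw [cutoff, Real.norm_of_nonneg (cutoffBump N).nonneg, norm_one]
  exact (cutoffBump N).le_one

theorem exists_enorm_fderiv_cutoff_le (N : ℕ) :
    ∃ K : ℝ≥0, ∀ n x, ‖fderiv ℝ (cutoff N n) x‖ₑ ≤ K := by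
  obtain ⟨K, hK⟩ := ((cutoffBump N).hasCompactSupport.fderiv ℝ).exists_bound_of_continuous
    ((cutoffBump N).contDiff.continuous_fderiv (n := 1) one_ne_zero)
  have hK0 : 0 ≤ K := (norm_nonneg _).trans (hK 0)
  refine ⟨⟨K, hK0⟩, fun n x => ?_⟩
  have h1 : fderiv ℝ (cutoff N n) x =
      (1 / ((n : ℝ) + 1)) • fderiv ℝ (cutoffBump N) ((1 / ((n : ℝ) + 1)) • x) :=
    fderiv_comp_smul _
  have h2 : ‖fderiv ℝ (cutoff N n) x‖ ≤ K := by
    rw [h1, norm_smul, Real.norm_of_nonneg (by positivity)]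
    calc _ ≤ 1 * K := by
          gcongr
          · rw [div_le_one (by positivity)]
            linarith [(Nat.cast_nonneg n : (0 : ℝ) ≤ n)]
          · exact hK _
      _ = K := one_mul K
  rw [← ofReal_norm]
  exact (ENNReal.ofReal_le_ofReal h2).trans (le_of_eq (ENNReal.ofReal_eq_coe_nnreal hK0))

theorem tendsto_cutoff (x : EuclideanSpace ℝ (Fin N)) :
    Tendsto (fun n => cutoff N n x) atTop (𝓝 1) := by
  obtain ⟨n₀, hn₀⟩ := exists_nat_gt ‖x‖
  refine tendsto_const_nhds.congr' ?_
  filter_upwards [eventually_ge_atTop n₀] with n hn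
  refine ((cutoffBump N).one_of_mem_closedBall ?_).symm
  have : (n₀ : ℝ) ≤ n := by exact_mod_cast hn
  rw [mem_closedBall_zero_iff, norm_smul, Real.norm_of_nonneg (by positivity), one_div,
    inv_mul_le_iff₀ (by positivity)]
  simp only [cutoffBump]
  linarith

/-- The Sobolev inequality passes from test functions to functions with a weak gradient, by
mollification, truncation and Fatou's lemma. -/
theorem exists_sobolev_const (hN : N = 2 ∨ N = 3) {q : ℝ} (hq : N = 3 → q < 6) :
    ∃ m : ℕ, q < 2 * m ∧ ∃ C : ℝ≥0, ∀ (u : EuclideanSpace ℝ (Fin N) → ℂ)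
      (g : EuclideanSpace ℝ (Fin N) → EuclideanSpace ℂ (Fin N)), IsWeakGradient u g →
      LocallyIntegrable u volume → LocallyIntegrable g volume → ∫⁻ x, ‖u x‖ₑ ^ (2 * m) ≤
        C * ((∫⁻ x, ‖u x‖ₑ ^ 2) + ∫⁻ x, ‖g x‖ₑ ^ 2) ^ m := by
  obtain ⟨m, hm, C, hC⟩ := exists_sobolev_const_of_hasCompactSupport hN hq
  obtain ⟨K, hK⟩ := exists_enorm_fderiv_cutoff_le N
  refine ⟨m, hm, C * (2 + 2 * K ^ 2) ^ m, fun u g h hu hg => ?_⟩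
  set w : ℕ → EuclideanSpace ℝ (Fin N) → ℂ := fun n => mollify (mollifierSeq N n) u with hw
  set v : ℕ → EuclideanSpace ℝ (Fin N) → ℂ := fun n x => cutoff N n x • w n x with hv
  have hwd : ∀ n, ContDiff ℝ 1 (w n) := fun n => contDiff_mollify _ hu
  have hvd : ∀ n, ContDiff ℝ 1 (v n) := fun n => (contDiff_cutoff n).smul (hwd n)
  have hvc : ∀ n, HasCompactSupport (v n) := fun n => (hasCompactSupport_cutoff n).smul_right
  have hvle : ∀ n x, ‖v n x‖ₑ ≤ ‖w n x‖ₑ := fun n x => by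
    simp only [hv, enorm_smul]
    calc _ ≤ 1 * ‖w n x‖ₑ := by gcongr; exact enorm_cutoff_le n x
      _ = _ := one_mul _
  have hDv : ∀ n x, ‖fderiv ℝ (v n) x‖ₑ ^ 2 ≤
      2 * ‖fderiv ℝ (w n) x‖ₑ ^ 2 + 2 * K ^ 2 * ‖w n x‖ₑ ^ 2 := fun n x => by
    have h1 := (((contDiff_cutoff (N := N) n).differentiable one_ne_zero x).hasFDerivAt.smul
      ((hwd n).differentiable one_ne_zero x).hasFDerivAt).fderiv
    have h2 : ‖fderiv ℝ (v n) x‖ₑ ≤ ‖fderiv ℝ (w n) x‖ₑ + K * ‖w n x‖ₑ := by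
      rw [show fderiv ℝ (v n) x = _ from h1]
      refine (enorm_add_le (_ : EuclideanSpace ℝ (Fin N) →L[ℝ] ℂ) _).trans (add_le_add ?_ ?_)
      · rw [enorm_smul]
        calc _ ≤ 1 * ‖fderiv ℝ (w n) x‖ₑ := by gcongr; exact enorm_cutoff_le n x
          _ = _ := one_mul _
      · have h3 : ‖(fderiv ℝ (cutoff N n) x).smulRight (w n x)‖ₑ =
            ‖fderiv ℝ (cutoff N n) x‖ₑ * ‖w n x‖ₑ := by
          rw [← ofReal_norm, ContinuousLinearMap.norm_smulRight_apply,
            ENNReal.ofReal_mul (norm_nonneg _), ofReal_norm, ofReal_norm]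
        rw [h3]
        gcongr
        exact hK n x
    calc _ ≤ (‖fderiv ℝ (w n) x‖ₑ + K * ‖w n x‖ₑ) ^ 2 := by gcongr
      _ ≤ 2 * ‖fderiv ℝ (w n) x‖ₑ ^ 2 + 2 * (K * ‖w n x‖ₑ) ^ 2 := by
          have := ENNReal.rpow_add_le_mul_rpow_add_rpow ‖fderiv ℝ (w n) x‖ₑ (K * ‖w n x‖ₑ)
            (p := 2) (by norm_num)
          norm_num at this
          rw [← mul_add]
          exact this
      _ = _ := by rw [mul_pow, mul_assoc]
  have hbound : ∀ n, ∫⁻ x, ‖v n x‖ₑ ^ (2 * m) ≤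
      (C * (2 + 2 * K ^ 2) ^ m : ℝ≥0) * ((∫⁻ x, ‖u x‖ₑ ^ 2) + ∫⁻ x, ‖g x‖ₑ ^ 2) ^ m := fun n => by
    have hA : ∫⁻ x, ‖w n x‖ₑ ^ 2 ≤ ∫⁻ x, ‖u x‖ₑ ^ 2 :=
      lintegral_enorm_mollify_sq_le _ hu.aestronglyMeasurable
    have hB : ∫⁻ x, ‖fderiv ℝ (w n) x‖ₑ ^ 2 ≤ ∫⁻ x, ‖g x‖ₑ ^ 2 :=
      lintegral_enorm_fderiv_mollify_sq_le _ h hu hg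
    have hm1 : Measurable fun x => ‖w n x‖ₑ ^ 2 := (hwd n).continuous.enorm.measurable.pow_const 2
    have hm2 : Measurable fun x => ‖fderiv ℝ (w n) x‖ₑ ^ 2 :=
      ((hwd n).continuous_fderiv one_ne_zero).enorm.measurable.pow_const 2
    refine (hC (v n) (hvd n) (hvc n)).trans ?_
    push_cast
    rw [mul_assoc, ← mul_pow]
    gcongr
    calc (∫⁻ x, ‖v n x‖ₑ ^ 2) + ∫⁻ x, ‖fderiv ℝ (v n) x‖ₑ ^ 2
        ≤ (∫⁻ x, ‖w n x‖ₑ ^ 2) +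
            ∫⁻ x, (2 * ‖fderiv ℝ (w n) x‖ₑ ^ 2 + 2 * K ^ 2 * ‖w n x‖ₑ ^ 2) := by
          gcongr with x x
          · exact hvle n x
          · exact hDv n x
      _ = (∫⁻ x, ‖w n x‖ₑ ^ 2) +
            (2 * (∫⁻ x, ‖fderiv ℝ (w n) x‖ₑ ^ 2) + 2 * K ^ 2 * ∫⁻ x, ‖w n x‖ₑ ^ 2) := by
          rw [lintegral_add_left (hm2.const_mul 2), lintegral_const_mul _ hm2,
            lintegral_const_mul _ hm1]
      _ ≤ (∫⁻ x, ‖u x‖ₑ ^ 2) +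
            (2 * (∫⁻ x, ‖g x‖ₑ ^ 2) + 2 * K ^ 2 * ∫⁻ x, ‖u x‖ₑ ^ 2) := by gcongr
      _ ≤ (∫⁻ x, ‖u x‖ₑ ^ 2) +
            (2 * (∫⁻ x, ‖g x‖ₑ ^ 2) + 2 * K ^ 2 * ∫⁻ x, ‖u x‖ₑ ^ 2) +
            ((∫⁻ x, ‖u x‖ₑ ^ 2) + 2 * K ^ 2 * ∫⁻ x, ‖g x‖ₑ ^ 2) := le_self_add
      _ = _ := by ring
  have hlim : ∀ᵐ x, ‖u x‖ₑ ^ (2 * m) = liminf (fun n => ‖v n x‖ₑ ^ (2 * m)) atTop := by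
    filter_upwards [ae_tendsto_mollify hu] with x hx
    have h1 : Tendsto (fun n => v n x) atTop (𝓝 (u x)) := by
      simpa [hv, hw] using (tendsto_cutoff x).smul hx
    exact ((ENNReal.continuous_pow _).tendsto _ |>.comp h1.enorm).liminf_eq.symm
  rw [lintegral_congr_ae hlim]
  refine (lintegral_liminf_le fun n => (hvd n).continuous.enorm.measurable.pow_const _).trans ?_
  exact liminf_le_of_le (by isBoundedDefault) fun b hb => by
    obtain ⟨n, hn⟩ := hb.exists
    exact hn.trans (hbound n)

end Cutoff

/-! ### Translation and mollification estimates -/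

section Translation

variable {N : ℕ}

theorem enorm_sub_translate_sq_le {w : EuclideanSpace ℝ (Fin N) → ℂ} (hw : ContDiff ℝ 1 w)
    (a x : EuclideanSpace ℝ (Fin N)) :
    ‖w (x - a) - w x‖ₑ ^ 2 ≤
      ‖a‖ₑ ^ 2 * ∫⁻ t in Set.Ioc (0 : ℝ) 1, ‖fderiv ℝ w (x - t • a)‖ₑ ^ 2 := by
  have hline : ∀ t : ℝ, HasDerivAt (fun t : ℝ => x - t • a) (-a) t := fun t => by
    simpa using ((hasDerivAt_id t).smul_const a).const_sub x
  have hd : ∀ t : ℝ, HasDerivAt (fun t : ℝ => w (x - t • a)) (fderiv ℝ w (x - t • a) (-a)) t :=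
    fun t => (hw.differentiable one_ne_zero _).hasFDerivAt.comp_hasDerivAt t (hline t)
  have hlc : Continuous fun t : ℝ => x - t • a :=
    continuous_const.sub (continuous_id.smul continuous_const)
  have hcf : Continuous fun t : ℝ => fderiv ℝ w (x - t • a) :=
    (hw.continuous_fderiv one_ne_zero).comp hlc
  have hc : Continuous fun t : ℝ => fderiv ℝ w (x - t • a) (-a) := hcf.clm_apply continuous_const
  have hint := intervalIntegral.integral_eq_sub_of_hasDerivAt (a := 0) (b := 1)
    (fun t _ => hd t) (hc.intervalIntegrable 0 1)
  simp only [one_smul, zero_smul, sub_zero] at hint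
  rw [← hint, intervalIntegral.integral_of_le zero_le_one]
  have h1 : ∫⁻ _ in Set.Ioc (0 : ℝ) 1, (1 : ℝ≥0∞) ≤ 1 := by simp
  calc ‖∫ t in Set.Ioc (0 : ℝ) 1, fderiv ℝ w (x - t • a) (-a)‖ₑ ^ 2
      ≤ (∫⁻ t in Set.Ioc (0 : ℝ) 1, 1 * ‖fderiv ℝ w (x - t • a) (-a)‖ₑ) ^ 2 := by
        simp_rw [one_mul]
        gcongr
        exact enorm_integral_le_lintegral_enorm _
    _ ≤ ∫⁻ t in Set.Ioc (0 : ℝ) 1, 1 * ‖fderiv ℝ w (x - t • a) (-a)‖ₑ ^ 2 :=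
        sq_lintegral_weight_mul_le aemeasurable_const hc.enorm.measurable.aemeasurable h1
    _ ≤ ∫⁻ t in Set.Ioc (0 : ℝ) 1, ‖a‖ₑ ^ 2 * ‖fderiv ℝ w (x - t • a)‖ₑ ^ 2 := by
        refine lintegral_mono fun t => ?_
        rw [one_mul, ← mul_pow, mul_comm]
        gcongr
        rw [← enorm_neg a]
        exact ContinuousLinearMap.le_opENorm _ _
    _ = _ := lintegral_const_mul _ (hcf.enorm.measurable.pow_const 2)

theorem lintegral_enorm_sub_translate_sq_le_of_contDiff {w : EuclideanSpace ℝ (Fin N) → ℂ}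
    (hw : ContDiff ℝ 1 w) (a : EuclideanSpace ℝ (Fin N)) :
    ∫⁻ x, ‖w (x - a) - w x‖ₑ ^ 2 ≤ ‖a‖ₑ ^ 2 * ∫⁻ x, ‖fderiv ℝ w x‖ₑ ^ 2 := by
  have hD : Measurable fun x => ‖fderiv ℝ w x‖ₑ ^ 2 :=
    (hw.continuous_fderiv one_ne_zero).enorm.measurable.pow_const 2
  have hm : Measurable fun z : EuclideanSpace ℝ (Fin N) × ℝ =>
      ‖fderiv ℝ w (z.1 - z.2 • a)‖ₑ ^ 2 := by
    have hc : Continuous fun z : EuclideanSpace ℝ (Fin N) × ℝ => z.1 - z.2 • a := by fun_prop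
    exact hD.comp hc.measurable
  calc ∫⁻ x, ‖w (x - a) - w x‖ₑ ^ 2
      ≤ ∫⁻ x, ‖a‖ₑ ^ 2 * ∫⁻ t in Set.Ioc (0 : ℝ) 1, ‖fderiv ℝ w (x - t • a)‖ₑ ^ 2 :=
        lintegral_mono fun x => enorm_sub_translate_sq_le hw a x
    _ = ‖a‖ₑ ^ 2 * ∫⁻ x, ∫⁻ t in Set.Ioc (0 : ℝ) 1, ‖fderiv ℝ w (x - t • a)‖ₑ ^ 2 :=
        lintegral_const_mul' _ _ (by finiteness)
    _ = ‖a‖ₑ ^ 2 * ∫⁻ t in Set.Ioc (0 : ℝ) 1, ∫⁻ x, ‖fderiv ℝ w (x - t • a)‖ₑ ^ 2 := by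
        rw [lintegral_lintegral_swap hm.aemeasurable]
    _ = _ := by
        simp_rw [lintegral_sub_right_eq_self (fun x => ‖fderiv ℝ w x‖ₑ ^ 2)]
        simp

/-- The `L²` modulus of continuity of a function with square-integrable weak gradient. -/
theorem lintegral_enorm_sub_translate_sq_le {u : EuclideanSpace ℝ (Fin N) → ℂ}
    {g : EuclideanSpace ℝ (Fin N) → EuclideanSpace ℂ (Fin N)} (h : IsWeakGradient u g)
    (hu : LocallyIntegrable u volume) (hg : LocallyIntegrable g volume)
    (a : EuclideanSpace ℝ (Fin N)) :
    ∫⁻ x, ‖u (x - a) - u x‖ₑ ^ 2 ≤ ‖a‖ₑ ^ 2 * ∫⁻ x, ‖g x‖ₑ ^ 2 := by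
  set w : ℕ → EuclideanSpace ℝ (Fin N) → ℂ := fun n => mollify (mollifierSeq N n) u with hw
  have hwd : ∀ n, ContDiff ℝ 1 (w n) := fun n => contDiff_mollify _ hu
  have hae := ae_tendsto_mollify hu
  have hae' : ∀ᵐ x, Tendsto (fun n => w n (x - a)) atTop (𝓝 (u (x - a))) :=
    (measurePreserving_sub_right volume a).quasiMeasurePreserving.ae hae
  have hlim : ∀ᵐ x, ‖u (x - a) - u x‖ₑ ^ 2 =
      liminf (fun n => ‖w n (x - a) - w n x‖ₑ ^ 2) atTop := by
    filter_upwards [hae, hae'] with x hx hx'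
    exact ((ENNReal.continuous_pow 2).tendsto _ |>.comp (hx'.sub hx).enorm).liminf_eq.symm
  rw [lintegral_congr_ae hlim]
  refine (lintegral_liminf_le fun n => ?_).trans ?_
  · have hc : Continuous fun x => w n (x - a) - w n x :=
      ((hwd n).continuous.comp (continuous_id.sub continuous_const)).sub (hwd n).continuous
    exact hc.enorm.measurable.pow_const 2
  · refine liminf_le_of_le (by isBoundedDefault) fun b hb => ?_
    obtain ⟨n, hn⟩ := hb.exists
    refine hn.trans ((lintegral_enorm_sub_translate_sq_le_of_contDiff (hwd n) a).trans ?_)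
    exact mul_le_mul' le_rfl (lintegral_enorm_fderiv_mollify_sq_le _ h hu hg)

theorem mollify_sub_eq (φ : ContDiffBump (0 : EuclideanSpace ℝ (Fin N)))
    {u : EuclideanSpace ℝ (Fin N) → ℂ} (hu : LocallyIntegrable u volume)
    (x : EuclideanSpace ℝ (Fin N)) :
    mollify φ u x - u x = ∫ y, φ.normed volume y • (u (x - y) - u x) := by
  have h1 : mollify φ u x = ∫ y, φ.normed volume y • u (x - y) := by
    rw [mollify, ← integral_sub_left_eq_self _ volume x]
    simp
  have hi : Integrable fun y => φ.normed volume y • u (x - y) := by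
    have := (integrable_normed_sub_smul φ hu x).comp_sub_left x
    simpa using this
  have hi' : Integrable fun y => φ.normed volume y • u x :=
    (φ.integrable_normed (μ := volume)).smul_const _
  simp_rw [smul_sub]
  rw [integral_sub hi hi', ← h1, integral_smul_const, φ.integral_normed, one_smul]

/-- Mollification at scale `ε` changes a function by at most `ε ‖∇u‖₂` in `L²`. -/
theorem lintegral_enorm_mollify_sub_sq_le (φ : ContDiffBump (0 : EuclideanSpace ℝ (Fin N)))
    {u : EuclideanSpace ℝ (Fin N) → ℂ} {g : EuclideanSpace ℝ (Fin N) → EuclideanSpace ℂ (Fin N)}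
    (h : IsWeakGradient u g) (hum : StronglyMeasurable u)
    (hu : LocallyIntegrable u volume) (hg : LocallyIntegrable g volume) :
    ∫⁻ x, ‖mollify φ u x - u x‖ₑ ^ 2 ≤ ENNReal.ofReal φ.rOut ^ 2 * ∫⁻ x, ‖g x‖ₑ ^ 2 := by
  have hsub : Measurable fun z : EuclideanSpace ℝ (Fin N) × EuclideanSpace ℝ (Fin N) =>
      u (z.1 - z.2) := hum.measurable.comp (measurable_fst.sub measurable_snd)
  have hfst : Measurable fun z : EuclideanSpace ℝ (Fin N) × EuclideanSpace ℝ (Fin N) =>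
      u z.1 := hum.measurable.comp measurable_fst
  have hφ2 : Measurable fun z : EuclideanSpace ℝ (Fin N) × EuclideanSpace ℝ (Fin N) =>
      φ.normed volume z.2 := φ.continuous_normed.measurable.comp measurable_snd
  have hm : Measurable fun z : EuclideanSpace ℝ (Fin N) × EuclideanSpace ℝ (Fin N) =>
      ‖φ.normed volume z.2‖ₑ * ‖u (z.1 - z.2) - u z.1‖ₑ ^ 2 :=
    hφ2.enorm.mul ((hsub.sub hfst).enorm.pow_const 2)
  calc ∫⁻ x, ‖mollify φ u x - u x‖ₑ ^ 2
      ≤ ∫⁻ x, ∫⁻ y, ‖φ.normed volume y‖ₑ * ‖u (x - y) - u x‖ₑ ^ 2 := by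
        refine lintegral_mono fun x => ?_
        rw [mollify_sub_eq φ hu]
        refine enorm_integral_smul_sq_le φ.continuous_normed.aestronglyMeasurable ?_
          (lintegral_enorm_normed φ).le
        exact ((hum.comp_measurable (measurable_const.sub measurable_id)).sub
          stronglyMeasurable_const).aestronglyMeasurable
    _ = ∫⁻ y, ∫⁻ x, ‖φ.normed volume y‖ₑ * ‖u (x - y) - u x‖ₑ ^ 2 :=
        lintegral_lintegral_swap hm.aemeasurable
    _ ≤ ∫⁻ y, ‖φ.normed volume y‖ₑ * (ENNReal.ofReal φ.rOut ^ 2 * ∫⁻ x, ‖g x‖ₑ ^ 2) := by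
        refine lintegral_mono fun y => ?_
        rw [lintegral_const_mul' _ _ (by finiteness)]
        by_cases hy : y ∈ Function.support (φ.normed volume)
        · rw [φ.support_normed_eq, mem_ball_zero_iff] at hy
          refine mul_le_mul' le_rfl
            ((lintegral_enorm_sub_translate_sq_le h hu hg y).trans ?_)
          gcongr
          rw [← ofReal_norm]
          exact ENNReal.ofReal_le_ofReal hy.le
        · rw [Function.notMem_support.1 hy]
          simp
    _ = _ := by
        rw [lintegral_mul_const _ φ.continuous_normed.enorm.measurable, lintegral_enorm_normed,
          one_mul]

end Translation

/-! ### The energy space as a Hilbert space -/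

/-- Sequential weak compactness of balls in a separable complex Hilbert space, tested against real
functionals. -/
theorem exists_weakTendsto_subseq {H : Type*} [NormedAddCommGroup H] [InnerProductSpace ℂ H]
    [NormedSpace ℝ H] [IsScalarTower ℝ ℂ H] [CompleteSpace H] [TopologicalSpace.SeparableSpace H]
    (u : ℕ → H) (hu : ∃ M, ∀ n, ‖u n‖ ≤ M) :
    ∃ v, ∃ φ : ℕ → ℕ, StrictMono φ ∧ WeakTendsto (u ∘ φ) v := by
  obtain ⟨M, hM⟩ := hu
  have hmem : ∀ n, StrongDual.toWeakDual (InnerProductSpace.toDual ℂ H (u n)) ∈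
      (WeakDual.toStrongDual ⁻¹' Metric.closedBall (0 : StrongDual ℂ H) M) := fun n => by
    simpa using! hM n
  obtain ⟨f, -, φ, hφ, hlim⟩ := WeakDual.isSeqCompact_closedBall ℂ H 0 M hmem
  refine ⟨(InnerProductSpace.toDual ℂ H).symm (WeakDual.toStrongDual f), φ, hφ, fun ℓ => ?_⟩
  set L : StrongDual ℂ H := StrongDual.extendRCLike (𝕜 := ℂ) ℓ
  set z : H := (InnerProductSpace.toDual ℂ H).symm L
  have hℓ : ∀ x, ℓ x = (inner ℂ x z).re := fun x => by
    have h1 : RCLike.re (L x) = ℓ x := StrongDual.re_extendRCLike_apply ℓ x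
    have h2 : L x = inner ℂ z x := (InnerProductSpace.toDual_symm_apply (𝕜 := ℂ)).symm
    rw [← h1, h2]
    exact inner_re_symm (𝕜 := ℂ) z x
  have hz : Tendsto (fun n => inner ℂ (u (φ n)) z) atTop (𝓝 (f z)) := by
    have := (WeakDual.eval_continuous z).tendsto f |>.comp hlim
    simpa [Function.comp_def] using! this
  have h2 : f z = inner ℂ ((InnerProductSpace.toDual ℂ H).symm (WeakDual.toStrongDual f)) z := by
    rw [InnerProductSpace.toDual_symm_apply]
    rfl
  rw [h2] at hz
  simp_rw [hℓ]
  exact (Complex.continuous_re.tendsto _).comp hz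

section TestPairing

variable {N : ℕ} {F : Type*} [NormedAddCommGroup F]

theorem lintegral_enorm_sq_eq (f : Lp F 2 (volume : Measure (EuclideanSpace ℝ (Fin N)))) :
    ∫⁻ x, ‖f x‖ₑ ^ 2 = ‖f‖ₑ ^ 2 := by
  have := eLpNorm_nnreal_pow_eq_lintegral (f := f)
    (μ := (volume : Measure (EuclideanSpace ℝ (Fin N)))) (p := 2) (by norm_num)
  simp only [NNReal.coe_ofNat, ENNReal.rpow_ofNat] at this
  rw [Lp.enorm_def, ← this]
  rfl

theorem Lp_locallyIntegrable (f : Lp F 2 (volume : Measure (EuclideanSpace ℝ (Fin N)))) :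
    LocallyIntegrable f volume :=
  (Lp.memLp f).locallyIntegrable (by norm_num)

variable [NormedSpace ℝ F]

theorem norm_integral_testFunction_smul_le {ρ : EuclideanSpace ℝ (Fin N) → ℝ} (hρ : Continuous ρ)
    (hc : HasCompactSupport ρ) (f : Lp F 2 (volume : Measure (EuclideanSpace ℝ (Fin N)))) :
    ‖∫ x, ρ x • f x‖ ≤ √((∫⁻ x, ‖ρ x‖ₑ ^ 2).toReal) * ‖f‖ := by
  have hfin : ∫⁻ x, ‖ρ x‖ₑ ^ 2 ≠ ∞ := by
    have h1 := ((hρ.memLp_of_hasCompactSupport hc :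
      MemLp ρ ((2 : ℝ≥0) : ℝ≥0∞) (volume : Measure (EuclideanSpace ℝ (Fin N)))).2).ne
    have := eLpNorm_nnreal_pow_eq_lintegral (f := ρ)
      (μ := (volume : Measure (EuclideanSpace ℝ (Fin N)))) (p := 2) (by norm_num)
    simp only [NNReal.coe_ofNat, ENNReal.rpow_ofNat] at this
    rw [← this]
    exact ENNReal.pow_ne_top h1
  have h : ‖∫ x, ρ x • f x‖ₑ ^ 2 ≤ (∫⁻ x, ‖ρ x‖ₑ ^ 2) * ‖f‖ₑ ^ 2 := by
    rw [← lintegral_enorm_sq_eq]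
    refine le_trans ?_ (sq_lintegral_mul_le hρ.enorm.measurable.aemeasurable
      (Lp.aestronglyMeasurable f).enorm)
    gcongr
    refine (enorm_integral_le_lintegral_enorm _).trans (le_of_eq ?_)
    simp_rw [enorm_smul]
  have h2 := ENNReal.toReal_mono (ENNReal.mul_ne_top hfin (by finiteness)) h
  rw [ENNReal.toReal_mul, ENNReal.toReal_pow, ENNReal.toReal_pow, toReal_enorm, toReal_enorm] at h2
  refine abs_le_of_sq_le_sq' ?_ (by positivity) |>.2
  rw [mul_pow, Real.sq_sqrt ENNReal.toReal_nonneg]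
  exact h2

/-- The continuous linear map `f ↦ ∫ ρ f` on `L²`, for a test function `ρ`. -/
noncomputable def testPairing (ρ : EuclideanSpace ℝ (Fin N) → ℝ) (hρ : Continuous ρ)
    (hc : HasCompactSupport ρ) :
    Lp F 2 (volume : Measure (EuclideanSpace ℝ (Fin N))) →L[ℝ] F :=
  LinearMap.mkContinuous
    { toFun := fun f => ∫ x, ρ x • f x
      map_add' := fun f g => by
        rw [← integral_add (integrable_testFunction_smul f hρ hc)
          (integrable_testFunction_smul g hρ hc)]
        refine integral_congr_ae ?_
        filter_upwards [Lp.coeFn_add f g] with x hx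
        rw [hx, Pi.add_apply, smul_add]
      map_smul' := fun c f => by
        rw [RingHom.id_apply, ← integral_smul]
        refine integral_congr_ae ?_
        filter_upwards [Lp.coeFn_smul c f] with x hx
        rw [hx, Pi.smul_apply, smul_comm] }
    _ fun f => norm_integral_testFunction_smul_le hρ hc f

theorem testPairing_apply {ρ : EuclideanSpace ℝ (Fin N) → ℝ} (hρ : Continuous ρ)
    (hc : HasCompactSupport ρ) (f : Lp F 2 (volume : Measure (EuclideanSpace ℝ (Fin N)))) :
    testPairing ρ hρ hc f = ∫ x, ρ x • f x := rfl

end TestPairing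

namespace SigmaSpace

variable {N : ℕ}

theorem isClosed_weakGradient : IsClosed {z : L2Triple N |
    IsWeakGradient (z.fst : EuclideanSpace ℝ (Fin N) → ℂ) z.snd.fst} := by
  simp only [IsWeakGradient, Set.ofPred_forall]
  refine isClosed_iInter fun ψ => isClosed_iInter fun hψ => isClosed_iInter fun hc =>
    isClosed_iInter fun j => ?_
  have hcd : Continuous fun x => fderiv ℝ ψ x (EuclideanSpace.single j 1) :=
    (hψ.continuous_fderiv (by simp)).clm_apply continuous_const
  have e : ∀ z : L2Triple N, ∫ x, ψ x • z.snd.fst x j =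
      (testPairing ψ hψ.continuous hc z.snd.fst) j := fun z => by
    have := (EuclideanSpace.proj j : EuclideanSpace ℂ (Fin N) →L[ℂ] ℂ).integral_comp_comm
      (integrable_testFunction_smul z.snd.fst hψ.continuous hc)
    simpa [testPairing_apply] using! this
  simp_rw [e]
  refine isClosed_eq ?_ ?_
  · exact (testPairing _ hcd (hc.fderiv_apply ℝ _)).continuous.comp (WithLp.continuous_fst _ _ _)
  · exact ((EuclideanSpace.proj j : EuclideanSpace ℂ (Fin N) →L[ℂ] ℂ).continuous.comp
      ((testPairing ψ hψ.continuous hc).continuous.comp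
        ((WithLp.continuous_fst _ _ _).comp (WithLp.continuous_snd _ _ _)))).neg

theorem isClosed_weight : IsClosed {z : L2Triple N |
    (z.snd.snd : EuclideanSpace ℝ (Fin N) → ℂ) =ᵐ[volume]
      fun x : EuclideanSpace ℝ (Fin N) => ((‖x‖ : ℝ) : ℂ) * z.fst x} := by
  refine IsSeqClosed.isClosed fun z z₀ hz hlim => ?_
  have h1 : Tendsto (fun n => (z n).fst) atTop (𝓝 z₀.fst) :=
    ((WithLp.continuous_fst _ _ _).tendsto _).comp hlim
  have h2 : Tendsto (fun n => (z n).snd.snd) atTop (𝓝 z₀.snd.snd) :=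
    (((WithLp.continuous_snd _ _ _).comp (WithLp.continuous_snd _ _ _)).tendsto _).comp hlim
  obtain ⟨a, ha, hae⟩ := (tendstoInMeasure_of_tendsto_Lp h1).exists_seq_tendsto_ae
  obtain ⟨b, hb, hbe⟩ :=
    (tendstoInMeasure_of_tendsto_Lp (h2.comp ha.tendsto_atTop)).exists_seq_tendsto_ae
  have hall : ∀ᵐ x, ∀ n, (z n).snd.snd x = ((‖x‖ : ℝ) : ℂ) * (z n).fst x := ae_all_iff.2 hz
  filter_upwards [hae, hbe, hall] with x hx hx' hx''
  refine tendsto_nhds_unique hx' ?_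
  simp only [Function.comp, hx'']
  exact (hx.comp hb.tendsto_atTop).const_mul _

theorem isClosed : IsClosed (SigmaSpace N : Set (L2Triple N)) :=
  isClosed_weakGradient.inter isClosed_weight

instance : CompleteSpace (SigmaSpace N) := isClosed.completeSpace_coe

instance : TopologicalSpace.SeparableSpace (SigmaSpace N) := by
  have : Fact ((2 : ℝ≥0∞) ≠ ∞) := ⟨by norm_num⟩
  have h1 : SecondCountableTopology (Lp ℂ 2 (volume : Measure (EuclideanSpace ℝ (Fin N)))) :=
    Lp.SecondCountableTopology
  have h2 : SecondCountableTopology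
      (Lp (EuclideanSpace ℂ (Fin N)) 2 (volume : Measure (EuclideanSpace ℝ (Fin N)))) :=
    Lp.SecondCountableTopology
  have h3 : SecondCountableTopology
      (WithLp 2 (Lp (EuclideanSpace ℂ (Fin N)) 2 (volume : Measure (EuclideanSpace ℝ (Fin N))) ×
      Lp ℂ 2 (volume : Measure (EuclideanSpace ℝ (Fin N))))) :=
    WithLp.secondCountableTopology _ _ _
  have h4 : SecondCountableTopology (L2Triple N) := WithLp.secondCountableTopology _ _ _
  have : SecondCountableTopology (SigmaSpace N) :=
    TopologicalSpace.Subtype.secondCountableTopology _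
  infer_instance

/-- The continuous linear map `u ↦ u` from the energy space to `L²`. -/
noncomputable def toL2 (N : ℕ) :
    SigmaSpace N →L[ℝ] Lp ℂ 2 (volume : Measure (EuclideanSpace ℝ (Fin N))) :=
  ((WithLp.fstL 2 ℂ _ _).comp (SigmaSpace N).subtypeL).restrictScalars ℝ

/-- The continuous linear map `u ↦ ∇u` from the energy space to `L²`. -/
noncomputable def gradL2 (N : ℕ) :
    SigmaSpace N →L[ℝ]
      Lp (EuclideanSpace ℂ (Fin N)) 2 (volume : Measure (EuclideanSpace ℝ (Fin N))) :=
  ((WithLp.fstL 2 ℂ _ _).comp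
    ((WithLp.sndL 2 ℂ _ _).comp (SigmaSpace N).subtypeL)).restrictScalars ℝ

/-- The continuous linear map `u ↦ |x| u` from the energy space to `L²`. -/
noncomputable def weightL2 (N : ℕ) :
    SigmaSpace N →L[ℝ] Lp ℂ 2 (volume : Measure (EuclideanSpace ℝ (Fin N))) :=
  ((WithLp.sndL 2 ℂ _ _).comp
    ((WithLp.sndL 2 ℂ _ _).comp (SigmaSpace N).subtypeL)).restrictScalars ℝ

theorem coe_gradL2 (u : SigmaSpace N) :
    (gradL2 N u : EuclideanSpace ℝ (Fin N) → EuclideanSpace ℂ (Fin N)) = gradOf u := rfl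

theorem coe_weightL2 (u : SigmaSpace N) :
    (weightL2 N u : EuclideanSpace ℝ (Fin N) → ℂ) =ᵐ[volume]
      fun x : EuclideanSpace ℝ (Fin N) => ((‖x‖ : ℝ) : ℂ) * fnOf u x := u.2.2

theorem isWeakGradient (u : SigmaSpace N) : IsWeakGradient (fnOf u) (gradOf u) := u.2.1

theorem norm_sq_eq (u : SigmaSpace N) :
    ‖u‖ ^ 2 = ‖toL2 N u‖ ^ 2 + (‖gradL2 N u‖ ^ 2 + ‖weightL2 N u‖ ^ 2) := by
  have h1 := WithLp.prod_norm_sq_eq_of_L2 u.1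
  have h2 := WithLp.prod_norm_sq_eq_of_L2 u.1.snd
  rw [h2] at h1
  exact h1

theorem norm_toL2_le (u : SigmaSpace N) : ‖toL2 N u‖ ≤ ‖u‖ := by
  refine abs_le_of_sq_le_sq' ?_ (norm_nonneg _) |>.2
  rw [norm_sq_eq]
  have h1 := sq_nonneg ‖gradL2 N u‖
  have h2 := sq_nonneg ‖weightL2 N u‖
  linarith

theorem norm_gradL2_le (u : SigmaSpace N) : ‖gradL2 N u‖ ≤ ‖u‖ := by
  refine abs_le_of_sq_le_sq' ?_ (norm_nonneg _) |>.2
  rw [norm_sq_eq]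
  have h1 := sq_nonneg ‖toL2 N u‖
  have h2 := sq_nonneg ‖weightL2 N u‖
  linarith

theorem norm_weightL2_le (u : SigmaSpace N) : ‖weightL2 N u‖ ≤ ‖u‖ := by
  refine abs_le_of_sq_le_sq' ?_ (norm_nonneg _) |>.2
  rw [norm_sq_eq]
  have h1 := sq_nonneg ‖toL2 N u‖
  have h2 := sq_nonneg ‖gradL2 N u‖
  linarith

theorem stronglyMeasurable_fnOf (u : SigmaSpace N) : StronglyMeasurable (fnOf u) :=
  Lp.stronglyMeasurable _

theorem lintegral_enorm_fnOf_sq_le (u : SigmaSpace N) : ∫⁻ x, ‖fnOf u x‖ₑ ^ 2 ≤ ‖u‖ₑ ^ 2 := by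
  refine (lintegral_enorm_sq_eq (toL2 N u)).le.trans ?_
  gcongr
  exact enorm_le_iff_norm_le.2 (norm_toL2_le u)

theorem lintegral_enorm_gradOf_sq_le (u : SigmaSpace N) :
    ∫⁻ x, ‖gradOf u x‖ₑ ^ 2 ≤ ‖u‖ₑ ^ 2 := by
  refine (lintegral_enorm_sq_eq (gradL2 N u)).le.trans ?_
  gcongr
  exact enorm_le_iff_norm_le.2 (norm_gradL2_le u)

theorem lintegral_enorm_norm_mul_fnOf_sq_le (u : SigmaSpace N) :
    ∫⁻ x, (‖x‖ₑ * ‖fnOf u x‖ₑ) ^ 2 ≤ ‖u‖ₑ ^ 2 := by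
  have h : ∫⁻ x, (‖x‖ₑ * ‖fnOf u x‖ₑ) ^ 2 = ∫⁻ x, ‖weightL2 N u x‖ₑ ^ 2 := by
    refine lintegral_congr_ae ?_
    filter_upwards [coe_weightL2 u] with x hx
    rw [hx, enorm_mul]
    congr 2
    rw [← ofReal_norm, ← ofReal_norm, Complex.norm_real, norm_norm]
  rw [h]
  refine (lintegral_enorm_sq_eq (weightL2 N u)).le.trans ?_
  gcongr
  exact enorm_le_iff_norm_le.2 (norm_weightL2_le u)

theorem locallyIntegrable_fnOf (u : SigmaSpace N) : LocallyIntegrable (fnOf u) volume :=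
  Lp_locallyIntegrable (toL2 N u)

theorem locallyIntegrable_gradOf (u : SigmaSpace N) : LocallyIntegrable (gradOf u) volume :=
  Lp_locallyIntegrable (gradL2 N u)

theorem weakCompact (u : ℕ → SigmaSpace N) (hu : ∃ M, ∀ n, ‖u n‖ ≤ M) :
    ∃ v, ∃ φ : ℕ → ℕ, StrictMono φ ∧ WeakTendsto (u ∘ φ) v :=
  exists_weakTendsto_subseq u hu

/-- A bump function is a nonzero element of the energy space. -/
instance : Nontrivial (SigmaSpace N) := by
  set χ : EuclideanSpace ℝ (Fin N) → ℂ := fun x => (cutoffBump N x : ℂ) with hχ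
  have hχd : ContDiff ℝ 1 χ := Complex.ofRealCLM.contDiff.comp (cutoffBump N).contDiff
  have hχc : HasCompactSupport χ :=
    (cutoffBump N).hasCompactSupport.comp_left (g := fun r : ℝ => (r : ℂ)) (by simp)
  have hdc : ∀ j, Continuous fun x => fderiv ℝ χ x (EuclideanSpace.single j 1) := fun j =>
    (hχd.continuous_fderiv one_ne_zero).clm_apply continuous_const
  set g : EuclideanSpace ℝ (Fin N) → EuclideanSpace ℂ (Fin N) :=
    fun x => WithLp.toLp 2 fun j => fderiv ℝ χ x (EuclideanSpace.single j 1) with hg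
  have hgc : Continuous g := (PiLp.continuous_toLp 2 _).comp (continuous_pi hdc)
  have hgs : HasCompactSupport g := (hχc.fderiv ℝ).comp_left
    (g := fun T : EuclideanSpace ℝ (Fin N) →L[ℝ] ℂ =>
      (WithLp.toLp 2 fun j => T (EuclideanSpace.single j 1) : EuclideanSpace ℂ (Fin N)))
    (by ext; simp)
  have hwc : Continuous fun x : EuclideanSpace ℝ (Fin N) => ((‖x‖ : ℝ) : ℂ) * χ x :=
    (Complex.continuous_ofReal.comp continuous_norm).mul hχd.continuous
  have h1 : MemLp χ 2 (volume : Measure (EuclideanSpace ℝ (Fin N))) :=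
    hχd.continuous.memLp_of_hasCompactSupport hχc
  have h2 : MemLp g 2 (volume : Measure (EuclideanSpace ℝ (Fin N))) :=
    hgc.memLp_of_hasCompactSupport hgs
  have h3 : MemLp (fun x => ((‖x‖ : ℝ) : ℂ) * χ x) 2
      (volume : Measure (EuclideanSpace ℝ (Fin N))) :=
    hwc.memLp_of_hasCompactSupport hχc.mul_left
  have hmem : (WithLp.toLp 2 (h1.toLp χ, WithLp.toLp 2 (h2.toLp g, h3.toLp _)) : L2Triple N) ∈
      SigmaSpace N := by
    refine ⟨fun ψ hψ hc j => ?_, ?_⟩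
    · have e1 : ∫ x, fderiv ℝ ψ x (EuclideanSpace.single j 1) • (h1.toLp χ) x =
          ∫ x, fderiv ℝ ψ x (EuclideanSpace.single j 1) • χ x := by
        refine integral_congr_ae ?_
        filter_upwards [h1.coeFn_toLp] with x hx
        rw [hx]
      have e2 : ∫ x, ψ x • (h2.toLp g) x j =
          ∫ x, ψ x • fderiv ℝ χ x (EuclideanSpace.single j 1) := by
        refine integral_congr_ae ?_
        filter_upwards [h2.coeFn_toLp] with x hx
        rw [hx]
      change ∫ x, fderiv ℝ ψ x (EuclideanSpace.single j 1) • (h1.toLp χ) x =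
        -∫ x, ψ x • (h2.toLp g) x j
      rw [e1, e2, integral_smul_fderiv_eq_neg_fderiv_smul_of_integrable, neg_neg]
      · exact (((hψ.continuous_fderiv (by simp)).clm_apply continuous_const).smul
          hχd.continuous).integrable_of_hasCompactSupport (hc.fderiv_apply ℝ _).smul_right
      · exact (hψ.continuous.smul (hdc j)).integrable_of_hasCompactSupport hc.smul_right
      · exact (hψ.continuous.smul hχd.continuous).integrable_of_hasCompactSupport hc.smul_right
      · exact fun x _ => hψ.differentiable (by simp) x
      · exact fun x _ => hχd.differentiable one_ne_zero x
    · change (h3.toLp _ : EuclideanSpace ℝ (Fin N) → ℂ) =ᵐ[volume]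
        fun x => ((‖x‖ : ℝ) : ℂ) * (h1.toLp χ) x
      filter_upwards [h1.coeFn_toLp, h3.coeFn_toLp] with x hx hx'
      rw [hx, hx']
  refine ⟨⟨⟨_, hmem⟩, 0, fun h => ?_⟩⟩
  have h4 : h1.toLp χ = 0 := congrArg (fun u => toL2 N u) h
  have h5 : χ =ᵐ[volume] 0 := (h1.coeFn_toLp).symm.trans (h4 ▸ Lp.coeFn_zero _ _ _)
  have h6 : χ = 0 := (hχd.continuous.ae_eq_iff_eq volume continuous_zero).1 h5
  have h7 := congrFun h6 0
  have h8 : cutoffBump N 0 = 1 := (cutoffBump N).one_of_mem_closedBall (by simp [cutoffBump])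
  simp [hχ, h8] at h7

end SigmaSpace

/-! ### Compactness of the embedding into Lebesgue spaces -/

namespace SigmaSpace

variable {N : ℕ}

theorem fnOf_add (u v : SigmaSpace N) :
    fnOf (u + v) =ᵐ[volume] fun x => fnOf u x + fnOf v x := by
  have h := Lp.coeFn_add (toL2 N u) (toL2 N v)
  rw [← map_add] at h
  exact h

theorem fnOf_sub (u v : SigmaSpace N) :
    fnOf (u - v) =ᵐ[volume] fun x => fnOf u x - fnOf v x := by
  have h := Lp.coeFn_sub (toL2 N u) (toL2 N v)
  rw [← map_sub] at h
  exact h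

theorem fnOf_smul (c : ℝ) (u : SigmaSpace N) :
    fnOf (c • u) =ᵐ[volume] fun x => c • fnOf u x := by
  have h := Lp.coeFn_smul c (toL2 N u)
  rw [← map_smul] at h
  exact h

theorem fnOf_zero : fnOf (0 : SigmaSpace N) =ᵐ[volume] fun _ => 0 := by
  have h := Lp.coeFn_zero ℂ 2 (volume : Measure (EuclideanSpace ℝ (Fin N)))
  rw [← map_zero (toL2 N)] at h
  exact h

theorem tendsto_mollify_of_weakTendsto (φ : ContDiffBump (0 : EuclideanSpace ℝ (Fin N)))
    {w : ℕ → SigmaSpace N} {v : SigmaSpace N} (h : WeakTendsto w v)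
    (x : EuclideanSpace ℝ (Fin N)) :
    Tendsto (fun n => mollify φ (fnOf (w n)) x) atTop (𝓝 (mollify φ (fnOf v) x)) := by
  set T : SigmaSpace N →L[ℝ] ℂ := (testPairing _ (continuous_normed_sub φ x)
    (φ.hasCompactSupport_normed.comp_homeomorph (Homeomorph.subLeft x))).comp (toL2 N) with hT
  have h1 := h (Complex.reCLM.comp T)
  have h2 := h (Complex.imCLM.comp T)
  have h3 := ((Complex.continuous_ofReal.tendsto _).comp h1).add
    (((Complex.continuous_ofReal.tendsto _).comp h2).mul_const Complex.I)
  have e : ∀ u : SigmaSpace N, mollify φ (fnOf u) x = ((T u).re : ℂ) + ((T u).im : ℂ) * Complex.I :=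
    fun u => (Complex.re_add_im (T u)).symm
  simp_rw [e]
  exact h3

/-- Away from a ball, the weight controls the `L²` mass. -/
theorem setLIntegral_compl_ball_le (u : SigmaSpace N) {R : ℝ} (hR : 0 < R) :
    ∫⁻ x in (Metric.ball 0 R)ᶜ, ‖fnOf u x‖ₑ ^ 2 ≤ ENNReal.ofReal (1 / R) ^ 2 * ‖u‖ₑ ^ 2 := by
  calc ∫⁻ x in (Metric.ball 0 R)ᶜ, ‖fnOf u x‖ₑ ^ 2
      ≤ ∫⁻ x in (Metric.ball 0 R)ᶜ, ENNReal.ofReal (1 / R) ^ 2 * (‖x‖ₑ * ‖fnOf u x‖ₑ) ^ 2 := by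
        refine setLIntegral_mono' Metric.isOpen_ball.measurableSet.compl fun x hx => ?_
        have hx' : R ≤ ‖x‖ := by simpa using hx
        rw [← mul_pow, ← mul_assoc]
        gcongr
        have : 1 ≤ ENNReal.ofReal (1 / R) * ‖x‖ₑ := by
          rw [← ofReal_norm, ← ENNReal.ofReal_mul (by positivity), ENNReal.one_le_ofReal,
            one_div, inv_mul_eq_div, le_div_iff₀ hR, one_mul]
          exact hx'
        exact le_mul_of_one_le_left' this
    _ ≤ ∫⁻ x, ENNReal.ofReal (1 / R) ^ 2 * (‖x‖ₑ * ‖fnOf u x‖ₑ) ^ 2 := setLIntegral_le_lintegral _ _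
    _ = ENNReal.ofReal (1 / R) ^ 2 * ∫⁻ x, (‖x‖ₑ * ‖fnOf u x‖ₑ) ^ 2 :=
        lintegral_const_mul' _ _ (by finiteness)
    _ ≤ _ := by
        gcongr
        exact lintegral_enorm_norm_mul_fnOf_sq_le u

theorem enorm_add_sq_le_two_mul (a b : ℂ) : ‖a + b‖ₑ ^ 2 ≤ 2 * ‖a‖ₑ ^ 2 + 2 * ‖b‖ₑ ^ 2 := by
  have := ENNReal.rpow_add_le_mul_rpow_add_rpow ‖a‖ₑ ‖b‖ₑ (p := 2) (by norm_num)
  norm_num at this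
  rw [← mul_add]
  refine le_trans ?_ this
  gcongr
  exact enorm_add_le a b

/-- The three contributions to the `L²` norm: the mollified function on a ball, the mollification
error, and the tail. -/
theorem lintegral_enorm_fnOf_sq_le_three (φ : ContDiffBump (0 : EuclideanSpace ℝ (Fin N)))
    (u : SigmaSpace N) {R : ℝ} (hR : 0 < R) :
    ∫⁻ x, ‖fnOf u x‖ₑ ^ 2 ≤ 2 * (∫⁻ x in Metric.ball 0 R, ‖mollify φ (fnOf u) x‖ₑ ^ 2) +
      (2 * ENNReal.ofReal φ.rOut ^ 2 + ENNReal.ofReal (1 / R) ^ 2) * ‖u‖ₑ ^ 2 := by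
  have hmm : Measurable fun x => ‖mollify φ (fnOf u) x‖ₑ ^ 2 :=
    (contDiff_mollify φ (locallyIntegrable_fnOf u)).continuous.enorm.measurable.pow_const 2
  have herr := lintegral_enorm_mollify_sub_sq_le φ (isWeakGradient u) (stronglyMeasurable_fnOf u)
    (locallyIntegrable_fnOf u) (locallyIntegrable_gradOf u)
  have hball : ∫⁻ x in Metric.ball 0 R, ‖fnOf u x‖ₑ ^ 2 ≤
      2 * (∫⁻ x in Metric.ball 0 R, ‖mollify φ (fnOf u) x‖ₑ ^ 2) +
        2 * (ENNReal.ofReal φ.rOut ^ 2 * ‖u‖ₑ ^ 2) := by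
    calc ∫⁻ x in Metric.ball 0 R, ‖fnOf u x‖ₑ ^ 2
        ≤ ∫⁻ x in Metric.ball 0 R, (2 * ‖mollify φ (fnOf u) x‖ₑ ^ 2 +
            2 * ‖mollify φ (fnOf u) x - fnOf u x‖ₑ ^ 2) := by
          refine lintegral_mono fun x => ?_
          have := enorm_add_sq_le_two_mul (mollify φ (fnOf u) x)
            (-(mollify φ (fnOf u) x - fnOf u x))
          rw [enorm_neg] at this
          simpa using this
      _ = 2 * (∫⁻ x in Metric.ball 0 R, ‖mollify φ (fnOf u) x‖ₑ ^ 2) +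
            2 * ∫⁻ x in Metric.ball 0 R, ‖mollify φ (fnOf u) x - fnOf u x‖ₑ ^ 2 := by
          rw [lintegral_add_left (hmm.const_mul 2), lintegral_const_mul _ hmm,
            lintegral_const_mul' _ _ (by norm_num)]
      _ ≤ _ := by
          gcongr
          refine (setLIntegral_le_lintegral _ _).trans (herr.trans ?_)
          gcongr
          exact lintegral_enorm_gradOf_sq_le u
  rw [← lintegral_add_compl _ (Metric.isOpen_ball (x := (0 : EuclideanSpace ℝ (Fin N)))
    (ε := R)).measurableSet]
  calc _ ≤ _ := add_le_add hball (setLIntegral_compl_ball_le u hR)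
    _ = _ := by ring

theorem tendsto_setLIntegral_mollify (φ : ContDiffBump (0 : EuclideanSpace ℝ (Fin N)))
    {w : ℕ → SigmaSpace N} (h : WeakTendsto w 0) {M : ℝ} (hM : ∀ n, ‖w n‖ ≤ M) (R : ℝ) :
    Tendsto (fun n => ∫⁻ x in Metric.ball 0 R, ‖mollify φ (fnOf (w n)) x‖ₑ ^ 2) atTop (𝓝 0) := by
  obtain ⟨K, hK⟩ := (φ.hasCompactSupport_normed (μ := volume)).exists_bound_of_continuous
    φ.continuous_normed
  have hbound : ∀ n x, ‖mollify φ (fnOf (w n)) x‖ₑ ^ 2 ≤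
      ENNReal.ofReal K * ENNReal.ofReal M ^ 2 := fun n x => by
    refine (enorm_mollify_sq_le φ (locallyIntegrable_fnOf (w n)).aestronglyMeasurable x).trans ?_
    calc _ ≤ ∫⁻ y, ENNReal.ofReal K * ‖fnOf (w n) y‖ₑ ^ 2 := by
          gcongr with y
          rw [← ofReal_norm]
          exact ENNReal.ofReal_le_ofReal (hK _)
      _ = ENNReal.ofReal K * ∫⁻ y, ‖fnOf (w n) y‖ₑ ^ 2 :=
          lintegral_const_mul' _ _ ENNReal.ofReal_ne_top
      _ ≤ _ := by
          gcongr
          refine (lintegral_enorm_fnOf_sq_le (w n)).trans ?_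
          gcongr
          rw [← ofReal_norm]
          exact ENNReal.ofReal_le_ofReal (hM n)
  have hz : ∀ x, mollify φ (fnOf (0 : SigmaSpace N)) x = 0 := fun x => by
    rw [mollify]
    refine integral_eq_zero_of_ae ?_
    filter_upwards [fnOf_zero (N := N)] with y hy
    simp [hy]
  have := tendsto_lintegral_of_dominated_convergence
    (μ := volume.restrict (Metric.ball (0 : EuclideanSpace ℝ (Fin N)) R))
    (F := fun n x => ‖mollify φ (fnOf (w n)) x‖ₑ ^ 2) (f := fun _ => 0)
    (fun _ => ENNReal.ofReal K * ENNReal.ofReal M ^ 2)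
    (fun n => (contDiff_mollify φ
      (locallyIntegrable_fnOf (w n))).continuous.enorm.measurable.pow_const 2)
    (fun n => Eventually.of_forall (hbound n))
    (by
      rw [lintegral_const, Measure.restrict_apply_univ]
      exact ENNReal.mul_ne_top (by finiteness) measure_ball_lt_top.ne)
    (Eventually.of_forall fun x => by
      have h1 := tendsto_mollify_of_weakTendsto φ h x
      rw [hz] at h1
      have h2 := (ENNReal.continuous_pow 2).tendsto _ |>.comp h1.enorm
      simpa [Function.comp_def] using h2)
  simpa using this

/-- **Rellich compactness**: weakly null bounded sequences of the energy space converge to zero in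
`L²`. -/
theorem tendsto_lintegral_enorm_sq {w : ℕ → SigmaSpace N} (h : WeakTendsto w 0)
    (hb : ∃ M, ∀ n, ‖w n‖ ≤ M) :
    Tendsto (fun n => ∫⁻ x, ‖fnOf (w n) x‖ₑ ^ 2) atTop (𝓝 0) := by
  obtain ⟨M, hM⟩ := hb
  have hc : Tendsto (fun k : ℕ => (2 * ENNReal.ofReal (mollifierSeq N k).rOut ^ 2 +
      ENNReal.ofReal (1 / ((k : ℝ) + 1)) ^ 2) * ENNReal.ofReal M ^ 2) atTop (𝓝 0) := by
    have h1 : Tendsto (fun k => ENNReal.ofReal (mollifierSeq N k).rOut ^ 2) atTop (𝓝 0) := by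
      have := (ENNReal.continuous_pow 2).tendsto _ |>.comp
        (ENNReal.tendsto_ofReal (tendsto_mollifierSeq_rOut (N := N)))
      simpa [Function.comp_def] using this
    have h2 : Tendsto (fun k : ℕ => ENNReal.ofReal (1 / ((k : ℝ) + 1)) ^ 2) atTop (𝓝 0) := by
      have := (ENNReal.continuous_pow 2).tendsto _ |>.comp
        (ENNReal.tendsto_ofReal (tendsto_one_div_add_atTop_nhds_zero_nat (𝕜 := ℝ)))
      simpa [Function.comp_def] using this
    have h3 := (ENNReal.Tendsto.const_mul h1 (a := 2) (Or.inr (by norm_num))).add h2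
    have h4 := ENNReal.Tendsto.mul_const h3 (b := ENNReal.ofReal M ^ 2) (Or.inr (by finiteness))
    simpa using h4
  rw [ENNReal.tendsto_nhds_zero] at hc ⊢
  intro ε hε
  obtain ⟨k, hk⟩ := (hc (ε / 2) (ENNReal.half_pos hε.ne')).exists
  have hball := ENNReal.Tendsto.const_mul
    (tendsto_setLIntegral_mollify (mollifierSeq N k) h hM ((k : ℝ) + 1)) (a := 2)
    (Or.inr (by norm_num))
  rw [mul_zero, ENNReal.tendsto_nhds_zero] at hball
  filter_upwards [hball (ε / 2) (ENNReal.half_pos hε.ne')] with n hn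
  refine (lintegral_enorm_fnOf_sq_le_three (mollifierSeq N k) (w n)
    (by positivity : (0 : ℝ) < (k : ℝ) + 1)).trans ?_
  rw [← ENNReal.add_halves ε]
  refine add_le_add hn (le_trans ?_ hk)
  gcongr
  rw [← ofReal_norm]
  exact ENNReal.ofReal_le_ofReal (hM n)

/-- Interpolation between the powers `2` and `2m`, with a threshold `T`. -/
theorem enorm_rpow_le {q : ℝ} (hq : 2 ≤ q) {m : ℕ} (hm : q ≤ 2 * m) {T : ℝ} (hT : 0 < T) (z : ℂ) :
    ‖z‖ₑ ^ q ≤ ENNReal.ofReal (T ^ (q - 2)) * ‖z‖ₑ ^ 2 +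
      ENNReal.ofReal (T ^ (q - 2 * m)) * ‖z‖ₑ ^ (2 * m) := by
  have key : ‖z‖ ^ q ≤ T ^ (q - 2) * ‖z‖ ^ 2 + T ^ (q - 2 * m) * ‖z‖ ^ (2 * m) := by
    rcases (norm_nonneg z).eq_or_lt with h0 | h0
    · rw [← h0, Real.zero_rpow (by linarith)]
      positivity
    · have e1 : ‖z‖ ^ q = ‖z‖ ^ (q - 2) * ‖z‖ ^ 2 := by
        rw [← Real.rpow_natCast, ← Real.rpow_add h0]; norm_num
      have e2 : ‖z‖ ^ q = ‖z‖ ^ (q - 2 * m) * ‖z‖ ^ (2 * m) := by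
        rw [← Real.rpow_natCast, ← Real.rpow_add h0]; push_cast; norm_num
      rcases le_total ‖z‖ T with h | h
      · rw [e1]
        have : ‖z‖ ^ (q - 2) * ‖z‖ ^ 2 ≤ T ^ (q - 2) * ‖z‖ ^ 2 := by
          gcongr
        have : 0 ≤ T ^ (q - 2 * m) * ‖z‖ ^ (2 * m) := by positivity
        linarith
      · rw [e2]
        have : ‖z‖ ^ (q - 2 * m) * ‖z‖ ^ (2 * m) ≤ T ^ (q - 2 * m) * ‖z‖ ^ (2 * m) := by
          gcongr ?_ * _
          exact Real.rpow_le_rpow_of_nonpos hT h (by linarith)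
        have : 0 ≤ T ^ (q - 2) * ‖z‖ ^ 2 := by positivity
        linarith
  rw [← ofReal_norm, ENNReal.ofReal_rpow_of_nonneg (norm_nonneg z) (by linarith),
    ← ENNReal.ofReal_pow (norm_nonneg z), ← ENNReal.ofReal_pow (norm_nonneg z),
    ← ENNReal.ofReal_mul (by positivity), ← ENNReal.ofReal_mul (by positivity),
    ← ENNReal.ofReal_add (by positivity) (by positivity)]
  exact ENNReal.ofReal_le_ofReal key

theorem lintegral_enorm_rpow_le {q : ℝ} (hq : 2 ≤ q) {m : ℕ} (hm : q ≤ 2 * m) {T : ℝ} (hT : 0 < T)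
    (u : SigmaSpace N) :
    ∫⁻ x, ‖fnOf u x‖ₑ ^ q ≤ ENNReal.ofReal (T ^ (q - 2)) * (∫⁻ x, ‖fnOf u x‖ₑ ^ 2) +
      ENNReal.ofReal (T ^ (q - 2 * m)) * ∫⁻ x, ‖fnOf u x‖ₑ ^ (2 * m) := by
  have hmeas : Measurable fun x => ENNReal.ofReal (T ^ (q - 2)) * ‖fnOf u x‖ₑ ^ 2 :=
    ((stronglyMeasurable_fnOf u).measurable.enorm.pow_const 2).const_mul _
  refine (lintegral_mono fun x => enorm_rpow_le hq hm hT (fnOf u x)).trans (le_of_eq ?_)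
  rw [lintegral_add_left hmeas, lintegral_const_mul' _ _ ENNReal.ofReal_ne_top,
    lintegral_const_mul' _ _ ENNReal.ofReal_ne_top]

/-- The Sobolev inequality on bounded subsets of the energy space. -/
theorem exists_lintegral_pow_bound (hN : N = 2 ∨ N = 3) {q : ℝ} (hq : N = 3 → q < 6) :
    ∃ m : ℕ, q < 2 * m ∧ ∀ M : ℝ, ∃ C : ℝ≥0, ∀ u : SigmaSpace N, ‖u‖ ≤ M →
      ∫⁻ x, ‖fnOf u x‖ₑ ^ (2 * m) ≤ C := by
  obtain ⟨m, hm, C, hC⟩ := exists_sobolev_const hN hq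
  refine ⟨m, hm, fun M => ⟨C * (M.toNNReal ^ 2 + M.toNNReal ^ 2) ^ m, fun u hu => ?_⟩⟩
  refine (hC _ _ (isWeakGradient u) (locallyIntegrable_fnOf u)
    (locallyIntegrable_gradOf u)).trans ?_
  have h1 : ‖u‖ₑ ≤ (M.toNNReal : ℝ≥0∞) := by
    rw [← ofReal_norm]
    exact ENNReal.ofReal_le_ofReal hu
  have h2 : ‖u‖ₑ ^ 2 ≤ (M.toNNReal : ℝ≥0∞) ^ 2 := by gcongr
  push_cast
  gcongr
  · exact (lintegral_enorm_fnOf_sq_le u).trans h2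
  · exact (lintegral_enorm_gradOf_sq_le u).trans h2

theorem exists_lintegral_rpow_bound (hN : N = 2 ∨ N = 3) {q : ℝ} (hq2 : 2 ≤ q)
    (hq : N = 3 → q < 6) (M : ℝ) :
    ∃ C : ℝ≥0, ∀ u : SigmaSpace N, ‖u‖ ≤ M → ∫⁻ x, ‖fnOf u x‖ₑ ^ q ≤ C := by
  obtain ⟨m, hm, h⟩ := exists_lintegral_pow_bound hN hq
  obtain ⟨C, hC⟩ := h M
  refine ⟨M.toNNReal ^ 2 + C, fun u hu => ?_⟩
  refine (lintegral_enorm_rpow_le hq2 hm.le one_pos u).trans ?_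
  simp only [Real.one_rpow, ENNReal.ofReal_one, one_mul]
  push_cast
  gcongr
  · refine (lintegral_enorm_fnOf_sq_le u).trans ?_
    gcongr
    rw [← ofReal_norm]
    exact ENNReal.ofReal_le_ofReal hu
  · exact hC u hu

/-- Weakly null bounded sequences converge to zero in the subcritical Lebesgue spaces. -/
theorem tendsto_lintegral_enorm_rpow (hN : N = 2 ∨ N = 3) {q : ℝ} (hq2 : 2 ≤ q)
    (hq : N = 3 → q < 6) {w : ℕ → SigmaSpace N} (h : WeakTendsto w 0)
    (hb : ∃ M, ∀ n, ‖w n‖ ≤ M) :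
    Tendsto (fun n => ∫⁻ x, ‖fnOf (w n) x‖ₑ ^ q) atTop (𝓝 0) := by
  obtain ⟨m, hm, hS⟩ := exists_lintegral_pow_bound hN hq
  obtain ⟨M, hM⟩ := id hb
  obtain ⟨C, hC⟩ := hS M
  have hT : Tendsto (fun k : ℕ => ENNReal.ofReal (((k : ℝ) + 1) ^ (q - 2 * m)) * C) atTop
      (𝓝 0) := by
    have h1 : Tendsto (fun T : ℝ => T ^ (q - 2 * m)) atTop (𝓝 0) := by
      have := tendsto_rpow_neg_atTop (y := 2 * m - q) (by linarith)
      simpa using this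
    have h2 := h1.comp (tendsto_atTop_add_const_right atTop (1 : ℝ)
      (tendsto_natCast_atTop_atTop (R := ℝ)))
    have h3 := ENNReal.Tendsto.mul_const (ENNReal.tendsto_ofReal h2) (b := (C : ℝ≥0∞))
      (Or.inr ENNReal.coe_ne_top)
    simpa [Function.comp_def] using h3
  have h2 := tendsto_lintegral_enorm_sq h hb
  rw [ENNReal.tendsto_nhds_zero] at hT ⊢
  intro ε hε
  obtain ⟨k, hk⟩ := (hT (ε / 2) (ENNReal.half_pos hε.ne')).exists
  have h3 := ENNReal.Tendsto.const_mul h2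
    (a := ENNReal.ofReal (((k : ℝ) + 1) ^ (q - 2))) (Or.inr ENNReal.ofReal_ne_top)
  rw [mul_zero, ENNReal.tendsto_nhds_zero] at h3
  filter_upwards [h3 (ε / 2) (ENNReal.half_pos hε.ne')] with n hn
  refine (lintegral_enorm_rpow_le hq2 hm.le
    (by positivity : (0 : ℝ) < (k : ℝ) + 1) (w n)).trans ?_
  rw [← ENNReal.add_halves ε]
  refine add_le_add hn (le_trans ?_ hk)
  gcongr
  exact hC _ (hM n)

end SigmaSpace

/-! ### The power functional -/

section Pointwise

theorem rpow_tangent_le {q : ℝ} (hq : 1 < q) {x y : ℝ} (hx : 0 ≤ x) (hy : 0 ≤ y) :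
    x ^ q + q * x ^ (q - 1) * (y - x) ≤ y ^ q := by
  rcases hx.eq_or_lt with rfl | hx
  · rw [Real.zero_rpow (by linarith), Real.zero_rpow (by linarith)]
    simpa using Real.rpow_nonneg hy q
  · have h := one_add_mul_self_le_rpow_one_add (s := y / x - 1) (by
      have : 0 ≤ y / x := by positivity
      linarith) hq.le
    have e : x ^ q = x ^ (q - 1) * x := by
      rw [← Real.rpow_add_one hx.ne']; norm_num
    have h2 : y ^ q = x ^ q * (1 + (y / x - 1)) ^ q := by
      rw [add_sub_cancel, ← Real.mul_rpow hx.le (by positivity), mul_div_cancel₀ _ hx.ne']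
    rw [h2]
    calc _ = x ^ q * (1 + q * (y / x - 1)) := by
          rw [e]; field_simp
      _ ≤ _ := by gcongr

/-- The gradient inequality for the convex function `‖·‖ ^ q`. -/
theorem norm_rpow_tangent_le {q : ℝ} (hq : 2 < q) (a c : ℂ) :
    ‖a‖ ^ q + q * (‖a‖ ^ (q - 2) * inner ℝ a (c - a)) ≤ ‖c‖ ^ q := by
  refine le_trans ?_ (rpow_tangent_le (by linarith) (norm_nonneg a) (norm_nonneg c))
  rcases (norm_nonneg a).eq_or_lt with h0 | h0
  · have h1 : a = 0 := norm_eq_zero.1 h0.symm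
    subst h1
    simp [Real.zero_rpow (by linarith : q - 1 ≠ 0)]
  · have e : ‖a‖ ^ (q - 1) = ‖a‖ ^ (q - 2) * ‖a‖ := by
      rw [← Real.rpow_add_one h0.ne']; ring_nf
    rw [e, inner_sub_right, real_inner_self_eq_norm_sq]
    have h1 := real_inner_le_norm a c
    have h2 : 0 ≤ q * ‖a‖ ^ (q - 2) := by positivity
    nlinarith [mul_le_mul_of_nonneg_left h1 h2]

theorem norm_rpow_smul_sub_le_aux {s : ℝ} (hs : 0 < s) {a c : ℂ} (h : ‖a‖ ≤ ‖c‖) :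
    ‖(‖c‖ ^ s : ℝ) • c - (‖a‖ ^ s : ℝ) • a‖ ≤ (s + 2) * ‖c‖ ^ s * ‖c - a‖ := by
  have e : (‖c‖ ^ s : ℝ) • c - (‖a‖ ^ s : ℝ) • a =
      (‖c‖ ^ s : ℝ) • (c - a) + (‖c‖ ^ s - ‖a‖ ^ s : ℝ) • a := by
    rw [smul_sub, sub_smul]; abel
  have hmono : ‖a‖ ^ s ≤ ‖c‖ ^ s := Real.rpow_le_rpow (norm_nonneg a) h hs.le
  have h1 : (‖c‖ ^ s - ‖a‖ ^ s) * ‖a‖ ≤ (s + 1) * ‖c‖ ^ s * (‖c‖ - ‖a‖) := by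
    have h2 := rpow_tangent_le (q := s + 1) (by linarith) (norm_nonneg c) (norm_nonneg a)
    rw [add_sub_cancel_right, Real.rpow_add_one' (norm_nonneg c) (by linarith),
      Real.rpow_add_one' (norm_nonneg a) (by linarith)] at h2
    have h3 : ‖c‖ ^ s * ‖a‖ ≤ ‖c‖ ^ s * ‖c‖ := by gcongr
    nlinarith
  have h4 : ‖c‖ - ‖a‖ ≤ ‖c - a‖ := norm_sub_norm_le c a
  rw [e]
  calc _ ≤ ‖(‖c‖ ^ s : ℝ) • (c - a)‖ + ‖(‖c‖ ^ s - ‖a‖ ^ s : ℝ) • a‖ := norm_add_le _ _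
    _ = ‖c‖ ^ s * ‖c - a‖ + (‖c‖ ^ s - ‖a‖ ^ s) * ‖a‖ := by
        rw [norm_smul, norm_smul, Real.norm_of_nonneg (by positivity),
          Real.norm_of_nonneg (by linarith)]
    _ ≤ ‖c‖ ^ s * ‖c - a‖ + (s + 1) * ‖c‖ ^ s * ‖c - a‖ := by
        have h5 : (s + 1) * ‖c‖ ^ s * (‖c‖ - ‖a‖) ≤ (s + 1) * ‖c‖ ^ s * ‖c - a‖ := by gcongr
        linarith
    _ = _ := by ring

theorem norm_rpow_smul_sub_le {s : ℝ} (hs : 0 < s) (a c : ℂ) :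
    ‖(‖c‖ ^ s : ℝ) • c - (‖a‖ ^ s : ℝ) • a‖ ≤ (s + 2) * (‖a‖ ^ s + ‖c‖ ^ s) * ‖c - a‖ := by
  rcases le_total ‖a‖ ‖c‖ with h | h
  · refine (norm_rpow_smul_sub_le_aux hs h).trans ?_
    gcongr
    have : 0 ≤ ‖a‖ ^ s := by positivity
    linarith
  · rw [norm_sub_rev, norm_sub_rev c a]
    refine (norm_rpow_smul_sub_le_aux hs h).trans ?_
    gcongr
    have : 0 ≤ ‖c‖ ^ s := by positivity
    linarith

/-- A quadratic bound for the first-order Taylor remainder of `‖·‖ ^ q`. -/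
theorem abs_norm_rpow_remainder_le {q : ℝ} (hq : 2 < q) (a b : ℂ) :
    |‖a + b‖ ^ q - ‖a‖ ^ q - q * (‖a‖ ^ (q - 2) * inner ℝ a b)| ≤
      q ^ 2 * (1 + 2 ^ (q - 2)) * (‖a‖ ^ (q - 2) * ‖b‖ ^ 2 + ‖b‖ ^ q) := by
  have h1 := norm_rpow_tangent_le hq a (a + b)
  have h2 := norm_rpow_tangent_le hq (a + b) a
  rw [add_sub_cancel_left] at h1
  rw [show a - (a + b) = -b by abel, inner_neg_right] at h2
  rw [abs_of_nonneg (by linarith)]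
  have h3 : ‖a + b‖ ^ (q - 2) * inner ℝ (a + b) b - ‖a‖ ^ (q - 2) * inner ℝ a b ≤
      q * (‖a‖ ^ (q - 2) + ‖a + b‖ ^ (q - 2)) * ‖b‖ * ‖b‖ := by
    have e : ‖a + b‖ ^ (q - 2) * inner ℝ (a + b) b - ‖a‖ ^ (q - 2) * inner ℝ a b =
        inner ℝ ((‖a + b‖ ^ (q - 2) : ℝ) • (a + b) - (‖a‖ ^ (q - 2) : ℝ) • a) b := by
      rw [inner_sub_left, real_inner_smul_left, real_inner_smul_left]
    rw [e]
    refine (real_inner_le_norm _ _).trans ?_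
    have := norm_rpow_smul_sub_le (s := q - 2) (by linarith) a (a + b)
    rw [add_sub_cancel_left, sub_add_cancel] at this
    gcongr
  have h4 : ‖a + b‖ ^ (q - 2) ≤ 2 ^ (q - 2) * (‖a‖ ^ (q - 2) + ‖b‖ ^ (q - 2)) := by
    have hm : ‖a + b‖ ≤ 2 * max ‖a‖ ‖b‖ := by
      have := norm_add_le a b
      have := le_max_left ‖a‖ ‖b‖
      have := le_max_right ‖a‖ ‖b‖
      linarith
    have hq2 : 0 ≤ q - 2 := by linarith
    calc ‖a + b‖ ^ (q - 2) ≤ (2 * max ‖a‖ ‖b‖) ^ (q - 2) :=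
          Real.rpow_le_rpow (norm_nonneg _) hm hq2
      _ = 2 ^ (q - 2) * max ‖a‖ ‖b‖ ^ (q - 2) := Real.mul_rpow (by norm_num) (by positivity)
      _ ≤ _ := by
        gcongr
        have ha : 0 ≤ ‖a‖ ^ (q - 2) := by positivity
        have hb : 0 ≤ ‖b‖ ^ (q - 2) := by positivity
        rcases max_choice ‖a‖ ‖b‖ with h | h <;> rw [h] <;> linarith
  have hb : ‖b‖ ^ q = ‖b‖ ^ (q - 2) * ‖b‖ ^ 2 := by
    rcases (norm_nonneg b).eq_or_lt with h0 | h0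
    · rw [← h0, Real.zero_rpow (by linarith)]; norm_num
    · rw [← Real.rpow_natCast, ← Real.rpow_add h0]; norm_num
  have hA : 0 ≤ ‖a‖ ^ (q - 2) := by positivity
  have hB : 0 ≤ ‖b‖ ^ (q - 2) := by positivity
  calc _ ≤ q * (q * (‖a‖ ^ (q - 2) + ‖a + b‖ ^ (q - 2)) * ‖b‖ * ‖b‖) := by
        have := mul_le_mul_of_nonneg_left h3 (by linarith : 0 ≤ q)
        linarith
    _ ≤ q * (q * ((1 + 2 ^ (q - 2)) * (‖a‖ ^ (q - 2) + ‖b‖ ^ (q - 2))) * ‖b‖ * ‖b‖) := by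
        gcongr
        linarith
    _ = _ := by rw [hb]; ring

theorem norm_rpow_mul_sq_le {q : ℝ} (hq : 2 < q) (a b : ℂ) :
    ‖a‖ ^ (q - 2) * ‖b‖ ^ 2 ≤ ‖a‖ ^ q + ‖b‖ ^ q := by
  have e : ∀ z : ℂ, ‖z‖ ^ q = ‖z‖ ^ (q - 2) * ‖z‖ ^ 2 := fun z => by
    rcases (norm_nonneg z).eq_or_lt with h0 | h0
    · rw [← h0, Real.zero_rpow (by linarith)]; norm_num
    · rw [← Real.rpow_natCast, ← Real.rpow_add h0]; norm_num
  have ha : 0 ≤ ‖a‖ ^ q := by positivity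
  have hb : 0 ≤ ‖b‖ ^ q := by positivity
  have hq2 : 0 ≤ q - 2 := by linarith
  rcases le_total ‖a‖ ‖b‖ with h | h
  · have : ‖a‖ ^ (q - 2) * ‖b‖ ^ 2 ≤ ‖b‖ ^ q := by rw [e b]; gcongr
    linarith
  · have : ‖a‖ ^ (q - 2) * ‖b‖ ^ 2 ≤ ‖a‖ ^ q := by rw [e a]; gcongr
    linarith

theorem abs_norm_rpow_mul_inner_le {q : ℝ} (hq : 2 < q) (a b : ℂ) :
    |‖a‖ ^ (q - 2) * inner ℝ a b| ≤ 2 * ‖a‖ ^ q + ‖b‖ ^ q := by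
  have h1 := norm_rpow_mul_sq_le hq a b
  have e : ‖a‖ ^ q = ‖a‖ ^ (q - 2) * ‖a‖ ^ 2 := by
    rcases (norm_nonneg a).eq_or_lt with h0 | h0
    · rw [← h0, Real.zero_rpow (by linarith)]; norm_num
    · rw [← Real.rpow_natCast, ← Real.rpow_add h0]; norm_num
  have hA : 0 ≤ ‖a‖ ^ (q - 2) := by positivity
  rw [abs_mul, abs_of_nonneg hA]
  have h2 : |inner ℝ a b| ≤ ‖a‖ ^ 2 + ‖b‖ ^ 2 := by
    refine (abs_real_inner_le_norm a b).trans ?_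
    nlinarith [sq_nonneg (‖a‖ - ‖b‖), sq_nonneg ‖a‖, sq_nonneg ‖b‖]
  calc _ ≤ ‖a‖ ^ (q - 2) * (‖a‖ ^ 2 + ‖b‖ ^ 2) := by gcongr
    _ ≤ _ := by rw [mul_add, ← e]; linarith

end Pointwise

namespace SigmaSpace

variable {N : ℕ} {q : ℝ}

/-- The functional `u ↦ ∫ |u|^q`. -/
noncomputable def powInt (q : ℝ) (u : SigmaSpace N) : ℝ := ∫ x, ‖fnOf u x‖ ^ q

theorem measurable_norm_rpow (u : SigmaSpace N) (q : ℝ) : Measurable fun x => ‖fnOf u x‖ ^ q :=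
  (stronglyMeasurable_fnOf u).measurable.norm.pow_const q

theorem enorm_norm_rpow (hq : 2 < q) (z : ℂ) : ‖‖z‖ ^ q‖ₑ = ‖z‖ₑ ^ q := by
  rw [← ofReal_norm, ← ofReal_norm, ENNReal.ofReal_rpow_of_nonneg (norm_nonneg z) (by linarith),
    Real.norm_of_nonneg (by positivity)]

theorem powInt_eq_toReal (hq : 2 < q) (u : SigmaSpace N) :
    powInt q u = (∫⁻ x, ‖fnOf u x‖ₑ ^ q).toReal := by
  rw [powInt, integral_eq_lintegral_of_nonneg_ae (Eventually.of_forall fun x => by positivity)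
    (measurable_norm_rpow u q).aestronglyMeasurable]
  congr 1
  refine lintegral_congr fun x => ?_
  rw [← enorm_norm_rpow hq, ← ofReal_norm, Real.norm_of_nonneg (by positivity)]

theorem integrable_norm_rpow (hN : N = 2 ∨ N = 3) (hq2 : 2 < q) (hq : N = 3 → q < 6)
    (u : SigmaSpace N) : Integrable fun x => ‖fnOf u x‖ ^ q := by
  obtain ⟨C, hC⟩ := exists_lintegral_rpow_bound (N := N) hN hq2.le hq ‖u‖
  refine ⟨(measurable_norm_rpow u q).aestronglyMeasurable, ?_⟩
  rw [HasFiniteIntegral]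
  simp_rw [enorm_norm_rpow hq2]
  exact (hC u le_rfl).trans_lt ENNReal.coe_lt_top

theorem powInt_nonneg (u : SigmaSpace N) : 0 ≤ powInt q u :=
  integral_nonneg fun x => by positivity

theorem powInt_smul (t : ℝ) (ht : 0 < t) (u : SigmaSpace N) :
    powInt q (t • u) = t ^ q * powInt q u := by
  rw [powInt, powInt, ← integral_const_mul]
  refine integral_congr_ae ?_
  filter_upwards [fnOf_smul t u] with x hx
  rw [hx, norm_smul, Real.norm_of_nonneg ht.le, Real.mul_rpow ht.le (norm_nonneg _)]

theorem powInt_pos (hN : N = 2 ∨ N = 3) (hq2 : 2 < q) (hq : N = 3 → q < 6)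
    (u : SigmaSpace N) (hu : u ≠ 0) : 0 < powInt q u := by
  refine (powInt_nonneg u).lt_of_ne' fun h0 => hu (ext_fn ?_)
  have h1 := (integral_eq_zero_iff_of_nonneg (fun x => by positivity)
    (integrable_norm_rpow hN hq2 hq u)).1 h0
  filter_upwards [h1, fnOf_zero (N := N)] with x hx hx0
  rw [hx0]
  have : ‖fnOf u x‖ = 0 := ((Real.rpow_eq_zero (norm_nonneg _) (by linarith)).1 hx)
  exact norm_eq_zero.1 this

theorem exists_powInt_le (hN : N = 2 ∨ N = 3) (hq2 : 2 < q) (hq : N = 3 → q < 6) :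
    ∃ C : ℝ, 0 ≤ C ∧ ∀ u : SigmaSpace N, powInt q u ≤ C * ‖u‖ ^ q := by
  obtain ⟨C, hC⟩ := exists_lintegral_rpow_bound (N := N) hN hq2.le hq 1
  refine ⟨C, C.2, fun u => ?_⟩
  rcases eq_or_ne u 0 with rfl | hu
  · have : powInt q (0 : SigmaSpace N) = 0 := by
      rw [powInt]
      refine integral_eq_zero_of_ae ?_
      filter_upwards [fnOf_zero (N := N)] with x hx
      rw [hx, norm_zero, Real.zero_rpow (by linarith), Pi.zero_apply]
    rw [this]
    have := C.2
    positivity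
  · have hn : 0 < ‖u‖ := norm_pos_iff.2 hu
    set v := ‖u‖⁻¹ • u with hv
    have huv : u = ‖u‖ • v := by rw [hv, smul_smul, mul_inv_cancel₀ hn.ne', one_smul]
    have hv1 : ‖v‖ ≤ 1 := by
      rw [hv, norm_smul, norm_inv, norm_norm, inv_mul_cancel₀ hn.ne']
    have hb : powInt q v ≤ C := by
      rw [powInt_eq_toReal hq2]
      exact ENNReal.toReal_le_coe_of_le_coe (hC v hv1)
    calc powInt q u = ‖u‖ ^ q * powInt q v := by rw [← powInt_smul _ hn, ← huv]
      _ ≤ ‖u‖ ^ q * C := by gcongr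
      _ = _ := mul_comm _ _

theorem weakTendsto_sub {u : ℕ → SigmaSpace N} {v : SigmaSpace N} (h : WeakTendsto u v) :
    WeakTendsto (fun n => u n - v) 0 := fun f => by
  simpa using (h f).sub_const (f v)

/-- The power functional is weakly sequentially continuous. -/
theorem powInt_weakCont (hN : N = 2 ∨ N = 3) (hq2 : 2 < q) (hq : N = 3 → q < 6)
    (u : ℕ → SigmaSpace N) (v : SigmaSpace N) (h : WeakTendsto u v) (hb : ∃ M, ∀ n, ‖u n‖ ≤ M) :
    Tendsto (fun n => powInt q (u n)) atTop (𝓝 (powInt q v)) := by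
  set r : ℝ≥0∞ := ENNReal.ofReal q with hr
  have hr0 : r ≠ 0 := by rw [hr]; simp; linarith
  have hrt : r ≠ ∞ := ENNReal.ofReal_ne_top
  have hrr : r.toReal = q := ENNReal.toReal_ofReal (by linarith)
  have hr1 : Fact (1 ≤ r) := ⟨by rw [hr, ENNReal.one_le_ofReal]; linarith⟩
  have hmem : ∀ w : SigmaSpace N, MemLp (fnOf w) r volume := fun w => by
    refine (integrable_norm_rpow_iff (stronglyMeasurable_fnOf w).aestronglyMeasurable hr0 hrt).1 ?_
    rw [hrr]
    exact integrable_norm_rpow hN hq2 hq w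
  have hnorm : ∀ w : SigmaSpace N, powInt q w = ‖(hmem w).toLp‖ ^ q := fun w => by
    rw [Lp.norm_toLp, eLpNorm_eq_lintegral_rpow_enorm_toReal hr0 hrt, hrr, powInt_eq_toReal hq2,
      ENNReal.toReal_rpow, ← ENNReal.rpow_mul, one_div_mul_cancel (by linarith), ENNReal.rpow_one]
  simp_rw [hnorm]
  have hlim : Tendsto (fun n => (hmem (u n)).toLp) atTop (𝓝 (hmem v).toLp) := by
    rw [Lp.tendsto_Lp_iff_tendsto_eLpNorm'']
    have h0 := tendsto_lintegral_enorm_rpow hN hq2.le hq (weakTendsto_sub h) (by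
      obtain ⟨M, hM⟩ := hb
      exact ⟨M + ‖v‖, fun n => (norm_sub_le _ _).trans (by gcongr; exact hM n)⟩)
    have h1 : Tendsto (fun n => (∫⁻ x, ‖fnOf (u n - v) x‖ₑ ^ q) ^ (1 / q)) atTop (𝓝 0) := by
      have := (ENNReal.continuous_rpow_const (y := 1 / q)).tendsto 0 |>.comp h0
      rwa [ENNReal.zero_rpow_of_pos (by apply one_div_pos.2; linarith)] at this
    refine h1.congr fun n => ?_
    rw [eLpNorm_eq_lintegral_rpow_enorm_toReal hr0 hrt, hrr]
    congr 1
    refine lintegral_congr_ae ?_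
    filter_upwards [fnOf_sub (u n) v] with x hx
    rw [hx, Pi.sub_apply]
  exact hlim.norm.rpow_const (Or.inr (by linarith))

theorem integrable_norm_rpow_mul_inner (hN : N = 2 ∨ N = 3) (hq2 : 2 < q) (hq : N = 3 → q < 6)
    (u h : SigmaSpace N) :
    Integrable fun x => ‖fnOf u x‖ ^ (q - 2) * inner ℝ (fnOf u x) (fnOf h x) := by
  refine Integrable.mono' (((integrable_norm_rpow hN hq2 hq u).const_mul 2).add
    (integrable_norm_rpow hN hq2 hq h)) ?_ (Eventually.of_forall fun x =>
      abs_norm_rpow_mul_inner_le hq2 _ _)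
  exact ((measurable_norm_rpow u (q - 2)).aestronglyMeasurable).mul
    ((stronglyMeasurable_fnOf u).inner (stronglyMeasurable_fnOf h)).aestronglyMeasurable

theorem integrable_norm_rpow_mul_sq (hN : N = 2 ∨ N = 3) (hq2 : 2 < q) (hq : N = 3 → q < 6)
    (u h : SigmaSpace N) :
    Integrable fun x => ‖fnOf u x‖ ^ (q - 2) * ‖fnOf h x‖ ^ 2 := by
  refine Integrable.mono' ((integrable_norm_rpow hN hq2 hq u).add
    (integrable_norm_rpow hN hq2 hq h)) ?_ (Eventually.of_forall fun x => ?_)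
  · exact ((measurable_norm_rpow u (q - 2)).mul
      ((stronglyMeasurable_fnOf h).measurable.norm.pow_const 2)).aestronglyMeasurable
  · rw [Real.norm_of_nonneg (by positivity)]
    exact norm_rpow_mul_sq_le hq2 _ _

theorem integral_norm_rpow_mul_sq_le (hN : N = 2 ∨ N = 3) (hq2 : 2 < q) (hq : N = 3 → q < 6)
    {C : ℝ} (hC : ∀ u : SigmaSpace N, powInt q u ≤ C * ‖u‖ ^ q) (u h : SigmaSpace N) :
    ∫ x, ‖fnOf u x‖ ^ (q - 2) * ‖fnOf h x‖ ^ 2 ≤ (powInt q u + C) * ‖h‖ ^ 2 := by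
  rcases eq_or_ne h 0 with rfl | hh
  · refine le_of_eq ?_
    rw [norm_zero, zero_pow two_ne_zero, mul_zero]
    refine integral_eq_zero_of_ae ?_
    filter_upwards [fnOf_zero (N := N)] with x hx
    simp [hx]
  · have hn : 0 < ‖h‖ := norm_pos_iff.2 hh
    set v := ‖h‖⁻¹ • h with hv
    have huv : h = ‖h‖ • v := by rw [hv, smul_smul, mul_inv_cancel₀ hn.ne', one_smul]
    have hv1 : ‖v‖ = 1 := by rw [hv, norm_smul, norm_inv, norm_norm, inv_mul_cancel₀ hn.ne']
    have h1 : ∫ x, ‖fnOf u x‖ ^ (q - 2) * ‖fnOf h x‖ ^ 2 =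
        ‖h‖ ^ 2 * ∫ x, ‖fnOf u x‖ ^ (q - 2) * ‖fnOf v x‖ ^ 2 := by
      rw [← integral_const_mul]
      refine integral_congr_ae ?_
      have := fnOf_smul ‖h‖ v
      rw [← huv] at this
      filter_upwards [this] with x hx
      rw [hx, norm_smul, norm_norm]
      ring
    have h2 : ∫ x, ‖fnOf u x‖ ^ (q - 2) * ‖fnOf v x‖ ^ 2 ≤ powInt q u + powInt q v := by
      rw [powInt, powInt, ← integral_add (integrable_norm_rpow hN hq2 hq u)
        (integrable_norm_rpow hN hq2 hq v)]
      exact integral_mono (integrable_norm_rpow_mul_sq hN hq2 hq u v)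
        ((integrable_norm_rpow hN hq2 hq u).add (integrable_norm_rpow hN hq2 hq v))
        fun x => norm_rpow_mul_sq_le hq2 _ _
    have h3 := hC v
    rw [hv1, Real.one_rpow, mul_one] at h3
    rw [h1, mul_comm]
    gcongr
    linarith

/-- The Fréchet derivative of the power functional at `u`, namely
`h ↦ q ∫ |u|^(q-2) Re(ū h)`. -/
noncomputable def powIntDeriv (hN : N = 2 ∨ N = 3) (hq2 : 2 < q) (hq : N = 3 → q < 6)
    (u : SigmaSpace N) : SigmaSpace N →ₗ[ℝ] ℝ where
  toFun h := q * ∫ x, ‖fnOf u x‖ ^ (q - 2) * inner ℝ (fnOf u x) (fnOf h x)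
  map_add' h k := by
    rw [← mul_add, ← integral_add (integrable_norm_rpow_mul_inner hN hq2 hq u h)
      (integrable_norm_rpow_mul_inner hN hq2 hq u k)]
    congr 1
    refine integral_congr_ae ?_
    filter_upwards [fnOf_add h k] with x hx
    rw [hx, inner_add_right, mul_add]
  map_smul' c h := by
    rw [RingHom.id_apply, smul_eq_mul, mul_left_comm c q, ← integral_const_mul c]
    congr 1
    refine integral_congr_ae ?_
    filter_upwards [fnOf_smul c h] with x hx
    rw [hx, inner_smul_right_eq_smul, smul_eq_mul, mul_left_comm]

theorem powIntDeriv_bound (hN : N = 2 ∨ N = 3) (hq2 : 2 < q) (hq : N = 3 → q < 6)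
    (u : SigmaSpace N) : ∃ K, ∀ h, ‖powIntDeriv hN hq2 hq u h‖ ≤ K * ‖h‖ := by
  obtain ⟨C, hC0, hC⟩ := exists_powInt_le (N := N) hN hq2 hq
  refine ⟨q * (2 * powInt q u + C) / 1, LinearMap.bound_of_ball_bound' (𝕜 := ℝ) one_pos _
    (powIntDeriv hN hq2 hq u) fun h hh => ?_⟩
  have hh1 : ‖h‖ ≤ 1 := by simpa using hh
  have h1 : powInt q h ≤ C := by
    refine (hC h).trans ?_
    have : ‖h‖ ^ q ≤ 1 := Real.rpow_le_one (norm_nonneg h) hh1 (by linarith)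
    nlinarith
  have hq0 : 0 ≤ q := by linarith
  change ‖q * ∫ x, ‖fnOf u x‖ ^ (q - 2) * inner ℝ (fnOf u x) (fnOf h x)‖ ≤ _
  rw [norm_mul, Real.norm_of_nonneg hq0]
  gcongr
  calc _ ≤ ∫ x, (2 * ‖fnOf u x‖ ^ q + ‖fnOf h x‖ ^ q) :=
        norm_integral_le_of_norm_le (((integrable_norm_rpow hN hq2 hq u).const_mul 2).add
          (integrable_norm_rpow hN hq2 hq h)) (Eventually.of_forall fun x =>
            abs_norm_rpow_mul_inner_le hq2 _ _)
    _ = 2 * powInt q u + powInt q h := by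
        rw [integral_add ((integrable_norm_rpow hN hq2 hq u).const_mul 2)
          (integrable_norm_rpow hN hq2 hq h), integral_const_mul]
        rfl
    _ ≤ _ := by linarith

theorem powInt_remainder_le (hN : N = 2 ∨ N = 3) (hq2 : 2 < q) (hq : N = 3 → q < 6)
    (u : SigmaSpace N) : ∃ K, ∀ h, ‖h‖ ≤ 1 →
      ‖powInt q (u + h) - powInt q u - powIntDeriv hN hq2 hq u h‖ ≤ K * ‖h‖ ^ 2 := by
  obtain ⟨C, hC0, hC⟩ := exists_powInt_le (N := N) hN hq2 hq
  refine ⟨q ^ 2 * (1 + 2 ^ (q - 2)) * (powInt q u + C + C), fun h hh => ?_⟩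
  have i1 := integrable_norm_rpow hN hq2 hq (u + h)
  have i2 := integrable_norm_rpow hN hq2 hq u
  have i3 := integrable_norm_rpow_mul_inner hN hq2 hq u h
  have i4 := integrable_norm_rpow_mul_sq hN hq2 hq u h
  have i5 := integrable_norm_rpow hN hq2 hq h
  have e : powInt q (u + h) - powInt q u - powIntDeriv hN hq2 hq u h =
      ∫ x, (‖fnOf (u + h) x‖ ^ q - ‖fnOf u x‖ ^ q -
        q * (‖fnOf u x‖ ^ (q - 2) * inner ℝ (fnOf u x) (fnOf h x))) := by
    have i12 : Integrable fun x => ‖fnOf (u + h) x‖ ^ q - ‖fnOf u x‖ ^ q := i1.sub i2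
    rw [integral_sub i12 (i3.const_mul q), integral_sub i1 i2, integral_const_mul]
    rfl
  have hh2 : powInt q h ≤ C * ‖h‖ ^ 2 := by
    refine (hC h).trans ?_
    gcongr
    rw [← Real.rpow_natCast]
    exact Real.rpow_le_rpow_of_exponent_ge' (norm_nonneg h) hh (by norm_num)
      (by push_cast; linarith)
  rw [e]
  calc _ ≤ ∫ x, q ^ 2 * (1 + 2 ^ (q - 2)) *
          (‖fnOf u x‖ ^ (q - 2) * ‖fnOf h x‖ ^ 2 + ‖fnOf h x‖ ^ q) := by
        refine norm_integral_le_of_norm_le ((i4.add i5).const_mul _) ?_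
        filter_upwards [fnOf_add u h] with x hx
        rw [hx]
        exact abs_norm_rpow_remainder_le hq2 _ _
    _ = q ^ 2 * (1 + 2 ^ (q - 2)) *
          ((∫ x, ‖fnOf u x‖ ^ (q - 2) * ‖fnOf h x‖ ^ 2) + powInt q h) := by
        rw [integral_const_mul, integral_add i4 i5]
        rfl
    _ ≤ q ^ 2 * (1 + 2 ^ (q - 2)) * ((powInt q u + C) * ‖h‖ ^ 2 + C * ‖h‖ ^ 2) := by
        gcongr
        exact integral_norm_rpow_mul_sq_le hN hq2 hq hC u h
    _ = _ := by ring

theorem differentiableAt_powInt (hN : N = 2 ∨ N = 3) (hq2 : 2 < q) (hq : N = 3 → q < 6)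
    (u : SigmaSpace N) : DifferentiableAt ℝ (powInt (N := N) q) u := by
  obtain ⟨K, hK⟩ := powIntDeriv_bound hN hq2 hq u
  obtain ⟨K', hK'⟩ := powInt_remainder_le hN hq2 hq u
  refine HasFDerivAt.differentiableAt (f' := (powIntDeriv hN hq2 hq u).mkContinuous K hK) ?_
  rw [hasFDerivAt_iff_isLittleO_nhds_zero]
  have hO : (fun h => powInt q (u + h) - powInt q u -
      (powIntDeriv hN hq2 hq u).mkContinuous K hK h) =O[𝓝 0] fun h => ‖h‖ ^ 2 := by
    refine Asymptotics.IsBigO.of_bound K' ?_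
    filter_upwards [Metric.closedBall_mem_nhds (0 : SigmaSpace N) one_pos] with h hh
    have := hK' h (by simpa using hh)
    rw [norm_pow, norm_norm]
    exact this
  exact hO.trans_isLittleO (Asymptotics.isLittleO_norm_pow_id one_lt_two)

end SigmaSpace

/-! ### The quadratic form -/

/-- A vector with `N ≤ 3` real entries, completed by zeros to three entries. -/
def padThree {N : ℕ} (v : Fin N → ℝ) : Fin 3 → ℝ :=
  fun k => if h : (k : ℕ) < N then v ⟨k, h⟩ else 0

/-- The components of the rotation field `Ω ∧ x`, so that `L_Ω u = i (Ω ∧ x) · ∇u`. They are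
written as triple products `Ω · (x ∧ eⱼ)`, which covers both dimensions. -/
noncomputable def rotCoeff {N : ℕ} (Ω : EuclideanSpace ℝ (Fin 3)) (j : Fin N)
    (x : EuclideanSpace ℝ (Fin N)) : ℝ :=
  ∑ k : Fin 3, Ω k * crossProduct (padThree x) (padThree (Pi.single j 1)) k

theorem rotationOp_eq {N : ℕ} (hN : N = 2 ∨ N = 3) (Ω : EuclideanSpace ℝ (Fin 3))
    (u : SigmaSpace N) (x : EuclideanSpace ℝ (Fin N)) :
    rotationOp Ω u x = ∑ j, ((rotCoeff Ω j x : ℝ) : ℂ) * (Complex.I * gradOf u x j) := by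
  rcases hN with rfl | rfl
  · simp [rotationOp, angularMomentum, rotCoeff, toThree, padThree, cross_apply,
      Fin.sum_univ_three, Fin.sum_univ_two]
    ring
  · simp [rotationOp, angularMomentum, rotCoeff, toThree, padThree, cross_apply,
      Fin.sum_univ_three, Pi.single_apply]
    ring

theorem sum_rotCoeff_sq_le {N : ℕ} (hN : N = 2 ∨ N = 3) (Ω : EuclideanSpace ℝ (Fin 3))
    (x : EuclideanSpace ℝ (Fin N)) : ∑ j, rotCoeff Ω j x ^ 2 ≤ (‖Ω‖ * ‖x‖) ^ 2 := by
  rw [mul_pow, EuclideanSpace.real_norm_sq_eq, EuclideanSpace.real_norm_sq_eq]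
  rcases hN with rfl | rfl
  · simp [rotCoeff, padThree, cross_apply, Fin.sum_univ_three, Fin.sum_univ_two]
    nlinarith [mul_nonneg (sq_nonneg (Ω 0)) (sq_nonneg (x 0)),
      mul_nonneg (sq_nonneg (Ω 0)) (sq_nonneg (x 1)),
      mul_nonneg (sq_nonneg (Ω 1)) (sq_nonneg (x 0)),
      mul_nonneg (sq_nonneg (Ω 1)) (sq_nonneg (x 1))]
  · simp [rotCoeff, padThree, cross_apply, Fin.sum_univ_three, Pi.single_apply]
    nlinarith [sq_nonneg (Ω 0 * x 0 + Ω 1 * x 1 + Ω 2 * x 2)]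

theorem abs_rotCoeff_le {N : ℕ} (hN : N = 2 ∨ N = 3) (Ω : EuclideanSpace ℝ (Fin 3)) (j : Fin N)
    (x : EuclideanSpace ℝ (Fin N)) : |rotCoeff Ω j x| ≤ ‖Ω‖ * ‖x‖ := by
  refine abs_le_of_sq_le_sq ?_ (by positivity)
  exact (Finset.single_le_sum (f := fun j => rotCoeff Ω j x ^ 2) (fun j _ => sq_nonneg _)
    (Finset.mem_univ j)).trans (sum_rotCoeff_sq_le hN Ω x)

theorem continuous_rotCoeff {N : ℕ} (Ω : EuclideanSpace ℝ (Fin 3)) (j : Fin N) :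
    Continuous (rotCoeff Ω j) := by
  have hpad : ∀ k : Fin 3, Continuous fun x : EuclideanSpace ℝ (Fin N) => padThree x k := by
    intro k
    unfold padThree
    split_ifs <;> fun_prop
  unfold rotCoeff
  refine continuous_finsetSum _ fun k _ => continuous_const.mul ?_
  fin_cases k <;> simp only [cross_apply] <;> simp <;>
    exact ((hpad _).mul continuous_const).sub ((hpad _).mul continuous_const)

theorem norm_rotationOp_le {N : ℕ} (hN : N = 2 ∨ N = 3) (Ω : EuclideanSpace ℝ (Fin 3))
    (u : SigmaSpace N) (x : EuclideanSpace ℝ (Fin N)) :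
    ‖rotationOp Ω u x‖ ≤ ‖Ω‖ * ‖x‖ * ‖gradOf u x‖ := by
  rw [rotationOp_eq hN]
  calc _ ≤ ∑ j, ‖((rotCoeff Ω j x : ℝ) : ℂ) * (Complex.I * gradOf u x j)‖ := norm_sum_le _ _
    _ = ∑ j, |rotCoeff Ω j x| * ‖gradOf u x j‖ := by simp
    _ ≤ √(∑ j, |rotCoeff Ω j x| ^ 2) * √(∑ j, ‖gradOf u x j‖ ^ 2) :=
        Real.sum_mul_le_sqrt_mul_sqrt _ _ _
    _ ≤ _ := by
        rw [← EuclideanSpace.norm_eq]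
        gcongr
        simp_rw [sq_abs]
        exact Real.sqrt_le_iff.2 ⟨by positivity, sum_rotCoeff_sq_le hN Ω x⟩

section Form

variable {H L ι : Type*} [NormedAddCommGroup H] [NormedSpace ℝ H] [NormedAddCommGroup L]
  [InnerProductSpace ℝ L] [Fintype ι]

/-- The bilinear form `(u, v) ↦ ⟪S u, T v⟫`. -/
noncomputable def innerForm (S T : H →L[ℝ] L) : H →L[ℝ] H →L[ℝ] ℝ :=
  (isBoundedBilinearMap_inner (𝕜 := ℝ) (E := L)).toContinuousLinearMap.bilinearComp S T

theorem innerForm_apply (S T : H →L[ℝ] L) (u v : H) : innerForm S T u v = inner ℝ (S u) (T v) :=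
  rfl

/-- The symmetric bilinear form whose quadratic form is
`∑ⱼ ‖Gⱼ u‖² + ∑ⱼ cⱼ ‖Xⱼ u‖² + 2 ∑ⱼ ⟪Rⱼ u, Jⱼ u⟫ + ω ‖U u‖²`. -/
noncomputable def formSum (G X R J : ι → H →L[ℝ] L) (c : ι → ℝ) (U : H →L[ℝ] L) (ω : ℝ) :
    H →L[ℝ] H →L[ℝ] ℝ :=
  ∑ j, innerForm (G j) (G j) + ∑ j, c j • innerForm (X j) (X j) +
    ∑ j, (innerForm (R j) (J j) + innerForm (J j) (R j)) + ω • innerForm U U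

theorem formSum_apply (G X R J : ι → H →L[ℝ] L) (c : ι → ℝ) (U : H →L[ℝ] L) (ω : ℝ) (u v : H) :
    formSum G X R J c U ω u v = ∑ j, inner ℝ (G j u) (G j v) +
      ∑ j, c j * inner ℝ (X j u) (X j v) +
      ∑ j, (inner ℝ (R j u) (J j v) + inner ℝ (J j u) (R j v)) + ω * inner ℝ (U u) (U v) := by
  simp only [formSum, add_apply, sum_apply, smul_apply, smul_eq_mul, innerForm_apply]

theorem formSum_symm (G X R J : ι → H →L[ℝ] L) (c : ι → ℝ) (U : H →L[ℝ] L) (ω : ℝ) (u v : H) :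
    formSum G X R J c U ω u v = formSum G X R J c U ω v u := by
  have h : ∀ (S T : H →L[ℝ] L), inner ℝ (S u) (T v) = inner ℝ (T v) (S u) := fun S T =>
    real_inner_comm _ _
  simp_rw [formSum_apply, h, add_comm]

theorem formSum_self (G X R J : ι → H →L[ℝ] L) (c : ι → ℝ) (U : H →L[ℝ] L) (ω : ℝ) (u : H) :
    formSum G X R J c U ω u u = ∑ j, ‖G j u‖ ^ 2 + ∑ j, c j * ‖X j u‖ ^ 2 +
      2 * ∑ j, inner ℝ (R j u) (J j u) + ω * ‖U u‖ ^ 2 := by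
  simp_rw [formSum_apply, real_inner_self_eq_norm_sq, Finset.mul_sum]
  congr 2
  refine Finset.sum_congr rfl fun j _ => ?_
  rw [real_inner_comm, two_mul]

end Form

namespace SigmaSpace

variable {N : ℕ}

theorem integrable_norm_sq {F : Type*} [NormedAddCommGroup F]
    (f : Lp F 2 (volume : Measure (EuclideanSpace ℝ (Fin N)))) :
    Integrable fun x => ‖f x‖ ^ 2 :=
  (Lp.memLp f).integrable_norm_pow two_ne_zero

theorem integral_norm_sq_eq {F : Type*} [NormedAddCommGroup F]
    (f : Lp F 2 (volume : Measure (EuclideanSpace ℝ (Fin N)))) :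
    ∫ x, ‖f x‖ ^ 2 = ‖f‖ ^ 2 := by
  have h := lintegral_enorm_sq_eq f
  rw [integral_eq_lintegral_of_nonneg_ae (Eventually.of_forall fun x => by positivity)
    (integrable_norm_sq f).aestronglyMeasurable]
  have e : ∀ x, ENNReal.ofReal (‖f x‖ ^ 2) = ‖f x‖ₑ ^ 2 := fun x => by
    rw [ENNReal.ofReal_pow (norm_nonneg _), ofReal_norm]
  simp_rw [e, h]
  rw [ENNReal.toReal_pow, toReal_enorm]

theorem memLp_mul_fnOf {m : EuclideanSpace ℝ (Fin N) → ℝ} (hm : Continuous m) {K : ℝ}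
    (hK : ∀ x, |m x| ≤ K * ‖x‖) (u : SigmaSpace N) :
    MemLp (fun x => ((m x : ℝ) : ℂ) * fnOf u x) 2 volume := by
  refine (Lp.memLp (weightL2 N u)).of_le_mul (c := K) ?_ ?_
  · exact ((Complex.continuous_ofReal.comp hm).stronglyMeasurable.mul
      (stronglyMeasurable_fnOf u)).aestronglyMeasurable
  · filter_upwards [coe_weightL2 u] with x hx
    rw [hx, norm_mul, norm_mul, Complex.norm_real, Complex.norm_real, norm_norm, ← mul_assoc]
    gcongr
    exact hK x

theorem toLp_mul_fnOf_add {m : EuclideanSpace ℝ (Fin N) → ℝ} (hm : Continuous m) {K : ℝ}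
    (hK : ∀ x, |m x| ≤ K * ‖x‖) (u v : SigmaSpace N) :
    (memLp_mul_fnOf hm hK (u + v)).toLp =
      (memLp_mul_fnOf hm hK u).toLp + (memLp_mul_fnOf hm hK v).toLp := by
  refine Lp.ext ?_
  filter_upwards [fnOf_add u v, (memLp_mul_fnOf hm hK (u + v)).coeFn_toLp,
    (memLp_mul_fnOf hm hK u).coeFn_toLp, (memLp_mul_fnOf hm hK v).coeFn_toLp,
    Lp.coeFn_add (memLp_mul_fnOf hm hK u).toLp (memLp_mul_fnOf hm hK v).toLp] with x h1 h2 h3 h4 h5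
  rw [h5, Pi.add_apply, h2, h3, h4, h1, mul_add]

theorem toLp_mul_fnOf_smul {m : EuclideanSpace ℝ (Fin N) → ℝ} (hm : Continuous m) {K : ℝ}
    (hK : ∀ x, |m x| ≤ K * ‖x‖) (c : ℝ) (u : SigmaSpace N) :
    (memLp_mul_fnOf hm hK (c • u)).toLp = c • (memLp_mul_fnOf hm hK u).toLp := by
  refine Lp.ext ?_
  filter_upwards [fnOf_smul c u, (memLp_mul_fnOf hm hK (c • u)).coeFn_toLp,
    (memLp_mul_fnOf hm hK u).coeFn_toLp,
    Lp.coeFn_smul c (memLp_mul_fnOf hm hK u).toLp] with x h1 h2 h3 h5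
  rw [h5, Pi.smul_apply, h2, h3, h1, mul_smul_comm]

theorem norm_toLp_mul_fnOf_le {m : EuclideanSpace ℝ (Fin N) → ℝ} (hm : Continuous m) {K : ℝ}
    (hK : ∀ x, |m x| ≤ K * ‖x‖) (u : SigmaSpace N) :
    ‖(memLp_mul_fnOf hm hK u).toLp‖ ≤ |K| * ‖u‖ := by
  have h : ‖(memLp_mul_fnOf hm hK u).toLp‖ ≤ |K| * ‖weightL2 N u‖ := by
    refine Lp.norm_le_mul_norm_of_ae_le_mul ?_
    filter_upwards [coe_weightL2 u, (memLp_mul_fnOf hm hK u).coeFn_toLp] with x hx hx'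
    rw [hx, hx', norm_mul, norm_mul, Complex.norm_real, Complex.norm_real, norm_norm,
      ← mul_assoc]
    gcongr
    exact (hK x).trans (by gcongr; exact le_abs_self K)
  exact h.trans (by gcongr; exact norm_weightL2_le u)

/-- Multiplication by a function of at most linear growth, as a continuous linear map from the
energy space to `L²`. -/
noncomputable def mulL2 (m : EuclideanSpace ℝ (Fin N) → ℝ) (hm : Continuous m) (K : ℝ)
    (hK : ∀ x, |m x| ≤ K * ‖x‖) :
    SigmaSpace N →L[ℝ] Lp ℂ 2 (volume : Measure (EuclideanSpace ℝ (Fin N))) :=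
  LinearMap.mkContinuous
    { toFun := fun u => (memLp_mul_fnOf hm hK u).toLp
      map_add' := toLp_mul_fnOf_add hm hK
      map_smul' := toLp_mul_fnOf_smul hm hK }
    |K| (norm_toLp_mul_fnOf_le hm hK)

theorem coe_mulL2 {m : EuclideanSpace ℝ (Fin N) → ℝ} (hm : Continuous m) {K : ℝ}
    (hK : ∀ x, |m x| ≤ K * ‖x‖) (u : SigmaSpace N) :
    (mulL2 m hm K hK u : EuclideanSpace ℝ (Fin N) → ℂ) =ᵐ[volume]
      fun x => ((m x : ℝ) : ℂ) * fnOf u x :=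
  (memLp_mul_fnOf hm hK u).coeFn_toLp

/-- The map `u ↦ a ∂ⱼu` from the energy space to `L²`, for a complex constant `a`. -/
noncomputable def partialL2 (a : ℂ) (j : Fin N) :
    SigmaSpace N →L[ℝ] Lp ℂ 2 (volume : Measure (EuclideanSpace ℝ (Fin N))) :=
  (((a • (EuclideanSpace.proj j : EuclideanSpace ℂ (Fin N) →L[ℂ] ℂ)).restrictScalars ℝ).compLpL
    2 volume).comp (gradL2 N)

theorem coe_partialL2 (a : ℂ) (j : Fin N) (u : SigmaSpace N) :
    (partialL2 a j u : EuclideanSpace ℝ (Fin N) → ℂ) =ᵐ[volume] fun x => a * gradOf u x j := by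
  refine (ContinuousLinearMap.coeFn_compLpL _ _).trans (Eventually.of_forall fun x => ?_)
  rfl

/-- Multiplication by the coordinate `xⱼ`. -/
noncomputable def coordL2 (j : Fin N) :
    SigmaSpace N →L[ℝ] Lp ℂ 2 (volume : Measure (EuclideanSpace ℝ (Fin N))) :=
  mulL2 (fun x => x j) (by fun_prop) 1 fun x => by
    rw [one_mul]; exact PiLp.norm_apply_le x j

/-- Multiplication by the `j`-th component of the rotation field `Ω ∧ x`. -/
noncomputable def rotL2 (hN : N = 2 ∨ N = 3) (Ω : EuclideanSpace ℝ (Fin 3)) (j : Fin N) :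
    SigmaSpace N →L[ℝ] Lp ℂ 2 (volume : Measure (EuclideanSpace ℝ (Fin N))) :=
  mulL2 (rotCoeff Ω j) (continuous_rotCoeff Ω j) ‖Ω‖ (abs_rotCoeff_le hN Ω j)

theorem coe_coordL2 (j : Fin N) (u : SigmaSpace N) :
    (coordL2 j u : EuclideanSpace ℝ (Fin N) → ℂ) =ᵐ[volume]
      fun x => ((x j : ℝ) : ℂ) * fnOf u x :=
  coe_mulL2 _ _ u

theorem coe_rotL2 (hN : N = 2 ∨ N = 3) (Ω : EuclideanSpace ℝ (Fin 3)) (j : Fin N)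
    (u : SigmaSpace N) :
    (rotL2 hN Ω j u : EuclideanSpace ℝ (Fin N) → ℂ) =ᵐ[volume]
      fun x => ((rotCoeff Ω j x : ℝ) : ℂ) * fnOf u x :=
  coe_mulL2 _ _ u

-- From here on these maps are determined by their almost everywhere formulas.
attribute [irreducible] mulL2 partialL2 coordL2 rotL2

/-- The symmetric bilinear form whose quadratic form is `𝔱[u] + ω ‖u‖₂²`. -/
noncomputable def energyForm (hN : N = 2 ∨ N = 3) (γ : Fin N → ℝ) (Ω : EuclideanSpace ℝ (Fin 3))
    (ω : ℝ) : SigmaSpace N →L[ℝ] SigmaSpace N →L[ℝ] ℝ :=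
  formSum (partialL2 1) coordL2 (rotL2 hN Ω) (partialL2 Complex.I) (fun j => γ j ^ 2) (toL2 N) ω

theorem integral_norm_fnOf_sq (u : SigmaSpace N) : ∫ x, ‖fnOf u x‖ ^ 2 = ‖toL2 N u‖ ^ 2 :=
  integral_norm_sq_eq (toL2 N u)

theorem integral_norm_gradOf_sq (u : SigmaSpace N) :
    ∫ x, ‖gradOf u x‖ ^ 2 = ∑ j, ‖partialL2 1 j u‖ ^ 2 := by
  simp_rw [← integral_norm_sq_eq]
  rw [← integral_finsetSum _ fun j _ => integrable_norm_sq _]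
  refine integral_congr_ae ?_
  have h : ∀ᵐ x, ∀ j, partialL2 1 j u x = 1 * gradOf u x j :=
    ae_all_iff.2 fun j => coe_partialL2 1 j u
  filter_upwards [h] with x hx
  simp_rw [hx, one_mul]
  exact EuclideanSpace.norm_sq_eq _

theorem harmonicPotential_mul_eq (γ : Fin N → ℝ) (u : SigmaSpace N) :
    (fun x => ∑ j, γ j ^ 2 * ‖coordL2 j u x‖ ^ 2) =ᵐ[volume]
      fun x => harmonicPotential γ x * ‖fnOf u x‖ ^ 2 := by
  have h : ∀ᵐ x, ∀ j, coordL2 j u x = ((x j : ℝ) : ℂ) * fnOf u x :=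
    ae_all_iff.2 fun j => coe_coordL2 j u
  filter_upwards [h] with x hx
  simp_rw [hx, harmonicPotential, Finset.sum_mul, norm_mul, mul_pow, Complex.norm_real,
    Real.norm_eq_abs, sq_abs, mul_assoc]

theorem integrable_harmonicPotential_mul (γ : Fin N → ℝ) (u : SigmaSpace N) :
    Integrable fun x => harmonicPotential γ x * ‖fnOf u x‖ ^ 2 := by
  have hi : Integrable fun x => ∑ j, γ j ^ 2 * ‖coordL2 j u x‖ ^ 2 :=
    integrable_finsetSum _ fun j _ => (integrable_norm_sq _).const_mul _
  exact hi.congr (harmonicPotential_mul_eq γ u)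

theorem integral_potential (γ : Fin N → ℝ) (u : SigmaSpace N) :
    ∫ x, harmonicPotential γ x * ‖fnOf u x‖ ^ 2 =
      ∑ j, γ j ^ 2 * ‖coordL2 j u‖ ^ 2 := by
  rw [← integral_congr_ae (harmonicPotential_mul_eq γ u),
    integral_finsetSum _ fun j _ => (integrable_norm_sq _).const_mul _]
  refine Finset.sum_congr rfl fun j _ => ?_
  rw [integral_const_mul, integral_norm_sq_eq]

theorem integrable_mul_conj (f g : Lp ℂ 2 (volume : Measure (EuclideanSpace ℝ (Fin N)))) :
    Integrable fun x => g x * (starRingEnd ℂ) (f x) :=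
  (Lp.memLp g).integrable_mul (Lp.memLp f).star

theorem re_integral_mul_conj (f g : Lp ℂ 2 (volume : Measure (EuclideanSpace ℝ (Fin N)))) :
    (∫ x, g x * (starRingEnd ℂ) (f x)).re = inner ℝ f g := by
  rw [L2.inner_def]
  exact (Complex.reCLM.integral_comp_comm (integrable_mul_conj f g)).symm

theorem rotationOp_mul_conj (hN : N = 2 ∨ N = 3) (Ω : EuclideanSpace ℝ (Fin 3))
    (u : SigmaSpace N) :
    (fun x => rotationOp Ω u x * (starRingEnd ℂ) (fnOf u x)) =ᵐ[volume]
      fun x => ∑ j, partialL2 Complex.I j u x * (starRingEnd ℂ) (rotL2 hN Ω j u x) := by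
  have h1 : ∀ᵐ x, ∀ j, partialL2 Complex.I j u x = Complex.I * gradOf u x j :=
    ae_all_iff.2 fun j => coe_partialL2 Complex.I j u
  have h2 : ∀ᵐ x, ∀ j, rotL2 hN Ω j u x = ((rotCoeff Ω j x : ℝ) : ℂ) * fnOf u x :=
    ae_all_iff.2 fun j => coe_rotL2 hN Ω j u
  filter_upwards [h1, h2] with x hx1 hx2
  rw [rotationOp_eq hN, Finset.sum_mul]
  refine Finset.sum_congr rfl fun j _ => ?_
  rw [hx1, hx2, map_mul, Complex.conj_ofReal]
  ring

theorem rotationForm_eq (hN : N = 2 ∨ N = 3) (Ω : EuclideanSpace ℝ (Fin 3)) (u : SigmaSpace N) :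
    rotationForm Ω u = ∑ j, inner ℝ (rotL2 hN Ω j u) (partialL2 Complex.I j u) := by
  rw [rotationForm, integral_congr_ae (rotationOp_mul_conj hN Ω u),
    integral_finsetSum _ fun j _ => integrable_mul_conj _ _, Complex.re_sum]
  exact Finset.sum_congr rfl fun j _ => re_integral_mul_conj _ _

theorem energyForm_self (hN : N = 2 ∨ N = 3) (γ : Fin N → ℝ) (Ω : EuclideanSpace ℝ (Fin 3))
    (ω : ℝ) (u : SigmaSpace N) :
    energyForm hN γ Ω ω u u = rotForm γ Ω u + ω * ∫ x, ‖fnOf u x‖ ^ 2 := by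
  have h : energyForm hN γ Ω ω u u = _ := formSum_self (partialL2 1) coordL2 (rotL2 hN Ω)
    (partialL2 Complex.I) (fun j => γ j ^ 2) (toL2 N) ω u
  have e : rotForm γ Ω u = (∫ x, ‖gradOf u x‖ ^ 2) +
      (∫ x, harmonicPotential γ x * ‖fnOf u x‖ ^ 2) + 2 * rotationForm Ω u := rfl
  refine h.trans (Eq.trans ?_ (congrArg (· + _) e.symm))
  exact (congrArg₂ (· + ·) (congrArg₂ (· + ·) (congrArg₂ (· + ·) (integral_norm_gradOf_sq u)
    (integral_potential γ u)) (congrArg _ (rotationForm_eq hN Ω u)))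
    (congrArg _ (integral_norm_fnOf_sq u))).symm

theorem energyForm_symm (hN : N = 2 ∨ N = 3) (γ : Fin N → ℝ) (Ω : EuclideanSpace ℝ (Fin 3))
    (ω : ℝ) (u v : SigmaSpace N) : energyForm hN γ Ω ω u v = energyForm hN γ Ω ω v u :=
  formSum_symm (partialL2 1) coordL2 (rotL2 hN Ω) (partialL2 Complex.I) (fun j => γ j ^ 2)
    (toL2 N) ω u v

/-! ### Coercivity -/

theorem sq_mul_norm_weightL2_le {γ : Fin N → ℝ} {g : ℝ} (hg : 0 < g) (hγ : ∀ j, g ≤ γ j)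
    (u : SigmaSpace N) :
    g ^ 2 * ‖weightL2 N u‖ ^ 2 ≤ ∫ x, harmonicPotential γ x * ‖fnOf u x‖ ^ 2 := by
  rw [← integral_norm_sq_eq, ← integral_const_mul]
  refine integral_mono_ae ((integrable_norm_sq _).const_mul _)
    (integrable_harmonicPotential_mul γ u) ?_
  filter_upwards [coe_weightL2 u] with x hx
  rw [hx, norm_mul, Complex.norm_real, norm_norm, mul_pow, ← mul_assoc]
  gcongr
  rw [EuclideanSpace.real_norm_sq_eq, Finset.mul_sum, harmonicPotential]
  gcongr with j
  exact hγ j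

theorem integral_norm_gradL2_add (a b : ℝ) (u : SigmaSpace N) :
    ∫ x, a * (‖gradL2 N u x‖ ^ 2 + b * ‖weightL2 N u x‖ ^ 2) =
      a * (‖gradL2 N u‖ ^ 2 + b * ‖weightL2 N u‖ ^ 2) := by
  have h1 := integral_norm_sq_eq (gradL2 N u)
  have h2 := integral_norm_sq_eq (weightL2 N u)
  have h := integral_add (integrable_norm_sq (gradL2 N u))
    ((integrable_norm_sq (weightL2 N u)).const_mul b)
  rw [integral_const_mul, ← h1, ← h2]
  exact congrArg _ (h.trans (congrArg _ (integral_const_mul _ _)))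

theorem integrable_norm_gradL2_add (a b : ℝ) (u : SigmaSpace N) :
    Integrable fun x => a * (‖gradL2 N u x‖ ^ 2 + b * ‖weightL2 N u x‖ ^ 2) :=
  ((integrable_norm_sq _).add ((integrable_norm_sq _).const_mul _)).const_mul _

theorem norm_rotationOp_mul_conj_le (hN : N = 2 ∨ N = 3) {g : ℝ} (hg : 0 < g)
    (Ω : EuclideanSpace ℝ (Fin 3)) (u : SigmaSpace N) :
    ∀ᵐ x, ‖rotationOp Ω u x * (starRingEnd ℂ) (fnOf u x)‖ ≤
      ‖Ω‖ / g / 2 * (‖gradL2 N u x‖ ^ 2 + g ^ 2 * ‖weightL2 N u x‖ ^ 2) := by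
  filter_upwards [coe_weightL2 u] with x hx
  rw [hx, coe_gradL2, norm_mul, norm_mul, RCLike.norm_conj, Complex.norm_real, norm_norm]
  have h := mul_le_mul_of_nonneg_right (norm_rotationOp_le hN Ω u x) (norm_nonneg (fnOf u x))
  refine h.trans ?_
  generalize ‖gradOf u x‖ = a
  generalize ‖fnOf u x‖ = b
  calc _ = ‖Ω‖ / g / 2 * (2 * a * (g * (‖x‖ * b))) := by field_simp
    _ ≤ ‖Ω‖ / g / 2 * (a ^ 2 + (g * (‖x‖ * b)) ^ 2) := by
        gcongr
        exact two_mul_le_add_sq _ _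
    _ = _ := by ring

theorem two_mul_abs_rotationForm_le (hN : N = 2 ∨ N = 3) {g : ℝ} (hg : 0 < g)
    (Ω : EuclideanSpace ℝ (Fin 3)) (u : SigmaSpace N) :
    2 * |rotationForm Ω u| ≤ ‖Ω‖ / g * (‖gradL2 N u‖ ^ 2 + g ^ 2 * ‖weightL2 N u‖ ^ 2) := by
  have h1 := norm_integral_le_of_norm_le (integrable_norm_gradL2_add (‖Ω‖ / g / 2) (g ^ 2) u)
    (norm_rotationOp_mul_conj_le hN hg Ω u)
  rw [integral_norm_gradL2_add] at h1
  have h2 : |rotationForm Ω u| ≤ ‖∫ x, rotationOp Ω u x * (starRingEnd ℂ) (fnOf u x)‖ :=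
    Complex.abs_re_le_norm _
  refine (mul_le_mul_of_nonneg_left (h2.trans h1) two_pos.le).trans_eq ?_
  generalize ‖gradL2 N u‖ ^ 2 = a
  generalize ‖weightL2 N u‖ ^ 2 = b
  ring

/-- Below the trapping frequency, `2 |l_Ω(u)|` is a fraction of the harmonic oscillator energy,
by `2 |Ω ∧ x| |u| |∇u| ≤ (|Ω| / g) (|∇u|² + g² |x|² |u|²)`. -/
theorem rotForm_ge (hN : N = 2 ∨ N = 3) {γ : Fin N → ℝ} {g : ℝ} (hg : 0 < g) (hγ : ∀ j, g ≤ γ j)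
    (Ω : EuclideanSpace ℝ (Fin 3)) (u : SigmaSpace N) :
    (1 - ‖Ω‖ / g) * (‖gradL2 N u‖ ^ 2 + g ^ 2 * ‖weightL2 N u‖ ^ 2) ≤ rotForm γ Ω u := by
  have hG : ∫ x, ‖gradOf u x‖ ^ 2 = ‖gradL2 N u‖ ^ 2 := integral_norm_sq_eq (gradL2 N u)
  have hV := sq_mul_norm_weightL2_le hg hγ u
  have hl := two_mul_abs_rotationForm_le hN hg Ω u
  have h3 := neg_abs_le (rotationForm Ω u)
  rw [rotForm, hG]
  generalize ‖gradL2 N u‖ ^ 2 = a at *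
  generalize g ^ 2 * ‖weightL2 N u‖ ^ 2 = b at *
  linarith

theorem rotForm_smul (hN : N = 2 ∨ N = 3) (γ : Fin N → ℝ) (Ω : EuclideanSpace ℝ (Fin 3)) (c : ℝ)
    (u : SigmaSpace N) : rotForm γ Ω (c • u) = c ^ 2 * rotForm γ Ω u := by
  have h := fun v => energyForm_self hN γ Ω 0 v
  simp only [zero_mul, add_zero] at h
  rw [← h, ← h]
  simp only [map_smul, smul_apply, smul_eq_mul]
  ring

theorem neg_lambdaZero_mul_le (hN : N = 2 ∨ N = 3) {γ : Fin N → ℝ} {Ω : EuclideanSpace ℝ (Fin 3)}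
    (hpos : ∀ u, 0 ≤ rotForm γ Ω u) (u : SigmaSpace N) :
    -lambdaZero γ Ω * ‖toL2 N u‖ ^ 2 ≤ rotForm γ Ω u := by
  rcases eq_or_ne (toL2 N u) 0 with h0 | h0
  · rw [h0, norm_zero]
    simpa using hpos u
  · have hn : 0 < ‖toL2 N u‖ := norm_pos_iff.2 h0
    have h1 : -lambdaZero γ Ω ≤ rotForm γ Ω (‖toL2 N u‖⁻¹ • u) := by
      rw [lambdaZero, neg_neg]
      refine csInf_le ⟨0, ?_⟩ ⟨_, ?_, rfl⟩
      · rintro _ ⟨v, -, rfl⟩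
        exact hpos v
      · rw [integral_norm_fnOf_sq, map_smul, norm_smul, norm_inv, norm_norm,
          inv_mul_cancel₀ hn.ne', one_pow]
    rw [rotForm_smul hN, inv_pow, inv_mul_eq_div, le_div_iff₀ (by positivity)] at h1
    exact h1

/-- The arithmetic of coercivity: part of the lower bound `t ≥ -l U²` is traded for the lower bound
of `t` by `G² + g² W²`. -/
theorem exists_coercive_const {κ g l ω : ℝ} (hκ : 0 < κ) (hg : 0 < g) (hω : l < ω) :
    ∃ c, 0 < c ∧ ∀ G W U t : ℝ, κ * (G ^ 2 + g ^ 2 * W ^ 2) ≤ t → -l * U ^ 2 ≤ t →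
      c * (U ^ 2 + (G ^ 2 + W ^ 2)) ≤ t + ω * U ^ 2 := by
  set δ := ω - l with hδd
  have hδ : 0 < δ := sub_pos.2 hω
  -- The share of the second bound given up for the first: small enough that half of the gap
  -- `δ = ω - l` is left in front of `U²`.
  set θ := δ / (2 * (|l| + δ)) with hθd
  have hl0 : 0 ≤ |l| := abs_nonneg l
  have hθ : 0 < θ := by positivity
  have hθeq : θ * (|l| + δ) = δ / 2 := by rw [hθd]; field_simp
  have hθ1 : θ < 1 := by nlinarith
  have hθl : δ / 2 ≤ δ + θ * l := by
    have := neg_abs_le l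
    nlinarith
  refine ⟨min (θ * κ) (min (θ * κ * g ^ 2) (δ / 2)), by positivity, fun G W U t hge hl => ?_⟩
  set c := min (θ * κ) (min (θ * κ * g ^ 2) (δ / 2)) with hc
  have hc1 : c ≤ θ * κ := min_le_left _ _
  have hc2 : c ≤ θ * κ * g ^ 2 := (min_le_right _ _).trans (min_le_left _ _)
  have hc3 : c ≤ δ / 2 := (min_le_right _ _).trans (min_le_right _ _)
  have h1 := mul_le_mul_of_nonneg_left hge hθ.le
  have h2 := mul_le_mul_of_nonneg_left hl (sub_pos.2 hθ1).le
  have e1 := mul_le_mul_of_nonneg_right hc1 (sq_nonneg G)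
  have e2 := mul_le_mul_of_nonneg_right hc2 (sq_nonneg W)
  have e3 := mul_le_mul_of_nonneg_right (hc3.trans hθl) (sq_nonneg U)
  have e4 : (1 - θ) * (-l * U ^ 2) + ω * U ^ 2 = (δ + θ * l) * U ^ 2 := by rw [hδd]; ring
  have e5 : θ * (κ * (G ^ 2 + g ^ 2 * W ^ 2)) = θ * κ * G ^ 2 + θ * κ * g ^ 2 * W ^ 2 := by ring
  linarith

theorem exists_coercive (hN : N = 2 ∨ N = 3) {γ : Fin N → ℝ} {g : ℝ} (hγ : ∀ j, g ≤ γ j)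
    {Ω : EuclideanSpace ℝ (Fin 3)} (hΩ : ‖Ω‖ < g) {ω : ℝ} (hω : lambdaZero γ Ω < ω) :
    ∃ c, 0 < c ∧ ∀ u : SigmaSpace N, c * ‖u‖ ^ 2 ≤ energyForm hN γ Ω ω u u := by
  have hg : 0 < g := (norm_nonneg Ω).trans_lt hΩ
  have hκ : 0 < 1 - ‖Ω‖ / g := by rw [sub_pos, div_lt_one hg]; exact hΩ
  have hge := rotForm_ge hN hg hγ Ω
  have hpos : ∀ u : SigmaSpace N, 0 ≤ rotForm γ Ω u := fun u =>
    le_trans (by positivity) (hge u)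
  obtain ⟨c, hc, h⟩ := exists_coercive_const hκ hg hω
  refine ⟨c, hc, fun u => ?_⟩
  rw [energyForm_self, integral_norm_fnOf_sq, norm_sq_eq]
  exact h _ _ _ _ (hge u) (neg_lambdaZero_mul_le hN hpos u)

end SigmaSpace

/-! ### Ground states -/

/-- The conclusions for an abstract Nehari problem, with its functionals given by formulas `S` and
`I`. -/
theorem NehariData.groundStates_nonempty_and_eq_and_pos {H : Type*} [NormedAddCommGroup H]
    [NormedSpace ℝ H] [Nontrivial H] (D : NehariData H) {S I : H → ℝ} (hS : D.action = S)
    (hI : D.nehari = I) :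
    {φ | (φ ≠ 0 ∧ HasFDerivAt S (0 : H →L[ℝ] ℝ) φ) ∧
        ∀ v, v ≠ 0 ∧ HasFDerivAt S (0 : H →L[ℝ] ℝ) v → S φ ≤ S v}.Nonempty ∧
      {φ | (φ ≠ 0 ∧ HasFDerivAt S (0 : H →L[ℝ] ℝ) φ) ∧
          ∀ v, v ≠ 0 ∧ HasFDerivAt S (0 : H →L[ℝ] ℝ) v → S φ ≤ S v} =
        {φ | S φ = sInf {r | ∃ u : H, u ≠ 0 ∧ I u = 0 ∧ r = S u} ∧ I φ = 0} ∧
      0 < sInf {r | ∃ u : H, u ≠ 0 ∧ I u = 0 ∧ r = S u} := by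
  subst hS hI
  exact ⟨D.groundStates_eq.symm ▸ D.exists_minimizer, D.groundStates_eq, D.level_pos⟩

namespace SigmaSpace

variable {N : ℕ}

theorem add_one_lt_six {p : ℝ} (hp' : (p : EReal) < critExponent N) (h3 : N = 3) : p + 1 < 6 := by
  subst h3
  rw [critExponent, if_neg (by norm_num), EReal.coe_lt_coe_iff] at hp'
  norm_num at hp'
  linarith

/-- The action and the Nehari functional of the rotating problem come from an abstract Nehari
problem on the energy space. -/
theorem exists_nehariData (hN : N = 2 ∨ N = 3) {p : ℝ} (hp : 1 < p)
    (hp' : (p : EReal) < critExponent N) {γ : Fin N → ℝ} {Ω : EuclideanSpace ℝ (Fin 3)}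
    (hΩ : ‖Ω‖ < ⨅ j, γ j) {ω : ℝ} (hω : lambdaZero γ Ω < ω) :
    ∃ D : NehariData (SigmaSpace N), D.action = actionS p γ Ω ω ∧ D.nehari = nehariI p γ Ω ω := by
  have hq2 : 2 < p + 1 := by linarith
  have hq := add_one_lt_six hp'
  obtain ⟨c, hc, hcoer⟩ :=
    exists_coercive hN (fun j => ciInf_le (Finite.bddBelow_range γ) j) hΩ hω
  obtain ⟨C, -, hC⟩ := exists_powInt_le hN hq2 hq
  refine ⟨{ B := energyForm hN γ Ω ω
            P := powInt (p + 1)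
            q := p + 1
            c := c
            C := C
            symm := energyForm_symm hN γ Ω ω
            c_pos := hc
            coercive := hcoer
            two_lt := hq2
            homog := powInt_smul
            pos := powInt_pos hN hq2 hq
            growth := hC
            differentiable := differentiableAt_powInt hN hq2 hq
            weakCont := powInt_weakCont hN hq2 hq
            weakCompact := weakCompact }, ?_, ?_⟩
  · funext u
    refine (congrArg (1 / 2 * · - 2 / (p + 1) * powInt (p + 1) u)
      (energyForm_self hN γ Ω ω u)).trans ?_
    rw [actionS]
    change _ - 2 / (p + 1) * (∫ x, ‖fnOf u x‖ ^ (p + 1)) = _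
    ring
  · funext u
    exact congrArg (· - 2 * powInt (p + 1) u) (energyForm_self hN γ Ω ω u)

end SigmaSpace

theorem proposition1p5 (N : ℕ) (hN : N = 2 ∨ N = 3)
    (p : ℝ) (hp : 1 < p) (hp' : (p : EReal) < critExponent N)
    (γ : Fin N → ℝ) (hγ : ∀ j, 0 < γ j)
    (Ω : EuclideanSpace ℝ (Fin 3)) (hΩ₂ : N = 2 → Ω 0 = 0 ∧ Ω 1 = 0)
    (hΩ : ‖Ω‖ < ⨅ j, γ j)
    (ω : ℝ) (hω : lambdaZero γ Ω < ω) :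
    (groundStates p γ Ω ω).Nonempty ∧
      groundStates p γ Ω ω =
        {φ : SigmaSpace N | actionS p γ Ω ω φ = nehariLevel p γ Ω ω ∧ nehariI p γ Ω ω φ = 0} ∧
      0 < nehariLevel p γ Ω ω := by

  obtain ⟨D, hS, hI⟩ := SigmaSpace.exists_nehariData hN hp hp' hΩ hω
  exact D.groundStates_nonempty_and_eq_and_pos hS hI
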